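/- **Setting.** Let $\mathcal X,\mathcal Y,\mathcal Z$ be finite alphabets with a fixed embedding $\mathcal X\hookrightarrow\mathcal Y$ (so $|\mathcal Y|\ge|\mathcal X|$), $G$ a probability distribution on $\mathcal X$, $W=\{W(z|x)\}$ a channel from $\mathcal X$ to $\mathcal Z$, and $R_I>0$. All logarithms are natural, $[t]_+=\max\{0,t\}$, divergences may be $+\infty$, and $\hat P$ denotes empirical distributions. *Choice of conditional types.* Let $\Delta,\epsilon>0$. For block length $n$, a choice $c_n$ assigns to each type $Q_X$ of sequences in $\mathcal X^n$ a joint type $Q_{XY}$ of sequences in $(\mathcal X\times\mathcal Y)^n$ with $X$-marginal $Q_X$ (that is, a conditional type $Q_{Y|X}$). It is admissible if $Y\equiv X$ whenever $H_Q(X)<\sqrt\Delta$, $H_Q(X|Y)\ge\Delta+3\epsilon$ whenever $H_Q(X)\ge\sqrt\Delta$, and the induced map $Q_X\mapsto Q_Y$ is one-to-one on the types of length $n$. *Ensemble of encoders.* For each type with $H_Q(X)\ge\sqrt\Delta$, a subcode $\mathcal C_Q$ of $\lceil e^{n[I_Q(X;Y)+\Delta]}\rceil$ vectors is drawn independently and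 uniformly from the type class $\mathcal T(Q_Y)$; for each $\mathbf x\in\mathcal X^n$, a uniformly random ordering of the conditional type class $\mathcal T(Q_{Y|X}|\mathbf x)$ is drawn; all draws are independent. A sequence $\mathbf x$ with $H_Q(X)<\sqrt\Delta$ is encoded as $f(\mathbf x)=\mathbf x$; any other $\mathbf x$ is encoded as the member of $\mathcal T(Q_{Y|X}|\mathbf x)\cap\mathcal C_Q$ of smallest rank, or as an error message if this set is empty. Let $\mathcal C$ be the set of all vectors of all subcodes, together with all $\mathbf x$ with $H_Q(X)<\sqrt\Delta$. *Identification.* $M=\lceil e^{nR_I}\rceil$ vectors $\mathbf x_1,\dots,\mathbf x_M$ are drawn i.i.d. from $G^n$ and $\mathbf y_j=f(\mathbf x_j)$ are stored. An index $m$ is drawn uniformly, and $\mathbf z\in\mathcal Z^n$ is the output of the memoryless channel $W$ for the input $\mathbf x_m$. The decoder minimizes over $j$ the metric $\log N(\mathbf y_j|\mathbf z)-n\alpha(\hat P_{\mathbf y_j})$, where $N(\mathbf y|\mathbf z)$ is the number of $\mathbf y'\in\mathcal C$ with $\hat P_{\mathbf y'\mathbf z}=\hat P_{\mathbf y\mathbf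 z}$ and $\alpha(Q_Y)=I_Q(X;Y)+D(Q_X\|G)$, with $Q_X$ the unique type mapped to $Q_Y$. Stored error messages do not compete. An error occurs if $\mathbf y_m$ is the error message or another stored vector has a metric not larger than that of $\mathbf y_m$. Let $\bar P_e(n,\Delta,c_n)$ be the error probability averaged over everything, including the ensemble. *Exponent.* For a map $U:Q_X\mapsto Q_{XY}$ (with $X$-marginal $Q_X$) and a set $S$ of distributions on $\mathcal X$, let $$E(R_I;U,S)=\min_{Q_X\in S}\ \min_{Q_{Z|Y}}\Big\{D(Q_X\|G)+\min_{\tilde Q_{X|YZ}\in\mathcal U(Q_{X|Y})}D(\tilde Q_{XZ|Y}\|Q_{X|Y}\times W|Q_Y)+\max\big\{[I_Q(Y;Z)-I_Q(X;Y)]_+,\,[I_Q(Y;Z)+D(Q_X\|G)-R_I]_+\big\}\Big\},$$ (minima are understood as infima in $[0,\infty]$), where $Q_{XY}=U(Q_X)$, $Q_{Z|Y}$ ranges over all channels from $\mathcal Y$ to $\mathcal Z$, $\tilde Q_{XZ|Y}=Q_{Z|Y}\times\tilde Q_{X|YZ}$, and $\mathcal U(Q_{X|Y})$ is the set of all $\tilde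 Q_{X|YZ}$ with $\sum_zQ_{Z|Y}(z|y)\tilde Q_{X|YZ}(x|y,z)=Q_{X|Y}(x|y)$ for all $x$ and all $y$ with $Q_Y(y)>0$. **Theorem 1.** The random-coding error exponent of this decoder is $E(R_I)$, up to a quantity that vanishes as $n\to\infty$ and then $\Delta\to0$. Precisely: (1) For every $\eta>0$ there is $\Delta_0>0$ such that for all $0<\Delta<\Delta_0$ and $\epsilon>0$, for all sufficiently large $n$ and every admissible choice $c_n$, with $\mathcal P_n(\mathcal X)$ the set of types of length $n$: $E(R_I;c_n,\mathcal P_n(\mathcal X))<\infty$, $\bar P_e(n,\Delta,c_n)>0$ and $$\Big|-\tfrac1n\log\bar P_e(n,\Delta,c_n)-E(R_I;c_n,\mathcal P_n(\mathcal X))\Big|\le\eta .$$ (2) Let $U$ be a continuous map $Q_X\mapsto Q_{XY}$ (with $X$-marginal $Q_X$) on the simplex $\mathcal P(\mathcal X)$ of all distributions on $\mathcal X$. Then $E(R_I;U,\mathcal P(\mathcal X))<\infty$, and for every $\eta>0$ there is $\Delta_0>0$ such that for all $0<\Delta<\Delta_0$, $\epsilon>0$ and every sequence $(c_n)$ that is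 admissible for all large $n$ and satisfies $\max\{\|c_n(Q_X)-U(Q_X)\|_\infty:\ Q_X\in\mathcal P_n(\mathcal X),\,H_Q(X)\ge\sqrt\Delta\}\to0$, for all sufficiently large $n$: $\bar P_e(n,\Delta,c_n)>0$ and $$\Big|-\tfrac1n\log\bar P_e(n,\Delta,c_n)-E(R_I;U,\mathcal P(\mathcal X))\Big|\le\eta .$$ -/

import Mathlib

open scoped ENNReal

namespace VQIdent

noncomputable section

/-! ### Information measures on finite alphabets (natural logarithms) -/

section Info

variable {A B : Type*} [Fintype A] [Fintype B]

/-- Shannon entropy `H(P) = - ∑ a, P a * log (P a)`. -/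
def entropy (P : A → ℝ) : ℝ := ∑ a, Real.negMulLog (P a)

/-- First marginal of a joint distribution. -/
def margFst (Q : A × B → ℝ) : A → ℝ := fun a => ∑ b, Q (a, b)

/-- Second marginal of a joint distribution. -/
def margSnd (Q : A × B → ℝ) : B → ℝ := fun b => ∑ a, Q (a, b)

/-- Conditional entropy `H(first | second) = H(first, second) - H(second)`. -/
def condEntropy (Q : A × B → ℝ) : ℝ := entropy Q - entropy (margSnd Q)

/-- Mutual information `I(first ; second) = H(first) - H(first | second)`. -/
def mutualInfo (Q : A × B → ℝ) : ℝ := entropy (margFst Q) - condEntropy Q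

open Classical in
/-- Relative entropy `D(P ‖ Q) = ∑ a, P a * log (P a / Q a)`,
equal to `∞` unless `P` is absolutely continuous with respect to `Q`. -/
def relEntropy (P Q : A → ℝ) : ℝ≥0∞ :=
  if ∀ a, Q a = 0 → P a = 0 then
    ENNReal.ofReal (∑ a, P a * Real.log (P a / Q a))
  else ⊤

/-- Weighted divergence `D(V ‖ V' | P) = ∑ b, P b * D(V(·|b) ‖ V'(·|b))`. -/
def condRelEntropy (V V' : B → A → ℝ) (P : B → ℝ) : ℝ≥0∞ :=
  ∑ b, ENNReal.ofReal (P b) * relEntropy (V b) (V' b)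

/-- `V b a` is the conditional probability `V(a|b)`. -/
def IsChannel (V : B → A → ℝ) : Prop := ∀ b, V b ∈ stdSimplex ℝ A

end Info

/-! ### Types (empirical distributions) -/

section Types

open Classical in
/-- The empirical distribution of a sequence. -/
def emp {n : ℕ} {A : Type*} (x : Fin n → A) : A → ℝ :=
  fun a => ((Finset.univ.filter (fun i => x i = a)).card : ℝ) / n

/-- The joint empirical distribution of two sequences. -/
def empPair {n : ℕ} {A B : Type*} (x : Fin n → A) (y : Fin n → B) : A × B → ℝ :=
  emp (fun i => (x i, y i))

open Classical in
/-- The set of all types of sequences of length `n` over `A`. -/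
def types (n : ℕ) (A : Type*) [Fintype A] : Finset (A → ℝ) :=
  Finset.univ.image (fun x : Fin n → A => emp x)

open Classical in
/-- The type class `T(P)`. -/
def typeClass {A : Type*} [Fintype A] (n : ℕ) (P : A → ℝ) : Finset (Fin n → A) :=
  Finset.univ.filter (fun x => emp x = P)

end Types

section Model

variable {X Y Z : Type*} [Fintype X] [Fintype Y] [Fintype Z]

/-! ### The error exponent -/

/-- The reverse channel `Q_{X|Y}(x|y)` of a joint distribution of `(X, Y)`. -/
def revChannel (Q : X × Y → ℝ) : Y → X → ℝ := fun y x => Q (x, y) / margSnd Q y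

/-- The joint distribution `Q_Y × Q_{Z|Y}`. -/
def jointYZ (Q : X × Y → ℝ) (V : Y → Z → ℝ) : Y × Z → ℝ :=
  fun p => margSnd Q p.1 * V p.1 p.2

/-- For given `Q = Q_{XY}` and `V = Q_{Z|Y}`: the conditional distributions `T = Q̃_{X|YZ}` with
`∑ z, Q_{Z|Y}(z|y) Q̃_{X|YZ}(x|y,z) = Q_{X|Y}(x|y)` wherever `Q_{X|Y}(·|y)` is defined. -/
def consistentSet (Q : X × Y → ℝ) (V : Y → Z → ℝ) : Set (Y × Z → X → ℝ) :=
  {T | IsChannel T ∧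
    ∀ x y, 0 < margSnd Q y → ∑ z, V y z * T (y, z) x = revChannel Q y x}

/-- The function of `Q_X`, `Q = Q_{XY}` and `V = Q_{Z|Y}` that is minimized in the exponent.
`ENNReal.ofReal` and the subtraction of `ℝ≥0∞` are truncated at `0`, hence are the positive part. -/
def exponentObjective (G : X → ℝ) (W : X → Z → ℝ) (R : ℝ)
    (QX : X → ℝ) (Q : X × Y → ℝ) (V : Y → Z → ℝ) : ℝ≥0∞ :=
  relEntropy QX G
    + (⨅ T ∈ consistentSet Q V,
        condRelEntropy (fun y (p : X × Z) => V y p.2 * T (y, p.2) p.1)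
          (fun y (p : X × Z) => revChannel Q y p.1 * W p.1 p.2) (margSnd Q))
    + max (ENNReal.ofReal (mutualInfo (jointYZ Q V) - mutualInfo Q))
        ((ENNReal.ofReal (mutualInfo (jointYZ Q V)) + relEntropy QX G) - ENNReal.ofReal R)

/-- The exponent for the assignment `U : Q_X ↦ Q_{XY}`, with `Q_X` ranging over `S`. -/
def exponent (G : X → ℝ) (W : X → Z → ℝ) (R : ℝ) (U : (X → ℝ) → (X × Y → ℝ))
    (S : Set (X → ℝ)) : ℝ≥0∞ :=
  ⨅ QX ∈ S, ⨅ V ∈ {V : Y → Z → ℝ | IsChannel V}, exponentObjective G W R QX (U QX) V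

/-! ### The ensemble of lossy encoders -/

open Classical in
/-- The joint distribution of `(X, ι X)`: distortionless reproduction. -/
def identityJoint (ι : X ↪ Y) (QX : X → ℝ) : X × Y → ℝ :=
  fun p => if p.2 = ι p.1 then QX p.1 else 0

/-- The rule `c` assigns to every type `Q_X` of length `n` a joint type `Q_{XY}` of length `n`
(that is, a conditional type `Q_{Y|X}`) in a way that is allowed in the ensemble. -/
structure Admissible (ι : X ↪ Y) (Δ ε : ℝ) (n : ℕ) (c : (X → ℝ) → (X × Y → ℝ)) : Prop where
  isType : ∀ QX ∈ types n X, c QX ∈ types n (X × Y)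
  marginal : ∀ QX ∈ types n X, margFst (c QX) = QX
  lossless : ∀ QX ∈ types n X, entropy QX < √Δ → c QX = identityJoint ι QX
  equivocation : ∀ QX ∈ types n X, √Δ ≤ entropy QX → Δ + 3 * ε ≤ condEntropy (c QX)
  oneToOne : Set.InjOn (fun QX => margSnd (c QX)) (types n X : Set (X → ℝ))

/-- The types `Q_X` whose sequences are encoded by a random subcode. -/
abbrev HighType (X : Type*) [Fintype X] (n : ℕ) (Δ : ℝ) : Type _ :=
  {QX : X → ℝ // QX ∈ types n X ∧ √Δ ≤ entropy QX}

instance (n : ℕ) (Δ : ℝ) : Finite (HighType X n Δ) :=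
  Finite.of_injective (β := {QX : X → ℝ // QX ∈ types n X}) (fun Q => ⟨Q.1, Q.2.1⟩)
    (fun a b h => Subtype.ext (by simpa using h))

instance (n : ℕ) (Δ : ℝ) : Fintype (HighType X n Δ) := Fintype.ofFinite _

/-- The size `e^{n (I_Q(X;Y) + Δ)}` of a subcode. -/
def subcodeSize (n : ℕ) (Δ : ℝ) (Q : X × Y → ℝ) : ℕ :=
  ⌈Real.exp (n * (mutualInfo Q + Δ))⌉₊

open Classical in
/-- The conditional type class `T(Q_{Y|X} | x)`, with `Q_{Y|X}` matched to the type of `x`. -/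
def condTypeClass {n : ℕ} (c : (X → ℝ) → (X × Y → ℝ)) (x : Fin n → X) : Finset (Fin n → Y) :=
  Finset.univ.filter (fun y => empPair x y = c (emp x))

/-- Realizations of all random subcodes: each codeword lies in the type class of `Q_Y`. -/
abbrev Codebooks (n : ℕ) (Δ : ℝ) (c : (X → ℝ) → (X × Y → ℝ)) : Type _ :=
  ∀ Q : HighType X n Δ, Fin (subcodeSize n Δ (c Q.1)) → {y // y ∈ typeClass n (margSnd (c Q.1))}

/-- Realizations of all rankings: an ordering of `T(Q_{Y|X} | x)` for every `x`. -/
abbrev Rankings (n : ℕ) (c : (X → ℝ) → (X × Y → ℝ)) : Type _ :=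
  ∀ x : Fin n → X, {y // y ∈ condTypeClass c x} ≃ Fin (condTypeClass c x).card

/-- The sample space of the ensemble. All codewords are independent and uniform in their type
classes and all rankings are independent and uniform, so the ensemble is the uniform distribution
on this finite product. -/
abbrev Ensemble (n : ℕ) (Δ : ℝ) (c : (X → ℝ) → (X × Y → ℝ)) : Type _ :=
  Codebooks n Δ c × Rankings n c

open Classical in
instance (n : ℕ) (Δ : ℝ) (c : (X → ℝ) → (X × Y → ℝ)) : Fintype (Ensemble n Δ c) :=
  inferInstance

variable {n : ℕ} {Δ : ℝ} {c : (X → ℝ) → (X × Y → ℝ)}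

/-- The vectors of the subcode `C_Q`. -/
def subcode (ω : Ensemble n Δ c) (Q : HighType X n Δ) : Set (Fin n → Y) :=
  {y | ∃ l, (ω.1 Q l : Fin n → Y) = y}

/-- The whole reproduction codebook: the random subcodes and the sequences `y ≡ x`
for `x` of low empirical entropy. -/
def codebook (ι : X ↪ Y) (ω : Ensemble n Δ c) : Set (Fin n → Y) :=
  {y | (∃ Q, y ∈ subcode ω Q) ∨ ∃ x : Fin n → X, entropy (emp x) < √Δ ∧ y = fun i => ι (x i)}

open Classical in
/-- The ranks of those members of `T(Q_{Y|X} | x)` that belong to the subcode of the type of `x`. -/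
def subcodeRanks (ω : Ensemble n Δ c) (x : Fin n → X) : Finset (Fin (condTypeClass c x).card) :=
  Finset.univ.filter (fun j =>
    ∃ Q : HighType X n Δ, Q.1 = emp x ∧ ((ω.2 x).symm j : Fin n → Y) ∈ subcode ω Q)

open Classical in
/-- The lossy encoder `f`; `none` is the error message. -/
def encode (ι : X ↪ Y) (ω : Ensemble n Δ c) (x : Fin n → X) : Option (Fin n → Y) :=
  if entropy (emp x) < √Δ then some (fun i => ι (x i))
  else if h : (subcodeRanks ω x).Nonempty then
    some ((ω.2 x).symm ((subcodeRanks ω x).min' h) : Fin n → Y)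
  else none

/-! ### The universal decoder and its error probability -/

/-- `α(Q_Y) = I_Q(X;Y) + D(Q_X ‖ G)`, with `Q_X` the type that `c` maps to `Q_Y`. It is used only
for the types of stored vectors, for which `D(Q_X ‖ G)` is finite with probability one. -/
def alpha (n : ℕ) (G : X → ℝ) (c : (X → ℝ) → (X × Y → ℝ)) (QY : Y → ℝ) : ℝ :=
  let QX := Function.invFunOn (fun QX => margSnd (c QX)) (types n X : Set (X → ℝ)) QY
  mutualInfo (c QX) + (relEntropy QX G).toReal

/-- `N(y|z)`: the number of codebook vectors in the conditional type class `T(y|z)`. -/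
def numTypical (ι : X ↪ Y) (ω : Ensemble n Δ c) (y : Fin n → Y) (z : Fin n → Z) : ℕ :=
  Set.ncard {y' | y' ∈ codebook ι ω ∧ empPair y' z = empPair y z}

/-- The decoding metric `log N(y|z) - n α(P_y)`. -/
def metric (G : X → ℝ) (ι : X ↪ Y) (ω : Ensemble n Δ c) (y : Fin n → Y) (z : Fin n → Z) : ℝ :=
  Real.log (numTypical ι ω y z) - n * alpha n G c (emp y)

/-- The minimization of the metric over the stored vectors `y_j = f(x_j)` identifies `m`. It does
not if `y_m` is the error message or if some other stored vector has a metric that is as small. -/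
def Identifies (G : X → ℝ) (ι : X ↪ Y) (ω : Ensemble n Δ c) {M : ℕ}
    (x : Fin M → Fin n → X) (m : Fin M) (z : Fin n → Z) : Prop :=
  ∃ y, encode ι ω (x m) = some y ∧
    ∀ j, j ≠ m → ∀ y', encode ι ω (x j) = some y' → metric G ι ω y z < metric G ι ω y' z

/-- The number `e^{nR}` of enrolled vectors. -/
def numEnrolled (n : ℕ) (R : ℝ) : ℕ := ⌈Real.exp (n * R)⌉₊

open Classical in
/-- The error probability for a given encoder: the enrolled vectors are drawn from the memoryless
source `G`, the index `m` is uniform, and `z` is the output of the memoryless channel `W`. -/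
def errorProbGiven (G : X → ℝ) (W : X → Z → ℝ) (R : ℝ) (ι : X ↪ Y) (ω : Ensemble n Δ c) : ℝ :=
  ∑ x : Fin (numEnrolled n R) → Fin n → X, (∏ m, ∏ i, G (x m i)) *
    ((∑ m, ∑ z : Fin n → Z, (∏ i, W (x m i) (z i)) * (if Identifies G ι ω x m z then 0 else 1))
      / numEnrolled n R)

/-- The error probability averaged over the ensemble of encoders. -/
def errorProb (G : X → ℝ) (W : X → Z → ℝ) (R : ℝ) (ι : X ↪ Y) (n : ℕ) (Δ : ℝ)
    (c : (X → ℝ) → (X × Y → ℝ)) : ℝ :=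
  (∑ ω : Ensemble n Δ c, errorProbGiven G W R ι ω) / Fintype.card (Ensemble n Δ c)

end Model

end

end VQIdent

open scoped ENNReal

namespace VQIdent

noncomputable section

set_option linter.unusedSectionVars false

/-! ### Elementary information inequalities -/

section Gibbs

variable {A B : Type*} [Fintype A] [Fintype B]

/-! Write I = I(X;Y), J = I(Y;Z), D = D(P_X‖G) for a joint distribution P of ((X,Y),Z), and let T(P)
= D + D(P_{Z|XY}‖W|P_{XY}) + [D + min(I, J) − R]_+ (`tripleExponent`). The proof shows that the
error probability is the sum of e^{-nT(P)} over the joint types P compatible with the choice of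
conditional types, up to factors e^{n·O(√Δ)} and e^{o(n)}, and that the infimum of T is the stated
exponent.

Error for fixed x, y = f(x), z and a fixed encoder. The other stored vectors are i.i.d., so the
error probability is 1 − (1 − κ)^{M−1}, which is min(1, e^{nR}κ) up to constants, where κ
(`confusion`) is the chance that a single competitor has a metric not larger than that of y. The
source probability of the sequences encoded as y' is at most about e^{-nα(y')}
(`Admissible.fiberProb_le`), so a y' whose metric does not exceed that of y has fibre probability at
most about e^{metric(y)}/N(y'|z). The sum of 1/N(y'|z) over the codebook is at most the number of
joint types (`sum_inv_numTypical_le`), hence κ is at most about N(y|z)e^{-nα(y)}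
(`Admissible.confusion_le`). Conversely, all N(y|z) codewords with the joint type of (y, z) tie with
y (`le_confusion`), and each has a fibre of nearly full probability.

Typical encoder. By Chernoff bounds every source sequence is covered, but by few draws, N(y|z) is
close to e^{n[I−J]_+}, and every codeword reproduces about the expected number of sequences; the
last point needs the lower bound on H(X|Y). The failure probabilities are doubly exponentially
small, so a union bound over exponentially many tuples costs nothing (`Admissible.avg_not_goodCode`,
`Admissible.avg_not_goodEncoder`). Since α = I + D, this gives κ ≈ e^{-n(D + min(I, J))}. For types
of entropy below √Δ the code is the identity, and the entropies and mutual informations that enter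
are at most √Δ.

Averaging. Interchanging two vectors in the random code shows that f(x) is uniform on its
conditional type class, given that x is covered (`Admissible.avg_encode_eq`). The method of types
then evaluates the remaining sum (`typeTerm_bounds`, `typeSum_le`, `le_typeSum`).

The exponent. The stated objective contains J where T contains min(I, J), and has an additional term
[J − I]_+. If J ≤ I the two agree. If J > I, replacing P_{Z|XY} by W removes the channel cost,
brings J to at most I by data processing, and does not increase T. Hence both have the same infimum
(`exponent_isGLB`).

For a continuous functional U the exponents of U and of the choices c_n are compared by carrying
near-minimizers from one problem to the other (`exponent_types_close`): T is uniformly continuous,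
and at marginals of entropy below √Δ the coupling changes T by at most √Δ. -/

lemma sub_le_mul_log_div {p q : ℝ} (hp : 0 ≤ p) (hq : 0 ≤ q) (h : q = 0 → p = 0) :
    p - q ≤ p * Real.log (p / q) := by
  rcases hp.eq_or_lt with rfl | hp
  · simpa using hq
  · have hq' : 0 < q := lt_of_le_of_ne hq (fun e => hp.ne' (h e.symm))
    have h1 := Real.one_sub_inv_le_log_of_pos (div_pos hp hq')
    have h2 := mul_le_mul_of_nonneg_left h1 hp.le
    have h3 : p * (1 - (p / q)⁻¹) = p - q := by field_simp
    linarith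

lemma sum_mul_log_div_nonneg {p q : A → ℝ} (hp : p ∈ stdSimplex ℝ A) (hq : ∀ a, 0 ≤ q a)
    (hq1 : ∑ a, q a ≤ 1) (h : ∀ a, q a = 0 → p a = 0) :
    0 ≤ ∑ a, p a * Real.log (p a / q a) := by
  have h1 : ∑ a, (p a - q a) ≤ ∑ a, p a * Real.log (p a / q a) :=
    Finset.sum_le_sum fun a _ => sub_le_mul_log_div (hp.1 a) (hq a) (h a)
  rw [Finset.sum_sub_distrib, hp.2] at h1
  linarith

/-- The divergence of `q` from `G` as a real number, for `q` absolutely continuous. -/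
def klReal (G q : A → ℝ) : ℝ := -entropy q - ∑ a, q a * Real.log (G a)

lemma sum_mul_log_div_eq_klReal {G q : A → ℝ} (h : ∀ a, G a = 0 → q a = 0) :
    ∑ a, q a * Real.log (q a / G a) = klReal G q := by
  rw [klReal, entropy, ← Finset.sum_neg_distrib, ← Finset.sum_sub_distrib]
  refine Finset.sum_congr rfl fun a _ => ?_
  by_cases hq : q a = 0
  · simp [hq]
  · rw [Real.log_div hq (fun e => hq (h a e)), Real.negMulLog]
    ring

lemma klReal_nonneg {G q : A → ℝ} (hG : G ∈ stdSimplex ℝ A) (hq : q ∈ stdSimplex ℝ A)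
    (h : ∀ a, G a = 0 → q a = 0) : 0 ≤ klReal G q := by
  rw [← sum_mul_log_div_eq_klReal h]
  exact sum_mul_log_div_nonneg hq hG.1 hG.2.le h

lemma relEntropy_eq_ofReal {G q : A → ℝ} (h : ∀ a, G a = 0 → q a = 0) :
    relEntropy q G = ENNReal.ofReal (klReal G q) := by
  rw [relEntropy, if_pos h, sum_mul_log_div_eq_klReal h]

lemma relEntropy_ne_top_iff {G q : A → ℝ} :
    relEntropy q G ≠ ⊤ ↔ ∀ a, G a = 0 → q a = 0 := by
  unfold relEntropy
  split_ifs with h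
  · simpa using h
  · simpa using h

lemma margFst_mem {Q : A × B → ℝ} (hQ : Q ∈ stdSimplex ℝ (A × B)) :
    margFst Q ∈ stdSimplex ℝ A :=
  ⟨fun a => Finset.sum_nonneg fun b _ => hQ.1 _, by
    rw [← hQ.2, Fintype.sum_prod_type]; rfl⟩

lemma margSnd_mem {Q : A × B → ℝ} (hQ : Q ∈ stdSimplex ℝ (A × B)) :
    margSnd Q ∈ stdSimplex ℝ B :=
  ⟨fun a => Finset.sum_nonneg fun b _ => hQ.1 _, by
    rw [← hQ.2, Fintype.sum_prod_type_right]; rfl⟩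

lemma le_margFst {Q : A × B → ℝ} (hQ : ∀ p, 0 ≤ Q p) (a : A) (b : B) :
    Q (a, b) ≤ margFst Q a :=
  Finset.single_le_sum (f := fun b => Q (a, b)) (fun b _ => hQ (a, b)) (Finset.mem_univ b)

lemma le_margSnd {Q : A × B → ℝ} (hQ : ∀ p, 0 ≤ Q p) (a : A) (b : B) :
    Q (a, b) ≤ margSnd Q b :=
  Finset.single_le_sum (f := fun a => Q (a, b)) (fun a _ => hQ (a, b)) (Finset.mem_univ a)

lemma entropy_margFst (Q : A × B → ℝ) :
    entropy (margFst Q) = -∑ p, Q p * Real.log (margFst Q p.1) := by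
  rw [entropy, Fintype.sum_prod_type, ← Finset.sum_neg_distrib]
  refine Finset.sum_congr rfl fun a _ => ?_
  rw [Real.negMulLog, neg_mul]
  exact congrArg Neg.neg (Finset.sum_mul ..)

lemma entropy_margSnd (Q : A × B → ℝ) :
    entropy (margSnd Q) = -∑ p, Q p * Real.log (margSnd Q p.2) := by
  rw [entropy, Fintype.sum_prod_type_right, ← Finset.sum_neg_distrib]
  refine Finset.sum_congr rfl fun a _ => ?_
  rw [Real.negMulLog, neg_mul]
  exact congrArg Neg.neg (Finset.sum_mul ..)

lemma entropy_eq_neg_sum (Q : A → ℝ) : entropy Q = -∑ p, Q p * Real.log (Q p) := by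
  simp [entropy, Real.negMulLog]

lemma mutualInfo_nonneg {Q : A × B → ℝ} (hQ : Q ∈ stdSimplex ℝ (A × B)) : 0 ≤ mutualInfo Q := by
  have h1 : ∑ p, (Q p - margFst Q p.1 * margSnd Q p.2) ≤ mutualInfo Q := by
    rw [mutualInfo, condEntropy, entropy_margFst, entropy_margSnd, entropy_eq_neg_sum]
    have : (-∑ p, Q p * Real.log (margFst Q p.1)) -
        (-∑ p, Q p * Real.log (Q p) - -∑ p, Q p * Real.log (margSnd Q p.2)) =
        ∑ p, (Q p * Real.log (Q p) - Q p * Real.log (margFst Q p.1)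
          - Q p * Real.log (margSnd Q p.2)) := by
      rw [Finset.sum_sub_distrib, Finset.sum_sub_distrib]; ring
    rw [this]
    refine Finset.sum_le_sum fun p _ => ?_
    rcases p with ⟨a, b⟩
    have ha := le_margFst hQ.1 a b
    have hb := le_margSnd hQ.1 a b
    have h0 := hQ.1 (a, b)
    rcases h0.eq_or_lt with h0 | h0
    · simp only [← h0]
      have := mul_nonneg (h0.le.trans ha) (h0.le.trans hb)
      simpa using this
    · have := sub_le_mul_log_div h0.le (q := margFst Q a * margSnd Q b)
        (mul_nonneg (h0.le.trans ha) (h0.le.trans hb))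
        (fun e => absurd e (mul_pos (h0.trans_le ha) (h0.trans_le hb)).ne')
      rw [Real.log_div h0.ne' (mul_pos (h0.trans_le ha) (h0.trans_le hb)).ne',
        Real.log_mul (h0.trans_le ha).ne' (h0.trans_le hb).ne'] at this
      simp only
      linarith
  refine le_trans (le_of_eq ?_) h1
  rw [Finset.sum_sub_distrib, hQ.2, Fintype.sum_prod_type]
  simp only [← Finset.mul_sum, (margSnd_mem hQ).2, mul_one, (margFst_mem hQ).2, sub_self]

lemma entropy_nonneg {q : A → ℝ} (hq : q ∈ stdSimplex ℝ A) : 0 ≤ entropy q :=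
  Finset.sum_nonneg fun a _ => Real.negMulLog_nonneg (hq.1 a)
    (hq.2 ▸ Finset.single_le_sum (fun a _ => hq.1 a) (Finset.mem_univ a))

/-- Conditioning on nothing: `H(second) ≤ H(first, second)`. -/
lemma entropy_margSnd_le {Q : A × B → ℝ} (hQ : Q ∈ stdSimplex ℝ (A × B)) :
    entropy (margSnd Q) ≤ entropy Q := by
  rw [entropy_margSnd, entropy_eq_neg_sum, neg_le_neg_iff]
  refine Finset.sum_le_sum fun p _ => ?_
  rcases (hQ.1 p).eq_or_lt with h0 | h0
  · simp [← h0]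
  · exact mul_le_mul_of_nonneg_left (Real.log_le_log h0 (le_margSnd hQ.1 p.1 p.2)) h0.le

lemma mutualInfo_le_entropy {Q : A × B → ℝ} (hQ : Q ∈ stdSimplex ℝ (A × B)) :
    mutualInfo Q ≤ entropy (margFst Q) := by
  have := entropy_margSnd_le hQ
  rw [mutualInfo, condEntropy]; linarith

lemma continuous_entropy : Continuous (entropy : (A → ℝ) → ℝ) :=
  continuous_finsetSum _ fun a _ => Real.continuous_negMulLog.comp (continuous_apply a)

lemma continuous_margFst : Continuous (margFst : (A × B → ℝ) → A → ℝ) :=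
  continuous_pi fun a => continuous_finsetSum _ fun b _ => continuous_apply (a, b)

lemma continuous_margSnd : Continuous (margSnd : (A × B → ℝ) → B → ℝ) :=
  continuous_pi fun b => continuous_finsetSum _ fun a _ => continuous_apply (a, b)

lemma continuous_mutualInfo : Continuous (mutualInfo : (A × B → ℝ) → ℝ) :=
  (continuous_entropy.comp continuous_margFst).sub
    (continuous_entropy.sub (continuous_entropy.comp continuous_margSnd))

lemma continuous_klReal (G : A → ℝ) : Continuous (klReal G) :=
  continuous_entropy.neg.sub
    (continuous_finsetSum _ fun a _ => (continuous_apply a).mul continuous_const)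

end Gibbs

/-! ### The exponent as an infimum over joint distributions of `((X, Y), Z)` -/

section Triple

variable {X Y Z : Type*} [Fintype X] [Fintype Y] [Fintype Z]

/-- The `(Y, Z)`-marginal of a joint distribution of `((X, Y), Z)`. -/
def margYZ (P : (X × Y) × Z → ℝ) : Y × Z → ℝ := fun p => ∑ x, P ((x, p.1), p.2)

/-- The divergence `D(P_{Z|XY} ‖ W | P_{XY})`, for `P` absolutely continuous. -/
def chanCost (W : X → Z → ℝ) (P : (X × Y) × Z → ℝ) : ℝ :=
  entropy (margFst P) - entropy P - ∑ p, P p * Real.log (W p.1.1 p.2)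

/-- The value of the exponent at a joint distribution of `((X, Y), Z)`. -/
def tripleExponent (G : X → ℝ) (W : X → Z → ℝ) (R : ℝ) (P : (X × Y) × Z → ℝ) : ℝ :=
  klReal G (margFst (margFst P)) + chanCost W P
    + max 0 (klReal G (margFst (margFst P))
      + min (mutualInfo (margFst P)) (mutualInfo (margYZ P)) - R)

/-- The joint distributions over which the exponent is the infimum of `tripleExponent`. -/
structure Feasible (G : X → ℝ) (W : X → Z → ℝ) (U : (X → ℝ) → (X × Y → ℝ)) (S : Set (X → ℝ))
    (P : (X × Y) × Z → ℝ) : Prop where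
  mem_simplex : P ∈ stdSimplex ℝ ((X × Y) × Z)
  mem_set : margFst (margFst P) ∈ S
  coupling : U (margFst (margFst P)) = margFst P
  acG : ∀ a, G a = 0 → margFst (margFst P) a = 0
  acW : ∀ x y z, W x z = 0 → P ((x, y), z) = 0

lemma continuous_margYZ : Continuous (margYZ : ((X × Y) × Z → ℝ) → Y × Z → ℝ) :=
  continuous_pi fun p => continuous_finsetSum _ fun x _ => continuous_apply ((x, p.1), p.2)

/-- The values log G and log W are mere coefficients, with log 0 = 0, so there is no singularity.
The support conditions under which the expression is a genuine divergence are kept apart, in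
`Feasible`. This separation makes compactness of the simplex available later. -/
lemma continuous_tripleExponent (G : X → ℝ) (W : X → Z → ℝ) (R : ℝ) :
    Continuous (tripleExponent G W R : ((X × Y) × Z → ℝ) → ℝ) := by
  have h1 := (continuous_klReal G).comp
    ((continuous_margFst (A := X) (B := Y)).comp (continuous_margFst (A := X × Y) (B := Z)))
  have h2 : Continuous (chanCost W : ((X × Y) × Z → ℝ) → ℝ) :=
    ((continuous_entropy.comp continuous_margFst).sub continuous_entropy).sub
      (continuous_finsetSum _ fun p _ => (continuous_apply p).mul continuous_const)
  have h3 := (continuous_mutualInfo (A := X) (B := Y)).comp (continuous_margFst (B := Z))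
  have h4 := (continuous_mutualInfo (A := Y) (B := Z)).comp (continuous_margYZ (X := X))
  exact (h1.add h2).add (continuous_const.max ((h1.add (h3.min h4)).sub continuous_const))

lemma margYZ_mem {P : (X × Y) × Z → ℝ} (hP : P ∈ stdSimplex ℝ ((X × Y) × Z)) :
    margYZ P ∈ stdSimplex ℝ (Y × Z) := by
  refine ⟨fun p => Finset.sum_nonneg fun x _ => hP.1 _, ?_⟩
  rw [← hP.2, Fintype.sum_prod_type, Fintype.sum_prod_type, Fintype.sum_prod_type]
  simp only [margYZ]
  rw [Finset.sum_comm (s := (Finset.univ : Finset X))]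
  exact Finset.sum_congr rfl fun y _ => Finset.sum_comm

lemma margFst_margYZ (P : (X × Y) × Z → ℝ) : margFst (margYZ P) = margSnd (margFst P) := by
  funext y; exact Finset.sum_comm

lemma margSnd_margYZ (P : (X × Y) × Z → ℝ) : margSnd (margYZ P) = margSnd P := by
  funext z
  simp only [margSnd, margYZ]
  rw [Fintype.sum_prod_type, Finset.sum_comm]

lemma entropy_margYZ (P : (X × Y) × Z → ℝ) :
    entropy (margYZ P) = -∑ p, P p * Real.log (margYZ P (p.1.2, p.2)) := by
  rw [entropy_eq_neg_sum, Fintype.sum_prod_type, Fintype.sum_prod_type, Fintype.sum_prod_type,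
    Finset.sum_comm (s := (Finset.univ : Finset X))]
  refine congrArg Neg.neg (Finset.sum_congr rfl fun y _ => ?_)
  rw [Finset.sum_comm]
  refine Finset.sum_congr rfl fun z _ => ?_
  exact Finset.sum_mul ..

lemma entropy_margFst_margFst (P : (X × Y) × Z → ℝ) :
    entropy (margFst (margFst P)) = -∑ p, P p * Real.log (margFst (margFst P) p.1.1) := by
  rw [entropy_margFst, Fintype.sum_prod_type (f := fun p : (X × Y) × Z => _)]
  refine congrArg Neg.neg (Finset.sum_congr rfl fun y _ => ?_)
  exact Finset.sum_mul ..

lemma le_margYZ {P : (X × Y) × Z → ℝ} (hP : ∀ p, 0 ≤ P p) (x : X) (y : Y) (z : Z) :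
    P ((x, y), z) ≤ margYZ P (y, z) :=
  Finset.single_le_sum (f := fun x => P ((x, y), z)) (fun _ _ => hP _) (Finset.mem_univ x)

/-- Data processing for `Y - X - Z`. -/
lemma mutualInfo_margYZ_le {Q : X × Y → ℝ} (hQ : Q ∈ stdSimplex ℝ (X × Y)) {W : X → Z → ℝ}
    (hW : IsChannel W) {P : (X × Y) × Z → ℝ} (hP : P = fun p => Q p.1 * W p.1.1 p.2) :
    mutualInfo (margYZ P) ≤ mutualInfo Q := by
  have hP0 : ∀ p, 0 ≤ P p := fun p => by
    rw [hP]; exact mul_nonneg (hQ.1 _) ((hW _).1 _)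
  have hPQ : margFst P = Q := by
    funext q; simp only [margFst, hP, ← Finset.mul_sum, (hW _).2, mul_one]
  have hPs : P ∈ stdSimplex ℝ ((X × Y) × Z) :=
    ⟨hP0, by rw [Fintype.sum_prod_type, ← hQ.2]; exact Finset.sum_congr rfl fun q _ => congrFun hPQ q⟩
  -- As P = Q × W, the difference I(X;Y) − I(Y;Z) is the divergence of P from P_X × W × P_{Y|Z}; it
  -- is bounded below termwise by log t ≥ 1 − 1/t.
  have key : ∑ p, (P p - margFst Q p.1.1 * W p.1.1 p.2 * (margYZ P (p.1.2, p.2) / margSnd P p.2)) ≤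
      mutualInfo Q - mutualInfo (margYZ P) := by
    have e : mutualInfo Q - mutualInfo (margYZ P) =
        ∑ p, (P p * Real.log (Q p.1) + P p * Real.log (margSnd P p.2)
          - P p * Real.log (margFst Q p.1.1) - P p * Real.log (margYZ P (p.1.2, p.2))) := by
      rw [Finset.sum_sub_distrib, Finset.sum_sub_distrib, Finset.sum_add_distrib]
      have h1 := entropy_margFst_margFst P
      have h2 := entropy_margFst P
      have h3 := entropy_margSnd P
      have h4 := entropy_margYZ P
      rw [hPQ] at h1 h2
      have h5 := margFst_margYZ P
      rw [hPQ] at h5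
      rw [mutualInfo, mutualInfo, condEntropy, condEntropy, h5, margSnd_margYZ]
      linarith
    rw [e]
    refine Finset.sum_le_sum fun p _ => ?_
    rcases p with ⟨⟨x, y⟩, z⟩
    simp only
    rcases (hP0 ((x, y), z)).eq_or_lt with h0 | h0
    · rw [← h0]
      have : 0 ≤ margFst Q x * W x z * (margYZ P (y, z) / margSnd P z) :=
        mul_nonneg (mul_nonneg ((margFst_mem hQ).1 x) ((hW x).1 z))
          (div_nonneg ((margYZ_mem hPs).1 _) ((margSnd_mem hPs).1 _))
      simpa using this
    · have hpe : P ((x, y), z) = Q (x, y) * W x z := by rw [hP]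
      have hQ0 : 0 < Q (x, y) := by
        rcases (hQ.1 (x, y)).eq_or_lt with h | h
        · rw [hpe, ← h] at h0; simp at h0
        · exact h
      have hX := hQ0.trans_le (le_margFst hQ.1 x y)
      have hZ := h0.trans_le (le_margSnd hP0 (x, y) z)
      have hYZ := h0.trans_le (le_margYZ hP0 x y z)
      have h1 := Real.one_sub_inv_le_log_of_pos
        (div_pos (mul_pos hQ0 hZ) (mul_pos hX hYZ))
      have h2 := mul_le_mul_of_nonneg_left h1 h0.le
      rw [Real.log_div (mul_pos hQ0 hZ).ne' (mul_pos hX hYZ).ne', Real.log_mul hQ0.ne' hZ.ne',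
        Real.log_mul hX.ne' hYZ.ne'] at h2
      have h3 : P ((x, y), z) * (1 - (Q (x, y) * margSnd P z / (margFst Q x * margYZ P (y, z)))⁻¹)
          = P ((x, y), z) - margFst Q x * W x z * (margYZ P (y, z) / margSnd P z) := by
        rw [mul_sub, mul_one]
        congr 1
        rw [hpe]
        field_simp
      linarith
  -- Summation over x and y leaves P_Z(z); where P_Z(z) = 0 the quotient is 0 by convention, which
  -- is harmless.
  have h2 : ∑ p : (X × Y) × Z, margFst Q p.1.1 * W p.1.1 p.2 *
      (margYZ P (p.1.2, p.2) / margSnd P p.2) ≤ 1 := by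
    have hz : ∀ z, ∑ x, margFst Q x * W x z = margSnd P z := by
      intro z
      rw [margSnd, Fintype.sum_prod_type]
      refine Finset.sum_congr rfl fun x _ => ?_
      rw [margFst, Finset.sum_mul]
      simp [hP]
    have hy : ∀ z, ∑ y, margYZ P (y, z) = margSnd P z := fun z => congrFun (margSnd_margYZ P) z
    rw [← (margSnd_mem hPs).2, Fintype.sum_prod_type_right]
    refine Finset.sum_le_sum fun z _ => ?_
    rw [Fintype.sum_prod_type]
    simp only [← Finset.mul_sum, ← Finset.sum_div, hy, ← Finset.sum_mul, hz]
    rcases ((margSnd_mem hPs).1 z).eq_or_lt with h | h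
    · simp [← h]
    · rw [div_self h.ne', mul_one]
  rw [Finset.sum_sub_distrib, hPs.2] at key
  linarith

/-- The joint distribution `Q_Y × Q_{Z|Y} × Q_{X|YZ}`. -/
def tripleOf (Q : X × Y → ℝ) (V : Y → Z → ℝ) (T : Y × Z → X → ℝ) : (X × Y) × Z → ℝ :=
  fun p => margSnd Q p.1.2 * V p.1.2 p.2 * T (p.1.2, p.2) p.1.1

section TripleOf

variable {Q : X × Y → ℝ} {V : Y → Z → ℝ} {T : Y × Z → X → ℝ} {W : X → Z → ℝ}

/-- This is exactly what the constraint in `consistentSet` is for. At letters y with Q_Y(y) = 0,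
where nothing is required, both sides vanish. -/
lemma margFst_tripleOf (hQ : Q ∈ stdSimplex ℝ (X × Y)) (hT : T ∈ consistentSet Q V) :
    margFst (tripleOf Q V T) = Q := by
  funext ⟨x, y⟩
  simp only [margFst, tripleOf, mul_assoc, ← Finset.mul_sum]
  rcases ((margSnd_mem hQ).1 y).eq_or_lt with h | h
  · have := le_margSnd hQ.1 x y
    rw [← h] at this ⊢
    rw [zero_mul]; exact le_antisymm (hQ.1 _) this
  · rw [hT.2 x y h, revChannel]
    field_simp

lemma margYZ_tripleOf (hT : T ∈ consistentSet Q V) :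
    margYZ (tripleOf Q V T) = jointYZ Q V := by
  funext ⟨y, z⟩
  simp only [margYZ, tripleOf, ← Finset.mul_sum, (hT.1 _).2, mul_one, jointYZ]

lemma tripleOf_mem (hQ : Q ∈ stdSimplex ℝ (X × Y)) (hV : IsChannel V)
    (hT : T ∈ consistentSet Q V) : tripleOf Q V T ∈ stdSimplex ℝ ((X × Y) × Z) := by
  refine ⟨fun p => mul_nonneg (mul_nonneg ((margSnd_mem hQ).1 _) ((hV _).1 _)) ((hT.1 _).1 _), ?_⟩
  rw [Fintype.sum_prod_type, ← hQ.2]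
  exact Finset.sum_congr rfl fun q _ => congrFun (margFst_tripleOf hQ hT) q

/-- A finite weighted divergence forces absolute continuity at every y of positive weight, and the
triple puts no mass on the other y. -/
lemma tripleOf_eq_zero_of_ne_top (hQ : Q ∈ stdSimplex ℝ (X × Y))
    (h : condRelEntropy (fun y (p : X × Z) => V y p.2 * T (y, p.2) p.1)
      (fun y (p : X × Z) => revChannel Q y p.1 * W p.1 p.2) (margSnd Q) ≠ ⊤)
    (x : X) (y : Y) (z : Z) (hw : W x z = 0) : tripleOf Q V T ((x, y), z) = 0 := by
  rcases ((margSnd_mem hQ).1 y).eq_or_lt with h0 | h0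
  · simp [tripleOf, ← h0]
  · have h1 := (ENNReal.sum_ne_top.1 h) y (Finset.mem_univ y)
    have h2 : relEntropy (fun p : X × Z => V y p.2 * T (y, p.2) p.1)
        (fun p : X × Z => revChannel Q y p.1 * W p.1 p.2) ≠ ⊤ := by
      intro e
      rw [e, ENNReal.mul_top (by simpa using h0)] at h1
      exact h1 rfl
    have h3 := relEntropy_ne_top_iff.1 h2 (x, z) (by simp [hw])
    simp only [tripleOf]
    rw [mul_assoc, h3, mul_zero]

/-- The conditional law of X given Y under the triple is again Q_{X|Y}, so in the chain rule for the
divergence of (X,Z) given Y only the part of Z given (X,Y) survives. -/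
lemma condRelEntropy_eq_chanCost (hW : IsChannel W) (hQ : Q ∈ stdSimplex ℝ (X × Y))
    (hV : IsChannel V) (hT : T ∈ consistentSet Q V)
    (hac : ∀ x y z, W x z = 0 → tripleOf Q V T ((x, y), z) = 0) :
    condRelEntropy (fun y (p : X × Z) => V y p.2 * T (y, p.2) p.1)
      (fun y (p : X × Z) => revChannel Q y p.1 * W p.1 p.2) (margSnd Q) =
    ENNReal.ofReal (chanCost W (tripleOf Q V T)) := by
  set P := tripleOf Q V T with hPdef
  have hP := tripleOf_mem hQ hV hT
  have hPQ := margFst_tripleOf hQ hT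
  have hY := margSnd_mem hQ
  have acy : ∀ y, 0 < margSnd Q y → ∀ p : X × Z, revChannel Q y p.1 * W p.1 p.2 = 0 →
      V y p.2 * T (y, p.2) p.1 = 0 := by
    rintro y hy ⟨x, z⟩ h0
    have hPz : P ((x, y), z) = 0 := by
      rcases mul_eq_zero.1 h0 with h | h
      · have hq : Q (x, y) = 0 := by
          rw [revChannel, div_eq_zero_iff] at h
          exact h.resolve_right hy.ne'
        have := le_margFst hP.1 (x, y) z
        rw [hPQ, hq] at this
        exact le_antisymm this (hP.1 _)
      · exact hac x y z h
    rw [hPdef, tripleOf, mul_assoc] at hPz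
    exact (mul_eq_zero.1 hPz).resolve_left hy.ne'
  have simp1 : ∀ y, 0 < margSnd Q y →
      (fun p : X × Z => V y p.2 * T (y, p.2) p.1) ∈ stdSimplex ℝ (X × Z) := by
    intro y hy
    refine ⟨fun p => mul_nonneg ((hV _).1 _) ((hT.1 _).1 _), ?_⟩
    rw [Fintype.sum_prod_type_right]
    simp only [← Finset.mul_sum, (hT.1 _).2, mul_one, (hV _).2]
  have nn : ∀ y, 0 < margSnd Q y →
      0 ≤ ∑ p : X × Z, V y p.2 * T (y, p.2) p.1 *
        Real.log (V y p.2 * T (y, p.2) p.1 / (revChannel Q y p.1 * W p.1 p.2)) := by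
    intro y hy
    refine sum_mul_log_div_nonneg (simp1 y hy)
      (fun p => mul_nonneg (div_nonneg (hQ.1 _) hy.le) ((hW _).1 _)) ?_ (acy y hy)
    rw [Fintype.sum_prod_type]
    simp only [← Finset.mul_sum, (hW _).2, mul_one, revChannel, ← Finset.sum_div]
    exact (div_self hy.ne').le
  have term : ∀ y, ENNReal.ofReal (margSnd Q y) *
      relEntropy (fun p : X × Z => V y p.2 * T (y, p.2) p.1)
        (fun p : X × Z => revChannel Q y p.1 * W p.1 p.2) =
      ENNReal.ofReal (margSnd Q y * ∑ p : X × Z, V y p.2 * T (y, p.2) p.1 *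
        Real.log (V y p.2 * T (y, p.2) p.1 / (revChannel Q y p.1 * W p.1 p.2))) := by
    intro y
    rcases (hY.1 y).eq_or_lt with h | h
    · simp [← h]
    · rw [relEntropy, if_pos (acy y h), ENNReal.ofReal_mul h.le]
  rw [condRelEntropy, Finset.sum_congr rfl fun y _ => term y,
    ← ENNReal.ofReal_sum_of_nonneg]
  · congr 1
    rw [chanCost, entropy_margFst, entropy_eq_neg_sum, hPQ]
    have : (-∑ p, P p * Real.log (Q p.1)) - -∑ p, P p * Real.log (P p)
        - ∑ p, P p * Real.log (W p.1.1 p.2) =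
        ∑ p, (P p * Real.log (P p) - P p * Real.log (Q p.1) - P p * Real.log (W p.1.1 p.2)) := by
      rw [Finset.sum_sub_distrib, Finset.sum_sub_distrib]; ring
    rw [this, Fintype.sum_prod_type, Fintype.sum_prod_type_right]
    refine Finset.sum_congr rfl fun y _ => ?_
    rw [Fintype.sum_prod_type, Finset.mul_sum]
    refine Finset.sum_congr rfl fun x _ => ?_
    rw [Finset.mul_sum]
    refine Finset.sum_congr rfl fun z _ => ?_
    have hpe : P ((x, y), z) = margSnd Q y * (V y z * T (y, z) x) := by
      rw [hPdef, tripleOf, mul_assoc]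
    rcases (hP.1 ((x, y), z)).eq_or_lt with h | h
    · have h' : P ((x, y), z) = 0 := h.symm
      simp only [h', zero_mul, sub_zero]
      rw [hpe] at h'
      rw [← mul_assoc, h', zero_mul]
    · change 0 < P ((x, y), z) at h
      have hq : 0 < Q (x, y) := h.trans_le (hPQ ▸ le_margFst hP.1 (x, y) z)
      have hy : 0 < margSnd Q y := hq.trans_le (le_margSnd hQ.1 x y)
      have hw : W x z ≠ 0 := fun e => h.ne' (hac x y z e)
      have e : V y z * T (y, z) x / (revChannel Q y x * W x z) =
          P ((x, y), z) / (Q (x, y) * W x z) := by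
        rw [hpe, revChannel]
        field_simp
      simp only [e]
      rw [← mul_assoc, ← hpe, Real.log_div h.ne' (mul_ne_zero hq.ne' hw),
        Real.log_mul hq.ne' hw]
      ring
  · intro y _
    rcases (hY.1 y).eq_or_lt with h | h
    · simp [← h]
    · exact mul_nonneg h.le (nn y h)

/-- Every joint distribution arises from some `Q_{Z|Y}` and `Q_{X|YZ}`. -/
lemma exists_tripleOf_eq {P : (X × Y) × Z → ℝ} (hP : P ∈ stdSimplex ℝ ((X × Y) × Z))
    {G : X → ℝ} (hG : G ∈ stdSimplex ℝ X) (hW : IsChannel W) :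
    ∃ V : Y → Z → ℝ, ∃ T : Y × Z → X → ℝ, IsChannel V ∧ T ∈ consistentSet (margFst P) V ∧
      tripleOf (margFst P) V T = P := by
  classical
  have hX : Nonempty X := by
    by_contra h
    rw [not_nonempty_iff] at h
    simpa using hG.2
  obtain ⟨x0⟩ := hX
  have hQ := margFst_mem hP
  have hYZ := margYZ_mem hP
  set Q := margFst P with hQdef
  -- The conditional laws of P, with arbitrary distributions (W at some letter, and G) where the
  -- conditioning event has probability zero, because `IsChannel` is required at every letter.
  let V : Y → Z → ℝ := fun y => if 0 < margSnd Q y then fun z => margYZ P (y, z) / margSnd Q y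
    else W x0
  let T : Y × Z → X → ℝ := fun p => if 0 < margYZ P p then
    fun x => P ((x, p.1), p.2) / margYZ P p else G
  have hV : IsChannel V := by
    intro y
    simp only [V]
    split_ifs with h
    · refine ⟨fun z => div_nonneg (hYZ.1 _) h.le, ?_⟩
      rw [← Finset.sum_div]
      have : ∑ z, margYZ P (y, z) = margSnd Q y := congrFun (margFst_margYZ P) y
      rw [this, div_self h.ne']
    · exact hW x0
  have hT : IsChannel T := by
    intro p
    simp only [T]
    split_ifs with h
    · refine ⟨fun x => div_nonneg (hP.1 _) h.le, ?_⟩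
      rw [← Finset.sum_div]
      exact div_self h.ne'
    · exact hG
  have e : ∀ x y z, 0 < margSnd Q y →
      V y z * T (y, z) x = P ((x, y), z) / margSnd Q y := by
    intro x y z hy
    simp only [V, T, if_pos hy]
    split_ifs with h
    · field_simp
    · have h1 : margYZ P (y, z) = 0 := le_antisymm (not_lt.1 h) (hYZ.1 _)
      have h2 := le_margYZ hP.1 x y z
      have h3 : P ((x, y), z) = 0 := le_antisymm (h1 ▸ h2) (hP.1 _)
      simp [h1, h3]
  refine ⟨V, T, hV, ⟨hT, fun x y hy => ?_⟩, ?_⟩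
  · simp only [e x y _ hy, ← Finset.sum_div]
    rfl
  · funext ⟨⟨x, y⟩, z⟩
    simp only [tripleOf]
    rcases ((margSnd_mem hQ).1 y).eq_or_lt with h | h
    · have h1 := le_margFst hP.1 (x, y) z
      have h2 := le_margSnd hQ.1 x y
      rw [← h, zero_mul, zero_mul]
      have := hP.1 ((x, y), z)
      rw [← hQdef] at h1
      linarith
    · rw [mul_assoc, e x y z h]
      field_simp

end TripleOf

variable {G : X → ℝ} {W : X → Z → ℝ} {R : ℝ} {U : (X → ℝ) → (X × Y → ℝ)} {S : Set (X → ℝ)}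

lemma chanCost_nonneg {P : (X × Y) × Z → ℝ} (hW : IsChannel W)
    (hP : P ∈ stdSimplex ℝ ((X × Y) × Z))
    (hac : ∀ x y z, W x z = 0 → P ((x, y), z) = 0) : 0 ≤ chanCost W P := by
  have hQ := margFst_mem hP
  have h := sum_mul_log_div_nonneg (p := P) (q := fun p => margFst P p.1 * W p.1.1 p.2) hP
    (fun p => mul_nonneg (hQ.1 _) ((hW _).1 _)) (by
      rw [Fintype.sum_prod_type]
      simp only [← Finset.mul_sum, (hW _).2, mul_one]
      exact hQ.2.le) (by
      rintro ⟨⟨x, y⟩, z⟩ h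
      rcases mul_eq_zero.1 h with h | h
      · exact le_antisymm (h ▸ le_margFst hP.1 (x, y) z) (hP.1 _)
      · exact hac x y z h)
  refine h.trans_eq ?_
  rw [chanCost, entropy_margFst, entropy_eq_neg_sum]
  have : (-∑ p, P p * Real.log (margFst P p.1)) - -∑ p, P p * Real.log (P p)
        - ∑ p, P p * Real.log (W p.1.1 p.2) =
        ∑ p, (P p * Real.log (P p) - P p * Real.log (margFst P p.1)
          - P p * Real.log (W p.1.1 p.2)) := by
      rw [Finset.sum_sub_distrib, Finset.sum_sub_distrib]; ring
  rw [this]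
  refine Finset.sum_congr rfl ?_
  rintro ⟨⟨x, y⟩, z⟩ -
  rcases (hP.1 ((x, y), z)).eq_or_lt with h | h
  · simp [← h]
  · have hq := h.trans_le (le_margFst hP.1 (x, y) z)
    have hw : W x z ≠ 0 := fun e => h.ne' (hac x y z e)
    simp only
    rw [Real.log_div h.ne' (mul_ne_zero hq.ne' hw), Real.log_mul hq.ne' hw]
    ring

lemma Feasible.klReal_nonneg {P : (X × Y) × Z → ℝ} (hG : G ∈ stdSimplex ℝ X)
    (h : Feasible G W U S P) : 0 ≤ klReal G (margFst (margFst P)) :=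
  VQIdent.klReal_nonneg hG (margFst_mem (margFst_mem h.mem_simplex)) h.acG

lemma Feasible.tripleExponent_nonneg {P : (X × Y) × Z → ℝ} (hG : G ∈ stdSimplex ℝ X)
    (hW : IsChannel W) (h : Feasible G W U S P) : 0 ≤ tripleExponent G W R P :=
  add_nonneg (add_nonneg (h.klReal_nonneg hG) (chanCost_nonneg hW h.mem_simplex h.acW))
    (le_max_left _ _)

/-- Infinite terms cannot violate the bound, and a finite objective comes from a feasible triple.
There it dominates T already through the second argument of its maximum, since min(I, J) ≤ J. -/
lemma ofReal_le_exponent (hW : IsChannel W) (hR : 0 ≤ R)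
    (hU : ∀ q ∈ S, U q ∈ stdSimplex ℝ (X × Y) ∧ margFst (U q) = q) {a : ℝ}
    (h : ∀ P : (X × Y) × Z → ℝ, Feasible G W U S P → a ≤ tripleExponent G W R P) :
    ENNReal.ofReal a ≤ exponent G W R U S := by
  refine le_iInf₂ fun q hq => le_iInf₂ fun V hV => ?_
  obtain ⟨hUs, hUm⟩ := hU q hq
  by_cases hD : relEntropy q G = ⊤
  · simp [exponentObjective, hD]
  have hac := relEntropy_ne_top_iff.1 hD
  rw [exponentObjective]
  simp only [ENNReal.add_iInf, ENNReal.iInf_add]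
  refine le_iInf₂ fun T hT => ?_
  by_cases hC : condRelEntropy (fun y (p : X × Z) => V y p.2 * T (y, p.2) p.1)
      (fun y (p : X × Z) => revChannel (U q) y p.1 * W p.1 p.2) (margSnd (U q)) = ⊤
  · rw [hC]; simp
  have hacW := tripleOf_eq_zero_of_ne_top hUs hC
  have hPQ := margFst_tripleOf hUs hT
  have hP : Feasible G W U S (tripleOf (U q) V T) :=
    ⟨tripleOf_mem hUs hV hT, by rwa [hPQ, hUm], by rw [hPQ, hUm], by rwa [hPQ, hUm], hacW⟩
  rw [condRelEntropy_eq_chanCost hW hUs hV hT hacW, relEntropy_eq_ofReal hac]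
  refine (ENNReal.ofReal_le_ofReal (h _ hP)).trans ?_
  rw [tripleExponent, hPQ, hUm, margYZ_tripleOf hT]
  refine ENNReal.ofReal_add_le.trans (add_le_add ENNReal.ofReal_add_le ?_)
  refine le_trans ?_ (le_max_right _ _)
  refine le_trans ?_ (tsub_le_tsub_right ENNReal.ofReal_add_le _)
  rw [← ENNReal.ofReal_sub _ hR, ENNReal.ofReal_le_ofReal_iff']
  have := min_le_right (mutualInfo (U q)) (mutualInfo (jointYZ (U q) V))
  by_cases h0 : 0 < klReal G q + min (mutualInfo (U q)) (mutualInfo (jointYZ (U q) V)) - R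
  · left; rw [max_eq_right h0.le]; linarith
  · right; rw [max_eq_left (not_lt.1 h0)]

/-- The joint distribution of a coupling and the output of the channel `W` fed by `X`. -/
def chanTriple (Q : X × Y → ℝ) (W : X → Z → ℝ) : (X × Y) × Z → ℝ := fun p => Q p.1 * W p.1.1 p.2

lemma margFst_chanTriple (Q : X × Y → ℝ) (hW : IsChannel W) :
    margFst (chanTriple Q W) = Q := by
  funext q; simp only [margFst, chanTriple, ← Finset.mul_sum, (hW _).2, mul_one]

lemma chanTriple_mem {Q : X × Y → ℝ} (hQ : Q ∈ stdSimplex ℝ (X × Y)) (hW : IsChannel W) :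
    chanTriple Q W ∈ stdSimplex ℝ ((X × Y) × Z) :=
  ⟨fun _ => mul_nonneg (hQ.1 _) ((hW _).1 _), by
    rw [Fintype.sum_prod_type, ← hQ.2]
    exact Finset.sum_congr rfl fun q _ => congrFun (margFst_chanTriple Q hW) q⟩

lemma chanCost_chanTriple (Q : X × Y → ℝ) (hW : IsChannel W) :
    chanCost W (chanTriple Q W) = 0 := by
  rw [chanCost, entropy_margFst, entropy_eq_neg_sum, margFst_chanTriple Q hW]
  have : (-∑ p, chanTriple Q W p * Real.log (Q p.1)) -
        -∑ p, chanTriple Q W p * Real.log (chanTriple Q W p)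
        - ∑ p, chanTriple Q W p * Real.log (W p.1.1 p.2) =
      ∑ p, (chanTriple Q W p * Real.log (chanTriple Q W p) - chanTriple Q W p * Real.log (Q p.1)
        - chanTriple Q W p * Real.log (W p.1.1 p.2)) := by
    rw [Finset.sum_sub_distrib, Finset.sum_sub_distrib]; ring
  rw [this]
  refine Finset.sum_eq_zero fun p _ => ?_
  by_cases h : chanTriple Q W p = 0
  · simp [h]
  · rw [chanTriple] at h ⊢
    rw [Real.log_mul (left_ne_zero_of_mul h) (right_ne_zero_of_mul h)]
    ring

lemma feasible_chanTriple (hW : IsChannel W) {q : X → ℝ} (hq : q ∈ S)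
    (hU : U q ∈ stdSimplex ℝ (X × Y) ∧ margFst (U q) = q) (hac : ∀ a, G a = 0 → q a = 0) :
    Feasible G W U S (chanTriple (U q) W) := by
  have h := margFst_chanTriple (U q) hW
  exact ⟨chanTriple_mem hU.1 hW, by rwa [h, hU.2], by rw [h, hU.2], by rwa [h, hU.2],
    fun x y z h0 => by simp [chanTriple, h0]⟩

/-- Under I(Y;Z) ≤ I(X;Y) the first argument of the maximum is zero and the minimum in T is I(Y;Z),
so disintegrating P yields an admissible pair whose objective does not exceed T(P). -/
lemma exponent_le_of_mutualInfo_le (hG : G ∈ stdSimplex ℝ X) (hW : IsChannel W) (hR : 0 ≤ R)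
    {P : (X × Y) × Z → ℝ} (h : Feasible G W U S P)
    (hI : mutualInfo (margYZ P) ≤ mutualInfo (margFst P)) :
    exponent G W R U S ≤ ENNReal.ofReal (tripleExponent G W R P) := by
  obtain ⟨V, T, hV, hT, hVT⟩ := exists_tripleOf_eq h.mem_simplex hG hW
  have hQ := margFst_mem h.mem_simplex
  refine (iInf₂_le _ h.mem_set).trans ((iInf₂_le V hV).trans ?_)
  rw [exponentObjective, h.coupling]
  have hc := condRelEntropy_eq_chanCost hW hQ hV hT (by rw [hVT]; exact h.acW)
  have hJ := margYZ_tripleOf hT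
  rw [hVT] at hc hJ
  have hD := h.klReal_nonneg hG
  have hI0 := mutualInfo_nonneg (margYZ_mem h.mem_simplex)
  refine (add_le_add (add_le_add_right ((iInf₂_le T hT).trans_eq hc) _) le_rfl).trans ?_
  rw [relEntropy_eq_ofReal h.acG, ← hJ, ENNReal.ofReal_of_nonpos (sub_nonpos.2 hI),
    ← ENNReal.ofReal_add hI0 hD, ← ENNReal.ofReal_sub _ hR,
    ← ENNReal.ofReal_add hD (chanCost_nonneg hW h.mem_simplex h.acW), tripleExponent,
    min_eq_right hI, ENNReal.ofReal_add (add_nonneg hD (chanCost_nonneg hW h.mem_simplex h.acW))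
      (le_max_left _ _)]
  refine add_le_add le_rfl (max_le zero_le (ENNReal.ofReal_le_ofReal ?_))
  rw [add_comm (mutualInfo _)]
  exact le_max_right _ _

/-- If I(Y;Z) > I(X;Y), the channel W itself is a better choice than P_{Z|XY}: its cost is zero, and
by data processing its I(Y;Z) is at most I(X;Y), the minimum that T(P) contains. Here the term
[I(Y;Z) − I(X;Y)]_+ turns out to be irrelevant to the infimum. -/
lemma exponent_le (hG : G ∈ stdSimplex ℝ X) (hW : IsChannel W) (hR : 0 ≤ R)
    {P : (X × Y) × Z → ℝ} (h : Feasible G W U S P) :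
    exponent G W R U S ≤ ENNReal.ofReal (tripleExponent G W R P) := by
  rcases le_or_gt (mutualInfo (margYZ P)) (mutualInfo (margFst P)) with hI | hI
  · exact exponent_le_of_mutualInfo_le hG hW hR h hI
  set P' := chanTriple (margFst P) W with hP'
  have hQ := margFst_mem h.mem_simplex
  have e := margFst_chanTriple (margFst P) hW
  have hF : Feasible G W U S P' := by
    have := feasible_chanTriple (W := W) hW h.mem_set (U := U)
      ⟨by rw [h.coupling]; exact hQ, by rw [h.coupling]⟩ h.acG
    rwa [h.coupling] at this
  have hI' : mutualInfo (margYZ P') ≤ mutualInfo (margFst P') := by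
    rw [e]; exact mutualInfo_margYZ_le hQ hW rfl
  refine (exponent_le_of_mutualInfo_le hG hW hR hF hI').trans (ENNReal.ofReal_le_ofReal ?_)
  rw [e] at hI'
  rw [tripleExponent, tripleExponent, chanCost_chanTriple _ hW, e, min_eq_right hI',
    min_eq_left hI.le]
  have h1 := chanCost_nonneg hW h.mem_simplex h.acW
  have h2 := max_le_max (le_refl (0 : ℝ)) (by linarith : klReal G (margFst (margFst P)) +
    mutualInfo (margYZ P') - R ≤ klReal G (margFst (margFst P)) + mutualInfo (margFst P) - R)
  linarith

/-- The exponent is the infimum of `tripleExponent` over the feasible joint distributions. -/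
theorem exponent_isGLB (hG : G ∈ stdSimplex ℝ X) (hW : IsChannel W) (hR : 0 ≤ R)
    (hU : ∀ q ∈ S, U q ∈ stdSimplex ℝ (X × Y) ∧ margFst (U q) = q)
    (hne : ∃ P : (X × Y) × Z → ℝ, Feasible G W U S P) :
    exponent G W R U S ≠ ⊤ ∧
      IsGLB (tripleExponent G W R '' {P | Feasible G W U S P}) (exponent G W R U S).toReal := by
  obtain ⟨P₀, h₀⟩ := hne
  have hne : exponent G W R U S ≠ ⊤ :=
    ne_top_of_le_ne_top ENNReal.ofReal_ne_top (exponent_le hG hW hR h₀)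
  refine ⟨hne, ?_, ?_⟩
  · rintro _ ⟨P, hP, rfl⟩
    exact ENNReal.toReal_le_of_le_ofReal (hP.tripleExponent_nonneg hG hW)
      (exponent_le hG hW hR hP)
  · intro a ha
    exact (ENNReal.ofReal_le_iff_le_toReal hne).1
      (ofReal_le_exponent hW hR hU fun P hP => ha ⟨P, hP, rfl⟩)

end Triple

/-! ### The method of types -/

section TypeMethod

open Classical

variable {A B : Type*} [Fintype A] [Fintype B] {n : ℕ}

/-- The number of occurrences of a letter in a sequence. -/
def occ (x : Fin n → A) (a : A) : ℕ := (Finset.univ.filter (fun i => x i = a)).card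

lemma emp_eq (x : Fin n → A) (a : A) : emp x a = occ x a / n := by
  rw [emp, occ]

lemma sum_occ (x : Fin n → A) : ∑ a, occ x a = n := by
  have := Finset.card_eq_sum_card_fiberwise (f := x) (s := Finset.univ) (t := Finset.univ)
    (fun _ _ => Finset.mem_coe.2 (Finset.mem_univ _))
  simpa [occ] using this.symm

lemma occ_le (x : Fin n → A) (a : A) : occ x a ≤ n := by
  exact (Finset.card_filter_le _ _).trans_eq (by simp)

lemma emp_eq_iff {x x' : Fin n → A} : emp x = emp x' ↔ ∀ a, occ x a = occ x' a := by
  constructor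
  · intro h a
    rcases Nat.eq_zero_or_pos n with rfl | hn
    · have h1 := occ_le x a
      have h2 := occ_le x' a
      omega
    · have := congrFun h a
      rw [emp_eq, emp_eq] at this
      have hn' : (n : ℝ) ≠ 0 := by positivity
      field_simp at this
      exact_mod_cast this
  · intro h; funext a; rw [emp_eq, emp_eq, h a]

lemma emp_comp_perm (x : Fin n → A) (σ : Equiv.Perm (Fin n)) : emp (x ∘ σ) = emp x := by
  rw [emp_eq_iff]
  intro a
  exact Finset.card_equiv σ (by simp)

/-- Equal counts give bijections between the position sets of each letter, and these glue to a
permutation. -/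
lemma exists_perm_of_emp_eq {x x' : Fin n → A} (h : emp x = emp x') :
    ∃ σ : Equiv.Perm (Fin n), x' = x ∘ σ := by
  rw [emp_eq_iff] at h
  have hc : ∀ a, Fintype.card {i // x' i = a} = Fintype.card {i // x i = a} := by
    intro a
    rw [Fintype.card_subtype, Fintype.card_subtype]
    exact (h a).symm
  let e := fun a => Fintype.equivOfCardEq (hc a)
  refine ⟨(Equiv.sigmaFiberEquiv x').symm.trans
    ((Equiv.sigmaCongrRight e).trans (Equiv.sigmaFiberEquiv x)), ?_⟩
  funext i
  exact (e (x' i) ⟨i, rfl⟩).2.symm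

lemma sum_comp_eq (x : Fin n → A) (f : A → ℝ) : ∑ i, f (x i) = n * ∑ a, emp x a * f a := by
  rcases Nat.eq_zero_or_pos n with rfl | hn
  · simp
  have hn' : (n : ℝ) ≠ 0 := by positivity
  have h1 : ∑ i, f (x i) = ∑ a, (occ x a : ℝ) * f a := by
    rw [← Finset.sum_fiberwise' (s := Finset.univ) (g := x) (f := f)]
    refine Finset.sum_congr rfl fun a _ => ?_
    rw [Finset.sum_const, nsmul_eq_mul, occ]
  rw [h1, Finset.mul_sum]
  refine Finset.sum_congr rfl fun a _ => ?_
  rw [emp_eq]; field_simp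

lemma emp_nonneg (x : Fin n → A) (a : A) : 0 ≤ emp x a := by rw [emp_eq]; positivity

lemma emp_mem (hn : 0 < n) (x : Fin n → A) : emp x ∈ stdSimplex ℝ A := by
  refine ⟨emp_nonneg x, ?_⟩
  have hn' : (n : ℝ) ≠ 0 := by positivity
  have := sum_comp_eq x (fun _ => 1)
  simp only [Finset.sum_const, Finset.card_univ, Fintype.card_fin, nsmul_eq_mul, mul_one] at this
  field_simp at this
  linarith

lemma emp_pos (x : Fin n → A) (i : Fin n) : 0 < emp x (x i) := by
  rw [emp_eq]
  have hn : 0 < n := i.pos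
  have : 0 < occ x (x i) := Finset.card_pos.2 ⟨i, by simp⟩
  positivity

lemma emp_eq_sum (x : Fin n → A) (a : A) : emp x a = (∑ i, if x i = a then (1 : ℝ) else 0) / n := by
  rw [emp]; simp

lemma margFst_empPair (x : Fin n → A) (y : Fin n → B) : margFst (empPair x y) = emp x := by
  funext a
  simp only [margFst, empPair, emp_eq_sum, ← Finset.sum_div]
  rw [Finset.sum_comm]
  congr 1
  refine Finset.sum_congr rfl fun i _ => ?_
  by_cases h : x i = a <;> simp [h]

lemma margSnd_empPair (x : Fin n → A) (y : Fin n → B) : margSnd (empPair x y) = emp y := by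
  funext b
  simp only [margSnd, empPair, emp_eq_sum, ← Finset.sum_div]
  rw [Finset.sum_comm]
  congr 1
  refine Finset.sum_congr rfl fun i _ => ?_
  by_cases h : y i = b <;> simp [h]

lemma empPair_swap (x : Fin n → A) (y : Fin n → B) (a : A) (b : B) :
    empPair y x (b, a) = empPair x y (a, b) := by
  simp only [empPair, emp_eq_sum, Prod.mk.injEq, and_comm]

lemma entropy_empPair_swap (x : Fin n → A) (y : Fin n → B) :
    entropy (empPair y x) = entropy (empPair x y) := by
  rw [entropy, entropy, Fintype.sum_prod_type, Fintype.sum_prod_type_right]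
  simp only [empPair_swap x y]

lemma empPair_swap_eq_iff (x x' : Fin n → A) (y y' : Fin n → B) :
    empPair y x = empPair y' x' ↔ empPair x y = empPair x' y' := by
  constructor <;> intro h <;> funext ⟨a, b⟩
  · rw [← empPair_swap x y, ← empPair_swap x' y', h]
  · rw [empPair_swap x y, empPair_swap x' y', h]

lemma margYZ_emp {X Y Z : Type*} [Fintype X] [Fintype Y] [Fintype Z]
    (x : Fin n → X) (y : Fin n → Y) (z : Fin n → Z) :
    margYZ (empPair (fun i => (x i, y i)) z) = empPair y z := by
  funext ⟨b, c⟩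
  simp only [margYZ, empPair, emp_eq_sum, ← Finset.sum_div]
  rw [Finset.sum_comm]
  congr 1
  refine Finset.sum_congr rfl fun i _ => ?_
  by_cases h : y i = b <;> by_cases h' : z i = c <;> simp [h, h']

lemma mem_types (x : Fin n → A) : emp x ∈ types n A :=
  Finset.mem_image.2 ⟨x, Finset.mem_univ _, rfl⟩

lemma exists_emp_of_mem_types {P : A → ℝ} (h : P ∈ types n A) : ∃ x : Fin n → A, emp x = P := by
  obtain ⟨x, -, hx⟩ := Finset.mem_image.1 h
  exact ⟨x, hx⟩

lemma mem_typeClass {P : A → ℝ} {x : Fin n → A} : x ∈ typeClass n P ↔ emp x = P := by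
  simp [typeClass]

/-- The generous term 2 log(k+1) lets the induction close with log t ≥ 1 − 1/t alone: the step
reduces to 1 ≤ k/(k+1) + 2/(k+2). -/
lemma log_factorial_le (k : ℕ) :
    Real.log k.factorial ≤ k * Real.log k - k + 1 + 2 * Real.log (k + 1) := by
  induction k with
  | zero => simp
  | succ k ih =>
    have h0 : (0 : ℝ) < k + 1 := by positivity
    have hf : (0 : ℝ) < k.factorial := by exact_mod_cast k.factorial_pos
    rw [Nat.factorial_succ, Nat.cast_mul, Real.log_mul (by positivity) hf.ne']
    have h2 := Real.one_sub_inv_le_log_of_pos (show (0 : ℝ) < (k + 2) / (k + 1) by positivity)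
    rw [Real.log_div (by positivity) (by positivity), inv_div] at h2
    have h3 : 1 - ((k : ℝ) + 1) / (k + 2) = 1 / (k + 2) := by field_simp; ring
    have h1 : (k : ℝ) / (k + 1) ≤ k * (Real.log (k + 1) - Real.log k) := by
      rcases Nat.eq_zero_or_pos k with rfl | hk
      · simp
      · have hk' : (0 : ℝ) < k := by exact_mod_cast hk
        have := Real.one_sub_inv_le_log_of_pos (show (0 : ℝ) < (k + 1) / k by positivity)
        rw [Real.log_div (by positivity) (by positivity), inv_div] at this
        have h5 := mul_le_mul_of_nonneg_left this hk'.le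
        refine le_trans (le_of_eq ?_) h5
        field_simp; ring
    have h4 : (1 : ℝ) ≤ k / (k + 1) + 2 * (1 / (k + 2)) := by
      rw [div_add' _ _ _ (by positivity), le_div_iff₀ (by positivity)]
      field_simp
      nlinarith
    push_cast
    have e : (k : ℝ) + 1 + 1 = k + 2 := by ring
    rw [e]
    rw [h3] at h2
    nlinarith

lemma le_log_factorial (n : ℕ) : n * Real.log n - n ≤ Real.log n.factorial := by
  rcases Nat.eq_zero_or_pos n with rfl | hn
  · simp
  · have h := Stirling.le_log_factorial_stirling hn.ne'
    have h1 : 0 ≤ Real.log n := Real.log_natCast_nonneg n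
    have h2 : 0 ≤ Real.log (2 * Real.pi) := Real.log_nonneg (by linarith [Real.pi_gt_three])
    linarith

/-- Orbit and stabilizer: the n! permutations of the positions act transitively on the type class,
and the stabilizer of x permutes the positions of each letter separately. -/
lemma card_typeClass_mul (x : Fin n → A) :
    (typeClass n (emp x)).card * ∏ a, (occ x a).factorial = n.factorial := by
  have h1 : (Finset.univ : Finset (Equiv.Perm (Fin n))).card = n.factorial := by
    rw [Finset.card_univ, Fintype.card_perm, Fintype.card_fin]
  rw [← h1, Finset.card_eq_sum_card_fiberwise (f := fun σ : Equiv.Perm (Fin n) => x ∘ σ)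
    (t := typeClass n (emp x))
    (fun σ _ => by simpa [mem_typeClass] using emp_comp_perm x σ)]
  rw [Finset.sum_const_nat (m := ∏ a, (occ x a).factorial)]
  intro y hy
  obtain ⟨τ, rfl⟩ := exists_perm_of_emp_eq (mem_typeClass.1 hy).symm
  have h2 : Fintype.card {σ : Equiv.Perm (Fin n) // x ∘ σ = x} = ∏ a, (occ x a).factorial := by
    rw [DomMulAct.stabilizer_card]
    refine Finset.prod_congr rfl fun a _ => ?_
    rw [Fintype.card_subtype, occ]
  rw [← h2, Fintype.card_subtype]
  refine Finset.card_equiv (Equiv.mulRight τ⁻¹) fun σ => ?_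
  simp only [Finset.mem_filter, Finset.mem_univ, true_and, Equiv.coe_mulRight]
  constructor
  · intro h
    funext i
    have := congrFun h (τ⁻¹ i)
    simpa using this
  · intro h
    funext i
    have := congrFun h (τ i)
    simpa using this

lemma mul_entropy_emp (x : Fin n → A) :
    n * entropy (emp x) = n * Real.log n - ∑ a, (occ x a : ℝ) * Real.log (occ x a) := by
  rcases Nat.eq_zero_or_pos n with rfl | hn
  · have : ∀ a, occ x a = 0 := fun a => by have := occ_le x a; omega
    simp [this]
  have hn' : (0 : ℝ) < n := by exact_mod_cast hn
  have h1 : (n : ℝ) * Real.log n = ∑ a, (occ x a : ℝ) * Real.log n := by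
    rw [← Finset.sum_mul]
    congr 1
    exact_mod_cast (sum_occ x).symm
  rw [h1, ← Finset.sum_sub_distrib, entropy, Finset.mul_sum]
  refine Finset.sum_congr rfl fun a _ => ?_
  rw [emp_eq, Real.negMulLog]
  rcases Nat.eq_zero_or_pos (occ x a) with h | h
  · simp [h]
  · rw [Real.log_div (by positivity) hn'.ne']
    field_simp
    ring

/-- Stirling's bounds applied to the multinomial coefficient; the linear terms cancel because the
counts add up to n. -/
lemma card_typeClass_lower (x : Fin n → A) :
    Real.exp (n * entropy (emp x) - Fintype.card A * (1 + 2 * Real.log (n + 1))) ≤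
      (typeClass n (emp x)).card := by
  have h := card_typeClass_mul x
  have hpos : 0 < (typeClass n (emp x)).card := Finset.card_pos.2 ⟨x, mem_typeClass.2 rfl⟩
  have hpos' : (0 : ℝ) < (typeClass n (emp x)).card := by exact_mod_cast hpos
  rw [← Real.le_log_iff_exp_le hpos', mul_entropy_emp]
  have hl : Real.log (typeClass n (emp x)).card + ∑ a, Real.log (occ x a).factorial =
      Real.log n.factorial := by
    rw [← h, Nat.cast_mul, Nat.cast_prod, Real.log_mul hpos'.ne', Real.log_prod]
    · intro a _; exact_mod_cast (occ x a).factorial_ne_zero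
    · exact Finset.prod_ne_zero_iff.2 fun a _ => by exact_mod_cast (occ x a).factorial_ne_zero
  have h1 := le_log_factorial n
  have h2 : ∑ a, Real.log (occ x a).factorial ≤
      ∑ a, ((occ x a : ℝ) * Real.log (occ x a) - occ x a + (1 + 2 * Real.log (n + 1))) := by
    refine Finset.sum_le_sum fun a _ => ?_
    have := log_factorial_le (occ x a)
    have h3 : Real.log ((occ x a : ℝ) + 1) ≤ Real.log (n + 1) :=
      Real.log_le_log (by positivity) (by
        have : (occ x a : ℝ) ≤ n := by exact_mod_cast occ_le x a
        linarith)
    linarith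
  rw [Finset.sum_add_distrib, Finset.sum_sub_distrib] at h2
  have h4 : ∑ a, (occ x a : ℝ) = n := by exact_mod_cast sum_occ x
  simp only [Finset.sum_const, Finset.card_univ, nsmul_eq_mul] at h2
  rw [h4] at h2
  linarith

lemma prod_eq_exp {G : A → ℝ} (hG : ∀ a, 0 ≤ G a) {x : Fin n → A}
    (h : ∀ a, G a = 0 → emp x a = 0) :
    ∏ i, G (x i) = Real.exp (n * ∑ a, emp x a * Real.log (G a)) := by
  rw [← sum_comp_eq, Real.exp_sum]
  refine Finset.prod_congr rfl fun i _ => ?_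
  have : G (x i) ≠ 0 := fun e => (emp_pos x i).ne' (h _ e)
  rw [Real.exp_log (lt_of_le_of_ne (hG _) this.symm)]

lemma prod_eq_exp_klReal {G : A → ℝ} (hG : ∀ a, 0 ≤ G a) {x : Fin n → A}
    (h : ∀ a, G a = 0 → emp x a = 0) :
    ∏ i, G (x i) = Real.exp (-(n * (entropy (emp x) + klReal G (emp x)))) := by
  rw [prod_eq_exp hG h, klReal]
  congr 1; ring

lemma emp_ac_of_prod_ne_zero {G : A → ℝ} {x : Fin n → A} (h : ∏ i, G (x i) ≠ 0) (a : A)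
    (ha : G a = 0) : emp x a = 0 := by
  rw [Finset.prod_ne_zero_iff] at h
  rw [emp_eq]
  have : occ x a = 0 := by
    rw [occ, Finset.card_eq_zero, Finset.filter_eq_empty_iff]
    intro i _ e
    exact h i (Finset.mem_univ i) (e ▸ ha)
  simp [this]

lemma sum_prod_eq_one {G : A → ℝ} (hG : G ∈ stdSimplex ℝ A) :
    ∑ x : Fin n → A, ∏ i, G (x i) = 1 := by
  rw [← Fintype.sum_pow, hG.2, one_pow]

/-- Under the i.i.d. law of the type itself every member of the class has probability e^{-nH}, and
the class has probability at most one. -/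
lemma card_typeClass_upper (x : Fin n → A) :
    ((typeClass n (emp x)).card : ℝ) ≤ Real.exp (n * entropy (emp x)) := by
  rcases Nat.eq_zero_or_pos n with rfl | hn
  · have := Finset.card_le_univ (typeClass 0 (emp x))
    simp at this
    simpa using this
  have h1 := sum_prod_eq_one (n := n) (emp_mem hn x)
  have h2 : ∑ x' ∈ typeClass n (emp x), ∏ i, emp x (x' i) ≤ 1 := by
    rw [← h1]
    exact Finset.sum_le_univ_sum_of_nonneg fun x' => Finset.prod_nonneg fun i _ => emp_nonneg _ _
  have h3 : ∀ x' ∈ typeClass n (emp x), ∏ i, emp x (x' i) = Real.exp (-(n * entropy (emp x))) := by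
    intro x' hx'
    have e := mem_typeClass.1 hx'
    rw [← e, prod_eq_exp (emp_nonneg x') (fun _ h => h), entropy_eq_neg_sum]
    congr 1; ring
  rw [Finset.sum_congr rfl h3, Finset.sum_const, nsmul_eq_mul, Real.exp_neg] at h2
  have := Real.exp_pos (n * entropy (emp x))
  rwa [← div_eq_mul_inv, div_le_one this] at h2

/-- The number of sequences that have the same joint type with `x` as `y`. -/
def condCard (x : Fin n → A) (y : Fin n → B) : ℕ :=
  (Finset.univ.filter (fun y' : Fin n → B => empPair x y' = empPair x y)).card

/-- The joint type class is fibred over the type class of x, and a permutation carrying x to another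
member identifies the fibres. -/
lemma condCard_mul (x : Fin n → A) (y : Fin n → B) :
    condCard x y * (typeClass n (emp x)).card = (typeClass n (empPair x y)).card := by
  rw [Finset.card_eq_sum_card_fiberwise (s := typeClass n (empPair x y))
    (f := fun w : Fin n → A × B => fun i => (w i).1) (t := typeClass n (emp x))]
  · rw [Finset.sum_const_nat (m := condCard x y), mul_comm]
    intro x' hx'
    obtain ⟨σ, rfl⟩ := exists_perm_of_emp_eq (mem_typeClass.1 hx').symm
    refine Finset.card_nbij' (fun w i => (w (σ.symm i)).2) (fun y' i => (x (σ i), y' (σ i))) ?_ ?_ ?_ ?_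
    · intro w hw
      simp only [Finset.coe_filter, Set.mem_ofPred_eq, mem_typeClass, Finset.mem_univ, true_and] at hw ⊢
      rw [← hw.1, ← emp_comp_perm w σ.symm, empPair]
      congr 1
      funext i
      have := congrFun hw.2 (σ.symm i)
      simp only [Function.comp, Equiv.apply_symm_apply] at this ⊢
      rw [← this]
    · intro y' hy'
      simp only [Finset.coe_filter, Set.mem_ofPred_eq, mem_typeClass, Finset.mem_univ, true_and] at hy' ⊢
      exact ⟨by rw [← hy']; exact emp_comp_perm (fun i => (x i, y' i)) σ, rfl⟩
    · intro w hw
      simp only [Finset.coe_filter, Set.mem_ofPred_eq, mem_typeClass] at hw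
      funext i
      have := congrFun hw.2 i
      simp only [Function.comp] at this
      simp [← this]
    · intro y' _
      simp
  · intro w hw
    rw [Finset.mem_coe, mem_typeClass] at hw ⊢
    rw [← margFst_empPair x y, ← hw]
    exact (margFst_empPair (fun i => (w i).1) (fun i => (w i).2)).symm

lemma card_types_le : ((types n A).card : ℝ) ≤ Real.exp (Fintype.card A * Real.log (n + 1)) := by
  have h : (types n A).card ≤ (n + 1) ^ Fintype.card A := by
    have h1 : types n A ⊆ Finset.univ.image
        (fun k : A → Fin (n + 1) => fun a => ((k a : ℕ) : ℝ) / n) := by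
      intro P hP
      obtain ⟨x, rfl⟩ := exists_emp_of_mem_types hP
      refine Finset.mem_image.2 ⟨fun a => ⟨occ x a, Nat.lt_succ_of_le (occ_le x a)⟩,
        Finset.mem_univ _, ?_⟩
      funext a
      rw [emp_eq]
    refine (Finset.card_le_card h1).trans (Finset.card_image_le.trans ?_)
    simp
  rw [← Real.log_pow, Real.exp_log (by positivity)]
  exact_mod_cast h

lemma eventually_log_le (C : ℝ) {δ : ℝ} (hδ : 0 < δ) :
    ∀ᶠ n : ℕ in Filter.atTop, C * (1 + 2 * Real.log (n + 1)) ≤ n * δ := by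
  have h1 : Filter.Tendsto (fun n : ℕ => (n : ℝ) + 1) Filter.atTop Filter.atTop :=
    Filter.tendsto_atTop_add_const_right _ _ tendsto_natCast_atTop_atTop
  -- For large n one has 1 ≤ nη and log(n+1) ≤ 2nη, hence 1 + 2 log(n+1) ≤ 5nη, and the left side is
  -- at most (5/8)nδ.
  set η := δ / (8 * (|C| + 1)) with hη
  have hη0 : 0 < η := by positivity
  have h2 := (Real.isLittleO_log_id_atTop.comp_tendsto h1).def hη0
  filter_upwards [h2, Filter.eventually_ge_atTop ⌈1 / η⌉₊, Filter.eventually_ge_atTop 1]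
    with n hn hn2 hn1
  simp only [Function.comp, id, Real.norm_eq_abs] at hn
  rw [abs_of_nonneg (by positivity : (0 : ℝ) ≤ n + 1)] at hn
  have h3 : 1 ≤ n * η := by
    have : 1 / η ≤ n := (Nat.le_ceil _).trans (by exact_mod_cast hn2)
    rwa [div_le_iff₀ hη0] at this
  have hn1' : (1 : ℝ) ≤ n := by exact_mod_cast hn1
  have h4 : Real.log (n + 1) ≤ η * (n + 1) := (le_abs_self _).trans hn
  have hl0 : 0 ≤ Real.log ((n : ℝ) + 1) := Real.log_nonneg (by linarith)
  have h5 : 1 + 2 * Real.log (n + 1) ≤ 5 * (n * η) := by nlinarith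
  calc C * (1 + 2 * Real.log (n + 1)) ≤ |C| * (1 + 2 * Real.log (n + 1)) :=
        mul_le_mul_of_nonneg_right (le_abs_self C) (by linarith)
    _ ≤ (|C| + 1) * (5 * (n * η)) := by
        refine mul_le_mul (by linarith) h5 (by linarith) (by positivity)
    _ = n * (δ * (5 / 8)) := by rw [hη]; field_simp
    _ ≤ n * δ := by
        refine mul_le_mul_of_nonneg_left (by linarith) (by linarith)

lemma eventually_card_typeClass (A : Type*) [Fintype A] {δ : ℝ} (hδ : 0 < δ) :
    ∀ᶠ n : ℕ in Filter.atTop, ∀ x : Fin n → A,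
      Real.exp (n * (entropy (emp x) - δ)) ≤ (typeClass n (emp x)).card := by
  filter_upwards [eventually_log_le (Fintype.card A) hδ] with n hn x
  refine le_trans (Real.exp_le_exp.2 ?_) (card_typeClass_lower x)
  rw [mul_sub]; linarith

lemma eventually_card_types (A : Type*) [Fintype A] {δ : ℝ} (hδ : 0 < δ) :
    ∀ᶠ n : ℕ in Filter.atTop, ((types n A).card : ℝ) ≤ Real.exp (n * δ) := by
  filter_upwards [eventually_log_le (Fintype.card A) hδ] with n hn
  refine card_types_le.trans (Real.exp_le_exp.2 (le_trans ?_ hn))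
  have hl0 : 0 ≤ Real.log ((n : ℝ) + 1) := Real.log_nonneg (by
    have : (0 : ℝ) ≤ n := by positivity
    linarith)
  exact mul_le_mul_of_nonneg_left (by linarith) (by positivity)

lemma typeClass_card_pos (x : Fin n → A) : (0 : ℝ) < (typeClass n (emp x)).card := by
  exact_mod_cast Finset.card_pos.2 ⟨x, mem_typeClass.2 rfl⟩

lemma eventually_condCard (A B : Type*) [Fintype A] [Fintype B] {δ : ℝ} (hδ : 0 < δ) :
    ∀ᶠ n : ℕ in Filter.atTop, ∀ (x : Fin n → A) (y : Fin n → B),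
      Real.exp (n * (entropy (empPair x y) - entropy (emp x) - δ)) ≤ condCard x y ∧
      (condCard x y : ℝ) ≤ Real.exp (n * (entropy (empPair x y) - entropy (emp x) + δ)) := by
  filter_upwards [eventually_card_typeClass A hδ, eventually_card_typeClass (A × B) hδ]
    with n h1 h2 x y
  have hm : (condCard x y : ℝ) * (typeClass n (emp x)).card = (typeClass n (empPair x y)).card := by
    exact_mod_cast condCard_mul x y
  have hp := typeClass_card_pos x
  have he : (condCard x y : ℝ) = (typeClass n (empPair x y)).card / (typeClass n (emp x)).card := by
    rw [← hm]; field_simp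
  rw [he]
  constructor
  · rw [le_div_iff₀ hp]
    calc _ ≤ Real.exp (n * (entropy (empPair x y) - entropy (emp x) - δ)) *
          Real.exp (n * entropy (emp x)) :=
          mul_le_mul_of_nonneg_left (card_typeClass_upper x) (Real.exp_pos _).le
      _ = Real.exp (n * (entropy (empPair x y) - δ)) := by
          rw [← Real.exp_add]; congr 1; ring
      _ ≤ _ := h2 _
  · rw [div_le_iff₀ hp]
    calc _ ≤ Real.exp (n * entropy (empPair x y)) := card_typeClass_upper (fun i => (x i, y i))
      _ = Real.exp (n * (entropy (empPair x y) - entropy (emp x) + δ)) *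
          Real.exp (n * (entropy (emp x) - δ)) := by
          rw [← Real.exp_add]; congr 1; ring
      _ ≤ _ := mul_le_mul_of_nonneg_left (h1 x) (Real.exp_pos _).le

end TypeMethod

/-! ### Approximation of distributions by types -/

section Rounding

open Classical

variable {A B : Type*} [Fintype A] [Fintype B] {n : ℕ}

/-- Round everything down and give the deficit, at most the number of letters, to one letter of
nonzero weight; the support does not grow. -/
lemma exists_nat_rounding {w : B → ℝ} (hw : ∀ b, 0 ≤ w b) {k : ℕ} (hk : ∑ b, w b = k) :
    ∃ m : B → ℕ, ∑ b, m b = k ∧ (∀ b, w b = 0 → m b = 0) ∧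
      ∀ b, |(m b : ℝ) - w b| ≤ Fintype.card B := by
  by_cases h0 : ∀ b, w b = 0
  · refine ⟨fun _ => 0, ?_, fun _ _ => rfl, fun b => by simp [h0]⟩
    simp only [h0, Finset.sum_const_zero] at hk ⊢
    exact_mod_cast hk
  push Not at h0
  obtain ⟨b₀, hb₀⟩ := h0
  have hfl : ∀ b, (⌊w b⌋₊ : ℝ) ≤ w b := fun b => Nat.floor_le (hw b)
  have hfl' : ∀ b, w b < ⌊w b⌋₊ + 1 := fun b => Nat.lt_floor_add_one _
  have hle : ∑ b, ⌊w b⌋₊ ≤ k := by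
    have : (∑ b, (⌊w b⌋₊ : ℝ)) ≤ k := hk ▸ Finset.sum_le_sum fun b _ => hfl b
    exact_mod_cast this
  have hr : ((k - ∑ b, ⌊w b⌋₊ : ℕ) : ℝ) ≤ Fintype.card B := by
    rw [Nat.cast_sub hle, ← hk, Nat.cast_sum, ← Finset.sum_sub_distrib]
    have : ∑ b, (w b - ⌊w b⌋₊) ≤ ∑ _b : B, (1 : ℝ) :=
      Finset.sum_le_sum fun b _ => by linarith [hfl' b]
    simpa using this
  have hc : (1 : ℝ) ≤ Fintype.card B := by
    exact_mod_cast Fintype.card_pos_iff.2 ⟨b₀⟩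
  refine ⟨fun b => ⌊w b⌋₊ + if b = b₀ then k - ∑ b, ⌊w b⌋₊ else 0, ?_, ?_, ?_⟩
  · rw [Finset.sum_add_distrib, Finset.sum_ite_eq' Finset.univ b₀]
    simp only [Finset.mem_univ, if_true]
    omega
  · intro b hb
    have : b ≠ b₀ := fun e => hb₀ (e ▸ hb)
    simp [this, hb]
  · intro b
    have h1 := hfl b
    have h2 := hfl' b
    rw [abs_le]
    push_cast
    split_ifs with h
    · have : (0 : ℝ) ≤ ((k - ∑ b, ⌊w b⌋₊ : ℕ) : ℝ) := by positivity
      constructor <;> linarith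
    · constructor <;> linarith

lemma exists_seq_of_occ {k : A → ℕ} (hk : ∑ a, k a = n) :
    ∃ x : Fin n → A, ∀ a, occ x a = k a := by
  have e : Fin n ≃ (a : A) × Fin (k a) := Fintype.equivOfCardEq (by simp [hk])
  refine ⟨fun i => (e i).1, fun a => ?_⟩
  rw [occ]
  have h1 : (Finset.univ.filter fun i => (e i).1 = a).card =
      (Finset.univ.filter fun s : (a : A) × Fin (k a) => s.1 = a).card :=
    Finset.card_equiv e (by simp)
  rw [h1]
  have h2 : (Finset.univ.filter fun s : (a : A) × Fin (k a) => s.1 = a) =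
      (Finset.univ : Finset (Fin (k a))).map ⟨fun j => ⟨a, j⟩, fun i j h => by simpa using h⟩ := by
    ext ⟨a', j⟩
    simp only [Finset.mem_filter, Finset.mem_univ, true_and, Finset.mem_map]
    constructor
    · rintro rfl; exact ⟨j, rfl⟩
    · rintro ⟨j', h⟩; exact (congrArg Sigma.fst h).symm
  rw [h2, Finset.card_map, Finset.card_univ, Fintype.card_fin]

/-- A joint distribution whose first marginal is a type can be approximated by a joint type
with the same first marginal and no larger support. -/
lemma exists_joint_type (hn : 0 < n) {P : A × B → ℝ} (hP : P ∈ stdSimplex ℝ (A × B))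
    {u : Fin n → A} (hu : margFst P = emp u) :
    ∃ v : Fin n → B, (∀ p, P p = 0 → empPair u v p = 0) ∧
      ∀ p, |empPair u v p - P p| ≤ Fintype.card B / n := by
  have hn' : (0 : ℝ) < n := by exact_mod_cast hn
  have h1 : ∀ a, ∑ b, n * P (a, b) = occ u a := by
    intro a
    have := congrFun hu a
    rw [emp_eq] at this
    rw [← Finset.mul_sum]
    change (n : ℝ) * margFst P a = _
    rw [this]; field_simp
  choose m hm1 hm2 hm3 using fun a =>
    exists_nat_rounding (fun b => mul_nonneg hn'.le (hP.1 (a, b))) (h1 a)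
  obtain ⟨w, hw⟩ := exists_seq_of_occ (n := n) (k := fun p : A × B => m p.1 p.2) (by
    rw [Fintype.sum_prod_type]
    simp only [hm1, sum_occ])
  have hw1 : emp (fun i => (w i).1) = emp u := by
    have e := margFst_empPair (fun i => (w i).1) (fun i => (w i).2)
    rw [← e]
    funext a
    rw [margFst, emp_eq, ← hm1, Nat.cast_sum, Finset.sum_div]
    refine Finset.sum_congr rfl fun b _ => ?_
    rw [empPair, emp_eq]
    exact congrArg (fun t : ℕ => (t : ℝ) / n) (hw (a, b))
  obtain ⟨σ, hσ⟩ := exists_perm_of_emp_eq hw1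
  have e : empPair u (fun i => (w (σ i)).2) = emp w := by
    rw [← emp_comp_perm w σ, empPair, hσ]
    rfl
  refine ⟨fun i => (w (σ i)).2, fun p hp => ?_, fun p => ?_⟩
  · rw [e, emp_eq, hw p, hm2 p.1 p.2 (by simp [hp])]
    simp
  · rw [e, emp_eq, hw p]
    have := hm3 p.1 p.2
    have e2 : (m p.1 p.2 : ℝ) / n - P p = (m p.1 p.2 - n * P (p.1, p.2)) / n := by
      field_simp
    rw [e2, abs_div, abs_of_pos hn']
    exact div_le_div_of_nonneg_right this hn'.le

lemma exists_type (hn : 0 < n) {q : A → ℝ} (hq : q ∈ stdSimplex ℝ A) :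
    ∃ v : Fin n → A, (∀ a, q a = 0 → emp v a = 0) ∧
      ∀ a, |emp v a - q a| ≤ Fintype.card A / n := by
  have hn' : (0 : ℝ) < n := by exact_mod_cast hn
  obtain ⟨m, hm1, hm2, hm3⟩ := exists_nat_rounding (w := fun a => n * q a) (k := n)
    (fun a => mul_nonneg hn'.le (hq.1 a)) (by rw [← Finset.mul_sum, hq.2, mul_one])
  obtain ⟨v, hv⟩ := exists_seq_of_occ hm1
  refine ⟨v, fun a ha => ?_, fun a => ?_⟩
  · rw [emp_eq, hv, hm2 a (by simp [ha])]; simp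
  · rw [emp_eq, hv]
    have e2 : (m a : ℝ) / n - q a = (m a - n * q a) / n := by field_simp
    rw [e2, abs_div, abs_of_pos hn']
    exact div_le_div_of_nonneg_right (hm3 a) hn'.le

end Rounding

/-! ### Uniform averages and concentration -/

section Average

open Classical

/-- The mean of a function with respect to the uniform distribution. -/
def avg {Ω : Type*} [Finite Ω] (f : Ω → ℝ) : ℝ :=
  letI := Fintype.ofFinite Ω
  (∑ ω, f ω) / Fintype.card Ω

lemma avg_eq {Ω : Type*} [Fintype Ω] (f : Ω → ℝ) : avg f = (∑ ω, f ω) / Fintype.card Ω := by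
  have h : Fintype.ofFinite Ω = ‹Fintype Ω› := Subsingleton.elim _ _
  rw [avg, h]

/-- The number of elements with a given property. -/
def cnt {ι : Type*} [Fintype ι] (p : ι → Prop) : ℕ := (Finset.univ.filter p).card

lemma cnt_eq {ι : Type*} [Fintype ι] (p : ι → Prop) [DecidablePred p] :
    cnt p = (Finset.univ.filter p).card := by
  unfold cnt; congr

lemma exists_of_cnt_pos {ι : Type*} [Fintype ι] {p : ι → Prop} (h : 0 < cnt p) : ∃ i, p i := by
  rw [cnt, Finset.card_pos] at h
  obtain ⟨i, hi⟩ := h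
  exact ⟨i, (Finset.mem_filter.1 hi).2⟩

lemma cnt_mono {ι : Type*} [Fintype ι] {p q : ι → Prop} (h : ∀ i, p i → q i) : cnt p ≤ cnt q :=
  Finset.card_le_card fun i hi => by
    rw [Finset.mem_filter] at hi ⊢
    exact ⟨hi.1, h i hi.2⟩

/-- The indicator function of a proposition. -/
def ind (p : Prop) : ℝ := if p then 1 else 0

lemma ind_nonneg (p : Prop) : 0 ≤ ind p := by unfold ind; split_ifs <;> norm_num

lemma ind_le_one (p : Prop) : ind p ≤ 1 := by unfold ind; split_ifs <;> norm_num

lemma ind_true {p : Prop} (h : p) : ind p = 1 := if_pos h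

lemma ind_false {p : Prop} (h : ¬ p) : ind p = 0 := if_neg h

lemma ind_mono {p q : Prop} (h : p → q) : ind p ≤ ind q := by
  by_cases hp : p
  · rw [ind_true hp, ind_true (h hp)]
  · rw [ind_false hp]; exact ind_nonneg q

variable {Ω Ω' : Type*} [Fintype Ω] [Fintype Ω']

lemma cnt_cast {ι : Type*} [Fintype ι] (p : ι → Prop) : (cnt p : ℝ) = ∑ i, ind (p i) := by
  rw [cnt, Finset.card_filter]
  push_cast
  rfl

lemma cnt_pos {ι : Type*} [Fintype ι] {p : ι → Prop} {i : ι} (h : p i) : 0 < cnt p :=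
  Finset.card_pos.2 ⟨i, by rw [Finset.mem_filter]; exact ⟨Finset.mem_univ i, h⟩⟩

lemma avg_mono {f g : Ω → ℝ} (h : ∀ ω, f ω ≤ g ω) : avg f ≤ avg g := by
  rw [avg_eq, avg_eq]
  exact div_le_div_of_nonneg_right (Finset.sum_le_sum fun ω _ => h ω) (by positivity)

lemma avg_nonneg {f : Ω → ℝ} (h : ∀ ω, 0 ≤ f ω) : 0 ≤ avg f := by
  rw [avg_eq]
  exact div_nonneg (Finset.sum_nonneg fun ω _ => h ω) (by positivity)

lemma avg_add (f g : Ω → ℝ) : avg (fun ω => f ω + g ω) = avg f + avg g := by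
  rw [avg_eq, avg_eq, avg_eq, Finset.sum_add_distrib, add_div]

lemma avg_sub (f g : Ω → ℝ) : avg (fun ω => f ω - g ω) = avg f - avg g := by
  rw [avg_eq, avg_eq, avg_eq, Finset.sum_sub_distrib, sub_div]

lemma avg_const_mul (a : ℝ) (f : Ω → ℝ) : avg (fun ω => a * f ω) = a * avg f := by
  rw [avg_eq, avg_eq, ← Finset.mul_sum, mul_div_assoc]

lemma avg_const [Nonempty Ω] (a : ℝ) : avg (fun _ : Ω => a) = a := by
  simp [avg_eq]

lemma avg_sum {ι : Type*} (s : Finset ι) (f : ι → Ω → ℝ) :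
    avg (fun ω => ∑ i ∈ s, f i ω) = ∑ i ∈ s, avg (f i) := by
  simp only [avg_eq]
  rw [Finset.sum_comm, Finset.sum_div]

lemma avg_equiv (e : Ω ≃ Ω') (f : Ω' → ℝ) : avg (fun ω => f (e ω)) = avg f := by
  rw [avg_eq, avg_eq, Equiv.sum_comp e f, Fintype.card_congr e]

lemma avg_prod (f : Ω × Ω' → ℝ) : avg f = avg fun a => avg fun b => f (a, b) := by
  simp only [avg_eq, Fintype.sum_prod_type, Fintype.card_prod, Nat.cast_mul, ← Finset.sum_div,
    div_div]
  rw [mul_comm]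

lemma avg_fst [Nonempty Ω'] (f : Ω → ℝ) : avg (fun ω : Ω × Ω' => f ω.1) = avg f := by
  rw [avg_prod]; simp only [avg_const]

section Pi

variable {ι : Type*} [Fintype ι] {α : ι → Type*} [∀ i, Fintype (α i)]

lemma avg_pi_prod (g : ∀ i, α i → ℝ) :
    avg (fun ω : ∀ i, α i => ∏ i, g i (ω i)) = ∏ i, avg (g i) := by
  simp only [avg_eq, Finset.prod_div_distrib, Fintype.card_pi, Nat.cast_prod]
  rw [Finset.prod_univ_sum, Fintype.piFinset_univ]

/-- Marginalization of the uniform law on a product: the product formula with the constant 1 in the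
other coordinates. -/
lemma avg_eval [∀ i, Nonempty (α i)] (i₀ : ι) (f : α i₀ → ℝ) :
    avg (fun ω : ∀ i, α i => f (ω i₀)) = avg f := by
  have h := avg_pi_prod (fun i (a : α i) => if h : i = i₀ then f (h ▸ a) else 1)
  rw [Finset.prod_eq_single i₀] at h
  · simp only [dite_true] at h
    rw [← h]
    congr 1
    funext ω
    rw [Finset.prod_eq_single i₀]
    · simp
    · intro i _ hi; simp [hi]
    · simp
  · intro i _ hi
    simp only [hi, dite_false, avg_const]
  · simp

/-- The moment generating function of a sum of independent indicators factorizes; the indicators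
need not be identically distributed. -/
lemma avg_exp_card [∀ i, Nonempty (α i)] (B : ∀ i, α i → Prop) (t : ℝ) :
    avg (fun ω : ∀ i, α i => Real.exp (t * (cnt fun i => B i (ω i) : ℝ))) =
      ∏ i, (1 + avg (fun a => ind (B i a)) * (Real.exp t - 1)) := by
  have h1 : ∀ i, 1 + avg (fun a => ind (B i a)) * (Real.exp t - 1) =
      avg (fun a : α i => Real.exp (t * ind (B i a))) := by
    intro i
    have : (fun a : α i => Real.exp (t * ind (B i a))) =
        fun a => 1 + (Real.exp t - 1) * ind (B i a) := by
      funext a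
      by_cases h : B i a
      · rw [ind_true h]; simp
      · rw [ind_false h]; simp
    rw [this, avg_add, avg_const, avg_const_mul, mul_comm]
  simp only [h1]
  rw [← avg_pi_prod]
  congr 1
  funext ω
  rw [← Real.exp_sum, ← Finset.mul_sum, cnt, Finset.card_filter]
  congr 2
  push_cast
  refine Finset.sum_congr rfl fun i _ => ?_
  simp [ind]

/-- Chernoff's bound at parameter 1, with e − 1 ≤ 2. -/
lemma avg_ind_le_card [∀ i, Nonempty (α i)] (B : ∀ i, α i → Prop) (t : ℝ) :
    avg (fun ω : ∀ i, α i => ind (t ≤ (cnt fun i => B i (ω i) : ℝ))) ≤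
      Real.exp (2 * ∑ i, avg (fun a => ind (B i a)) - t) := by
  calc _ ≤ avg (fun ω : ∀ i, α i => Real.exp (-t) *
        Real.exp (1 * (cnt fun i => B i (ω i) : ℝ))) := by
        refine avg_mono fun ω => ?_
        by_cases h : t ≤ (cnt fun i => B i (ω i) : ℝ)
        · rw [ind_true h, ← Real.exp_add]
          exact Real.one_le_exp (by linarith)
        · rw [ind_false h]; positivity
    _ = Real.exp (-t) * ∏ i, (1 + avg (fun a => ind (B i a)) * (Real.exp 1 - 1)) := by
        rw [avg_const_mul, avg_exp_card]
    _ ≤ Real.exp (-t) * ∏ i, Real.exp (2 * avg (fun a => ind (B i a))) := by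
        refine mul_le_mul_of_nonneg_left (Finset.prod_le_prod ?_ ?_) (Real.exp_pos _).le
        · intro i _
          have h1 : 0 ≤ avg (fun a => ind (B i a)) := avg_nonneg fun a => ind_nonneg _
          have h2 : (1 : ℝ) ≤ Real.exp 1 := Real.one_le_exp zero_le_one
          nlinarith
        · intro i _
          have h1 : 0 ≤ avg (fun a => ind (B i a)) := avg_nonneg fun a => ind_nonneg _
          have h2 := Real.exp_one_lt_d9
          have h3 := Real.add_one_le_exp (2 * avg (fun a => ind (B i a)))
          nlinarith
    _ = _ := by
        rw [← Real.exp_sum, ← Real.exp_add, ← Finset.mul_sum]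
        congr 1; ring

/-- Chernoff's bound at parameter −1, with 1 − 1/e ≥ 1/2. -/
lemma avg_ind_card_le [∀ i, Nonempty (α i)] (B : ∀ i, α i → Prop) (t : ℝ) :
    avg (fun ω : ∀ i, α i => ind ((cnt fun i => B i (ω i) : ℝ) ≤ t)) ≤
      Real.exp (t - (∑ i, avg (fun a => ind (B i a))) / 2) := by
  calc _ ≤ avg (fun ω : ∀ i, α i => Real.exp t *
        Real.exp ((-1) * (cnt fun i => B i (ω i) : ℝ))) := by
        refine avg_mono fun ω => ?_
        by_cases h : (cnt fun i => B i (ω i) : ℝ) ≤ t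
        · rw [ind_true h, ← Real.exp_add]
          exact Real.one_le_exp (by linarith)
        · rw [ind_false h]; positivity
    _ = Real.exp t * ∏ i, (1 + avg (fun a => ind (B i a)) * (Real.exp (-1) - 1)) := by
        rw [avg_const_mul, avg_exp_card]
    _ ≤ Real.exp t * ∏ i, Real.exp (-(1 / 2) * avg (fun a => ind (B i a))) := by
        have h2 : Real.exp (-1) ≤ 1 / 2 := by
          rw [Real.exp_neg, inv_le_comm₀ (Real.exp_pos _) (by norm_num)]
          have := Real.exp_one_gt_d9
          norm_num; linarith
        refine mul_le_mul_of_nonneg_left (Finset.prod_le_prod ?_ ?_) (Real.exp_pos _).le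
        · intro i _
          have h1 : 0 ≤ avg (fun a => ind (B i a)) := avg_nonneg fun a => ind_nonneg _
          have h3 : avg (fun a => ind (B i a)) ≤ 1 :=
            (avg_mono fun a => ind_le_one _).trans_eq (avg_const 1)
          have h4 := Real.exp_pos (-1)
          nlinarith
        · intro i _
          have h1 : 0 ≤ avg (fun a => ind (B i a)) := avg_nonneg fun a => ind_nonneg _
          have h3 := Real.add_one_le_exp (-(1 / 2) * avg (fun a => ind (B i a)))
          nlinarith
    _ = _ := by
        rw [← Real.exp_sum, ← Real.exp_add, ← Finset.mul_sum]
        congr 1; ring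

end Pi

lemma avg_ind_mem_subtype {β : Type*} (T S : Finset β) (hS : S ⊆ T) :
    avg (fun b : {b // b ∈ T} => ind ((b : β) ∈ S)) = S.card / T.card := by
  rw [avg_eq, Fintype.card_coe]
  congr 1
  rw [Finset.sum_coe_sort T (fun b => ind (b ∈ S)), ← Finset.sum_subset hS
    (fun b _ hb => ind_false hb), Finset.sum_congr rfl fun b hb => ind_true hb]
  simp

/-- In a uniformly random ranking, every element of `S` is equally likely to be the first. -/
lemma avg_ind_first {β : Type*} [Fintype β] {k : ℕ} [Nonempty (β ≃ Fin k)] {S : Finset β} {b : β}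
    (hb : b ∈ S) :
    avg (fun r : β ≃ Fin k => ind (∀ b' ∈ S, r b ≤ r b')) = 1 / S.card := by
  -- Composing with the transposition of b and b₁ preserves both the uniform law on rankings and the
  -- set S.
  have hsym : ∀ b₁ ∈ S, avg (fun r : β ≃ Fin k => ind (∀ b' ∈ S, r b₁ ≤ r b')) =
      avg (fun r : β ≃ Fin k => ind (∀ b' ∈ S, r b ≤ r b')) := by
    intro b₁ hb₁
    have hsw : ∀ b', b' ∈ S ↔ Equiv.swap b b₁ b' ∈ S := by
      intro b'
      rw [Equiv.swap_apply_def]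
      split_ifs with h1 h2
      · simp [h1, hb, hb₁]
      · simp [h2, hb, hb₁]
      · rfl
    rw [← avg_equiv (Equiv.equivCongr (Equiv.swap b b₁) (Equiv.refl (Fin k)))]
    congr 1
    funext r
    congr 1
    simp only [Equiv.equivCongr_apply_apply, Equiv.symm_swap, Equiv.swap_apply_right,
      Equiv.refl_apply]
    refine propext ⟨fun h b' hb' => ?_, fun h b' hb' => h _ ((hsw b').1 hb')⟩
    have := h (Equiv.swap b b₁ b') ((hsw b').1 hb')
    simpa using this
  -- In each ranking exactly one member of S comes first.
  have htot : ∑ b₁ ∈ S, avg (fun r : β ≃ Fin k => ind (∀ b' ∈ S, r b₁ ≤ r b')) = 1 := by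
    rw [← avg_sum, ← avg_const (Ω := β ≃ Fin k) 1]
    congr 1
    funext r
    obtain ⟨m, hm, hmin⟩ := Finset.exists_min_image S r ⟨b, hb⟩
    rw [Finset.sum_eq_single m]
    · exact ind_true hmin
    · intro b₁ hb₁ hne
      refine ind_false fun h => hne (r.injective (le_antisymm (h m hm) (hmin b₁ hb₁)))
    · exact fun h => absurd hm h
  rw [Finset.sum_congr rfl hsym, Finset.sum_const, nsmul_eq_mul] at htot
  have hc : (S.card : ℝ) ≠ 0 := by
    intro h; rw [h] at htot; simp at htot
  field_simp
  linarith

end Average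

/-! ### The random encoder -/

section Encoder

open Classical

variable {X Y Z : Type*} [Fintype X] [Fintype Y] [Fintype Z]
variable {n : ℕ} {Δ ε : ℝ} {c : (X → ℝ) → (X × Y → ℝ)} {ι : X ↪ Y}

lemma mem_condTypeClass {x : Fin n → X} {y : Fin n → Y} :
    y ∈ condTypeClass c x ↔ empPair x y = c (emp x) := by
  simp [condTypeClass]

/-- The type of a sequence of high empirical entropy. -/
def highType (x : Fin n → X) (hx : √Δ ≤ entropy (emp x)) : HighType X n Δ :=
  ⟨emp x, mem_types x, hx⟩

/-- The number of draws of a subcode that fall into a given set. -/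
def hits (C : Codebooks n Δ c) (Q : HighType X n Δ) (S : Finset (Fin n → Y)) : ℕ :=
  cnt fun l => (C Q l : Fin n → Y) ∈ S

/-- The members of the conditional type class of `x` that belong to the subcode of its type. -/
def cover (C : Codebooks n Δ c) (x : Fin n → X) (hx : √Δ ≤ entropy (emp x)) :
    Finset {y // y ∈ condTypeClass c x} :=
  Finset.univ.filter fun b => ∃ l, (C (highType x hx) l : Fin n → Y) = b

lemma mem_cover {C : Codebooks n Δ c} {x : Fin n → X} {hx : √Δ ≤ entropy (emp x)}
    {b : {y // y ∈ condTypeClass c x}} :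
    b ∈ cover C x hx ↔ ∃ l, (C (highType x hx) l : Fin n → Y) = b := by
  rw [cover, Finset.mem_filter]
  simp

lemma Admissible.exists_pair (h : Admissible ι Δ ε n c) {q : X → ℝ} (hq : q ∈ types n X) :
    ∃ x : Fin n → X, ∃ y : Fin n → Y, emp x = q ∧ empPair x y = c q ∧ emp y = margSnd (c q) := by
  obtain ⟨w, hw⟩ := exists_emp_of_mem_types (h.isType q hq)
  have hw' : empPair (fun i => (w i).1) (fun i => (w i).2) = c q := hw
  refine ⟨fun i => (w i).1, fun i => (w i).2, ?_, hw', ?_⟩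
  · rw [← h.marginal q hq, ← hw', margFst_empPair]
  · rw [← hw', margSnd_empPair]

lemma Admissible.exists_mem_condTypeClass (h : Admissible ι Δ ε n c) (x : Fin n → X) :
    ∃ y, y ∈ condTypeClass c x := by
  obtain ⟨x', y, hx', hxy, -⟩ := h.exists_pair (mem_types x)
  obtain ⟨σ, rfl⟩ := exists_perm_of_emp_eq hx'
  refine ⟨y ∘ σ, mem_condTypeClass.2 ?_⟩
  rw [← hxy]
  exact emp_comp_perm (fun i => (x' i, y i)) σ

lemma emp_of_mem_condTypeClass {x : Fin n → X} {y : Fin n → Y} (hy : y ∈ condTypeClass c x) :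
    emp y = margSnd (c (emp x)) := by
  rw [← mem_condTypeClass.1 hy, margSnd_empPair]

lemma Admissible.nonempty_typeClass (h : Admissible ι Δ ε n c) (Q : HighType X n Δ) :
    Nonempty {y // y ∈ typeClass n (margSnd (c Q.1))} := by
  obtain ⟨x, y, -, -, hy⟩ := h.exists_pair Q.2.1
  exact ⟨⟨y, mem_typeClass.2 hy⟩⟩

instance (x : Fin n → X) :
    Nonempty ({y // y ∈ condTypeClass c x} ≃ Fin (condTypeClass c x).card) :=
  ⟨(condTypeClass c x).equivFin⟩

instance : Nonempty (Rankings n c) := ⟨fun x => (condTypeClass c x).equivFin⟩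

lemma Admissible.nonempty_codebooks (h : Admissible ι Δ ε n c) : Nonempty (Codebooks n Δ c) :=
  ⟨fun Q _ => Classical.choice (h.nonempty_typeClass Q)⟩

lemma Admissible.nonempty_ensemble (h : Admissible ι Δ ε n c) : Nonempty (Ensemble n Δ c) :=
  ⟨(Classical.choice h.nonempty_codebooks, Classical.choice inferInstance)⟩

lemma avg_ensemble (f : Ensemble n Δ c → ℝ) :
    avg f = avg fun C : Codebooks n Δ c => avg fun r : Rankings n c => f (C, r) := by
  rw [← avg_prod]

/-- The empirical distribution of a losslessly reproduced sequence. -/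
lemma empPair_lossless (x : Fin n → X) :
    empPair x (fun i => ι (x i)) = identityJoint ι (emp x) := by
  funext ⟨a, b⟩
  simp only [empPair, emp_eq_sum, identityJoint]
  by_cases h : b = ι a
  · subst h
    simp
  · rw [if_neg h]
    have : ∀ i, ¬ ((x i, ι (x i)) = (a, b)) := by
      rintro i h'
      simp only [Prod.mk.injEq] at h'
      exact h (by rw [← h'.2, h'.1])
    simp [this]

lemma Admissible.condTypeClass_low (h : Admissible ι Δ ε n c) {x : Fin n → X}
    (hx : entropy (emp x) < √Δ) : condTypeClass c x = {fun i => ι (x i)} := by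
  ext y
  rw [mem_condTypeClass, h.lossless _ (mem_types x) hx, Finset.mem_singleton]
  constructor
  · intro hy
    funext i
    have h1 := emp_pos (fun i => (x i, y i)) i
    change 0 < empPair x y (x i, y i) at h1
    rw [hy, identityJoint] at h1
    by_contra hne
    rw [if_neg hne] at h1
    exact lt_irrefl _ h1
  · rintro rfl
    exact empPair_lossless x

lemma encode_low {x : Fin n → X} (hx : entropy (emp x) < √Δ) (ω : Ensemble n Δ c) :
    encode ι ω x = some fun i => ι (x i) := by
  rw [encode, if_pos hx]

lemma mem_subcodeRanks {ω : Ensemble n Δ c} {x : Fin n → X} (hx : √Δ ≤ entropy (emp x))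
    {j : Fin (condTypeClass c x).card} :
    j ∈ subcodeRanks ω x ↔ (ω.2 x).symm j ∈ cover ω.1 x hx := by
  rw [subcodeRanks, Finset.mem_filter, mem_cover]
  simp only [Finset.mem_univ, true_and, subcode, Set.mem_ofPred_eq]
  constructor
  · rintro ⟨Q, hQ, hl⟩
    have : Q = highType x hx := Subtype.ext hQ
    rwa [this] at hl
  · intro hl
    exact ⟨highType x hx, rfl, hl⟩

lemma encode_high_iff {ω : Ensemble n Δ c} {x : Fin n → X} (hx : √Δ ≤ entropy (emp x))
    {y : Fin n → Y} :
    encode ι ω x = some y ↔ ∃ b ∈ cover ω.1 x hx, (b : Fin n → Y) = y ∧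
      ∀ b' ∈ cover ω.1 x hx, ω.2 x b ≤ ω.2 x b' := by
  rw [encode, if_neg (not_lt.2 hx)]
  split_ifs with h
  · rw [Option.some_inj]
    constructor
    · rintro rfl
      refine ⟨_, (mem_subcodeRanks hx).1 (Finset.min'_mem _ h), rfl, fun b' hb' => ?_⟩
      rw [Equiv.apply_symm_apply]
      exact Finset.min'_le _ _ ((mem_subcodeRanks hx).2 (by simpa using hb'))
    · rintro ⟨b, hb, rfl, hmin⟩
      congr 1
      rw [Equiv.symm_apply_eq]
      refine le_antisymm (Finset.min'_le _ _ ((mem_subcodeRanks hx).2 (by simpa using hb))) ?_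
      have := hmin _ ((mem_subcodeRanks hx).1 (Finset.min'_mem _ h))
      rwa [Equiv.apply_symm_apply] at this
  · constructor
    · intro h'; cases h'
    · rintro ⟨b, hb, -, -⟩
      exact absurd ⟨ω.2 x b, (mem_subcodeRanks hx).2 (by simpa using hb)⟩ h

lemma encode_high_eq_none_iff {ω : Ensemble n Δ c} {x : Fin n → X} (hx : √Δ ≤ entropy (emp x)) :
    encode ι ω x = none ↔ cover ω.1 x hx = ∅ := by
  rw [Option.eq_none_iff_forall_ne_some, Finset.eq_empty_iff_forall_notMem]
  constructor
  · intro h b hb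
    obtain ⟨m, hm, hmin⟩ := Finset.exists_min_image (cover ω.1 x hx) (ω.2 x) ⟨b, hb⟩
    exact h m ((encode_high_iff hx).2 ⟨m, hm, rfl, hmin⟩)
  · intro h y hy
    obtain ⟨b, hb, -⟩ := (encode_high_iff hx).1 hy
    exact h b hb

lemma Admissible.mem_of_encode (h : Admissible ι Δ ε n c) {ω : Ensemble n Δ c} {x : Fin n → X}
    {y : Fin n → Y} (hy : encode ι ω x = some y) : y ∈ condTypeClass c x := by
  rcases lt_or_ge (entropy (emp x)) √Δ with hx | hx
  · rw [encode_low hx, Option.some_inj] at hy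
    rw [h.condTypeClass_low hx, ← hy]
    exact Finset.mem_singleton_self _
  · obtain ⟨b, -, rfl, -⟩ := (encode_high_iff hx).1 hy
    exact b.2

lemma mem_codebook_of_encode {ω : Ensemble n Δ c} {x : Fin n → X}
    {y : Fin n → Y} (hy : encode ι ω x = some y) : y ∈ codebook ι ω := by
  rcases lt_or_ge (entropy (emp x)) √Δ with hx | hx
  · rw [encode_low hx, Option.some_inj] at hy
    exact Or.inr ⟨x, hx, hy.symm⟩
  · obtain ⟨b, hb, rfl, -⟩ := (encode_high_iff hx).1 hy
    obtain ⟨l, hl⟩ := mem_cover.1 hb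
    exact Or.inl ⟨highType x hx, l, hl⟩

lemma card_cover_le_hits (C : Codebooks n Δ c) (x : Fin n → X) (hx : √Δ ≤ entropy (emp x)) :
    (cover C x hx).card ≤ hits C (highType x hx) (condTypeClass c x) := by
  rw [hits, cnt]
  refine le_trans ?_ (Finset.card_image_le (f := fun l => (C (highType x hx) l : Fin n → Y)))
  rw [← Finset.card_map (Function.Embedding.subtype _)]
  refine Finset.card_le_card fun y hy => ?_
  rw [Finset.mem_map] at hy
  obtain ⟨b, hb, rfl⟩ := hy
  obtain ⟨l, hl⟩ := mem_cover.1 hb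
  exact Finset.mem_image.2 ⟨l, by simp [hl], hl⟩

lemma cover_nonempty_of_hits {C : Codebooks n Δ c} {x : Fin n → X} {hx : √Δ ≤ entropy (emp x)}
    (h : 0 < hits C (highType x hx) (condTypeClass c x)) : (cover C x hx).Nonempty := by
  obtain ⟨l, hl⟩ := exists_of_cnt_pos h
  exact ⟨⟨_, hl⟩, mem_cover.2 ⟨l, rfl⟩⟩

/-- The draws of one subcode are independent and uniform in the type class, so the number of hits is
binomial and the Chernoff bound applies. -/
lemma Admissible.avg_hits_ge (h : Admissible ι Δ ε n c) (Q : HighType X n Δ)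
    {S : Finset (Fin n → Y)} (hS : S ⊆ typeClass n (margSnd (c Q.1))) (t : ℝ) :
    avg (fun C : Codebooks n Δ c => ind (t ≤ hits C Q S)) ≤
      Real.exp (2 * (subcodeSize n Δ (c Q.1) *
        (S.card / (typeClass n (margSnd (c Q.1))).card)) - t) := by
  have := h.nonempty_typeClass
  have h1 := avg_eval (α := fun Q : HighType X n Δ =>
    Fin (subcodeSize n Δ (c Q.1)) → {y // y ∈ typeClass n (margSnd (c Q.1))}) Q
    (fun w => ind (t ≤ (cnt fun l => (w l : Fin n → Y) ∈ S : ℝ)))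
  have h2 := avg_ind_le_card (α := fun _ : Fin (subcodeSize n Δ (c Q.1)) =>
    {y // y ∈ typeClass n (margSnd (c Q.1))}) (fun _ y => (y : Fin n → Y) ∈ S) t
  simp only [avg_ind_mem_subtype _ S hS, Finset.sum_const, Finset.card_univ, Fintype.card_fin,
    nsmul_eq_mul] at h2
  rw [← h1] at h2
  exact h2

lemma Admissible.avg_hits_le (h : Admissible ι Δ ε n c) (Q : HighType X n Δ)
    {S : Finset (Fin n → Y)} (hS : S ⊆ typeClass n (margSnd (c Q.1))) (t : ℝ) :
    avg (fun C : Codebooks n Δ c => ind ((hits C Q S : ℝ) ≤ t)) ≤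
      Real.exp (t - (subcodeSize n Δ (c Q.1) *
        (S.card / (typeClass n (margSnd (c Q.1))).card)) / 2) := by
  have := h.nonempty_typeClass
  have h1 := avg_eval (α := fun Q : HighType X n Δ =>
    Fin (subcodeSize n Δ (c Q.1)) → {y // y ∈ typeClass n (margSnd (c Q.1))}) Q
    (fun w => ind ((cnt fun l => (w l : Fin n → Y) ∈ S : ℝ) ≤ t))
  have h2 := avg_ind_card_le (α := fun _ : Fin (subcodeSize n Δ (c Q.1)) =>
    {y // y ∈ typeClass n (margSnd (c Q.1))}) (fun _ y => (y : Fin n → Y) ∈ S) t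
  simp only [avg_ind_mem_subtype _ S hS, Finset.sum_const, Finset.card_univ, Fintype.card_fin,
    nsmul_eq_mul] at h2
  rw [← h1] at h2
  exact h2

/-- Given the code, the encoder picks uniformly among the covering codewords. -/
lemma avg_rankings_encode (C : Codebooks n Δ c) {x : Fin n → X} (hx : √Δ ≤ entropy (emp x))
    (b : {y // y ∈ condTypeClass c x}) :
    avg (fun r : Rankings n c => ind (encode ι (C, r) x = some (b : Fin n → Y))) =
      ind (b ∈ cover C x hx) * (1 / (cover C x hx).card) := by
  have h1 : (fun r : Rankings n c => ind (encode ι (C, r) x = some (b : Fin n → Y))) =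
      fun r => ind (b ∈ cover C x hx) * ind (∀ b' ∈ cover C x hx, r x b ≤ r x b') := by
    funext r
    by_cases hb : b ∈ cover C x hx
    · rw [ind_true hb, one_mul]
      congr 1
      rw [encode_high_iff hx]
      refine propext ⟨?_, fun h => ⟨b, hb, rfl, h⟩⟩
      rintro ⟨b', -, e, h⟩
      rwa [Subtype.ext e] at h
    · rw [ind_false hb, zero_mul]
      refine ind_false fun h => hb ?_
      obtain ⟨b', hb', e, -⟩ := (encode_high_iff hx).1 h
      rwa [Subtype.ext e] at hb'
  rw [h1, avg_const_mul]
  by_cases hb : b ∈ cover C x hx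
  · rw [avg_eval (α := fun x : Fin n → X =>
      {y // y ∈ condTypeClass c x} ≃ Fin (condTypeClass c x).card) x
      (fun ρ => ind (∀ b' ∈ cover C x hx, ρ b ≤ ρ b')), avg_ind_first hb]
  · simp [ind_false hb]

/-- The codebooks with two vectors of the same type interchanged. -/
def swapCode {y₁ y₂ : Fin n → Y} (hy : emp y₁ = emp y₂) : Codebooks n Δ c ≃ Codebooks n Δ c :=
  Equiv.piCongrRight fun _ => Equiv.piCongrRight fun _ =>
    (Equiv.swap y₁ y₂).subtypePerm fun y => by
      rw [mem_typeClass, mem_typeClass, Equiv.swap_apply_def]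
      split_ifs with h1 h2
      · rw [h1, hy]
      · rw [h2, hy]
      · rfl

lemma swapCode_apply {y₁ y₂ : Fin n → Y} (hy : emp y₁ = emp y₂) (C : Codebooks n Δ c)
    (Q : HighType X n Δ) (l) : (swapCode hy C Q l : Fin n → Y) = Equiv.swap y₁ y₂ (C Q l) := rfl

/-- All members of the conditional type class are equally likely reproductions of x: averaging over
rankings gives 1/|cover| for each covering vector, and interchanging two vectors throughout the code
keeps the law of the code and the size of the cover. -/
lemma Admissible.avg_encode_eq (h : Admissible ι Δ ε n c) {x : Fin n → X} {y : Fin n → Y}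
    (hy : y ∈ condTypeClass c x) :
    avg (fun ω : Ensemble n Δ c => ind (encode ι ω x = some y)) * (condTypeClass c x).card =
      1 - avg (fun ω : Ensemble n Δ c => ind (encode ι ω x = none)) := by
  have := h.nonempty_ensemble
  have htot : ∑ y ∈ condTypeClass c x, avg (fun ω : Ensemble n Δ c => ind (encode ι ω x = some y)) =
      1 - avg (fun ω : Ensemble n Δ c => ind (encode ι ω x = none)) := by
    rw [eq_sub_iff_add_eq, ← avg_sum, ← avg_add]
    refine Eq.trans ?_ (avg_const (Ω := Ensemble n Δ c) 1)
    congr 1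
    funext ω
    rcases he : encode ι ω x with _ | y'
    · rw [ind_true rfl, Finset.sum_eq_zero, zero_add]
      intro y' _
      exact ind_false (by simp)
    · rw [Finset.sum_eq_single y', ind_true rfl, ind_false (by simp), add_zero]
      · intro y'' _ hne
        exact ind_false fun e => hne (Option.some_inj.1 e).symm
      · intro hn; exact absurd (h.mem_of_encode he) hn
  rw [← htot]
  rcases lt_or_ge (entropy (emp x)) √Δ with hx | hx
  · rw [h.condTypeClass_low hx] at hy ⊢
    rw [Finset.mem_singleton.1 hy, Finset.sum_singleton, Finset.card_singleton]
    simp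
  have hsym : ∀ y' ∈ condTypeClass c x,
      avg (fun ω : Ensemble n Δ c => ind (encode ι ω x = some y')) =
      avg (fun ω : Ensemble n Δ c => ind (encode ι ω x = some y)) := by
    intro y' hy'
    have e : emp y = emp y' := by
      rw [emp_of_mem_condTypeClass hy, emp_of_mem_condTypeClass hy']
    rw [avg_ensemble, avg_ensemble]
    simp only [avg_rankings_encode (ι := ι) _ hx ⟨y, hy⟩, avg_rankings_encode (ι := ι) _ hx ⟨y', hy'⟩]
    rw [← avg_equiv (swapCode (Δ := Δ) (c := c) e)]
    congr 1
    funext C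
    have hsw : ∀ b, b ∈ condTypeClass c x ↔ Equiv.swap y y' b ∈ condTypeClass c x := by
      intro b
      rw [Equiv.swap_apply_def]
      split_ifs with h1 h2
      · simp [h1, hy, hy']
      · simp [h2, hy, hy']
      · rfl
    have hmem : ∀ b (hb : b ∈ condTypeClass c x),
        (⟨b, hb⟩ : {y // y ∈ condTypeClass c x}) ∈ cover (swapCode e C) x hx ↔
        (⟨Equiv.swap y y' b, (hsw b).1 hb⟩ : {y // y ∈ condTypeClass c x}) ∈ cover C x hx := by
      intro b hb
      simp only [mem_cover, swapCode_apply]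
      refine exists_congr fun l => ?_
      rw [Equiv.swap_apply_eq_iff]
    have hcard : (cover (swapCode e C) x hx).card = (cover C x hx).card := by
      refine Finset.card_equiv ((Equiv.swap y y').subtypePerm fun b => (hsw b).symm) ?_
      rintro ⟨b, hb⟩
      exact hmem b hb
    rw [hcard]
    congr 2
    refine propext ((hmem y' hy').trans ?_)
    simp only [Equiv.swap_apply_right]
  rw [Finset.sum_congr rfl hsym, Finset.sum_const, nsmul_eq_mul, mul_comm]

/-- Given a code that covers no sequence too often, every codeword is the
reproduction of many sequences. -/
lemma Admissible.avg_fiber_le (h : Admissible ι Δ ε n c) (C : Codebooks n Δ c)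
    (Q : HighType X n Δ) {m : ℝ}
    (hC : ∀ x hx, emp x = Q.1 → ((cover C x hx).card : ℝ) ≤ m) {y : Fin n → Y}
    (hy : ∃ l, (C Q l : Fin n → Y) = y) (t : ℝ) :
    avg (fun r : Rankings n c =>
      ind ((cnt fun x => encode ι (C, r) x = some y : ℝ) ≤ t)) ≤
    Real.exp (t - ((cnt fun x : Fin n → X => empPair x y = c Q.1) / m) / 2) := by
  have key : ∀ x : Fin n → X, empPair x y = c Q.1 → ∃ hx : √Δ ≤ entropy (emp x),
      emp x = Q.1 ∧ ∃ hy : y ∈ condTypeClass c x, (⟨y, hy⟩ : {y // _}) ∈ cover C x hx := by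
    intro x hxy
    have e : emp x = Q.1 := by rw [← h.marginal _ Q.2.1, ← hxy, margFst_empPair]
    have hx : √Δ ≤ entropy (emp x) := e ▸ Q.2.2
    refine ⟨hx, e, mem_condTypeClass.2 (by rw [hxy, e]), mem_cover.2 ?_⟩
    have : highType x hx = Q := Subtype.ext e
    rw [this]; exact hy
  -- With the code fixed, the event that x is reproduced by y involves the ranking at x only. These
  -- events are therefore independent over x, each of probability 1/|cover| ≥ 1/m.
  let B : ∀ x : Fin n → X, ({y // y ∈ condTypeClass c x} ≃ Fin (condTypeClass c x).card) → Prop :=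
    fun x ρ => empPair x y = c Q.1 ∧ ∃ hx, ∃ hy : y ∈ condTypeClass c x,
      ∀ b' ∈ cover C x hx, ρ ⟨y, hy⟩ ≤ ρ b'
  have h1 := avg_ind_card_le B t
  refine le_trans (avg_mono fun r => ind_mono fun hr => le_trans ?_ hr) (h1.trans ?_)
  · refine Nat.cast_le.2 (cnt_mono fun x hx => ?_)
    obtain ⟨hxy, hx1, hx2, hx3⟩ := hx
    obtain ⟨hx4, -, hx5, hx6⟩ := key x hxy
    exact (encode_high_iff hx1).2 ⟨_, hx6, rfl, hx3⟩
  · refine Real.exp_le_exp.2 (sub_le_sub_left (div_le_div_of_nonneg_right ?_ zero_le_two) _)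
    rw [cnt, Finset.card_filter, Nat.cast_sum, Finset.sum_div]
    refine Finset.sum_le_sum fun x _ => ?_
    by_cases hxy : empPair x y = c Q.1
    · obtain ⟨hx4, hx7, hx5, hx6⟩ := key x hxy
      rw [if_pos hxy]
      have h2 : avg (fun ρ => ind (B x ρ)) = 1 / (cover C x hx4).card := by
        rw [← avg_ind_first (k := (condTypeClass c x).card) hx6]
        congr 1
        funext ρ
        congr 1
        refine propext ⟨fun hB => ?_, fun hB => ⟨hxy, hx4, hx5, hB⟩⟩
        obtain ⟨-, _, _, hB⟩ := hB
        exact hB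
      rw [h2, Nat.cast_one]
      refine one_div_le_one_div_of_le ?_ (hC x hx4 hx7)
      exact_mod_cast Finset.card_pos.2 ⟨_, hx6⟩
    · rw [if_neg hxy]
      simp only [Nat.cast_zero, zero_div]
      exact avg_nonneg fun _ => ind_nonneg _

end Encoder

/-! ### The error probability of a given encoder -/

section GivenEncoder

open Classical

variable {X Y Z : Type*} [Fintype X] [Fintype Y] [Fintype Z]
variable {n : ℕ} {Δ ε : ℝ} {c : (X → ℝ) → (X × Y → ℝ)} {ι : X ↪ Y}
variable {G : X → ℝ} {W : X → Z → ℝ} {R : ℝ}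

/-- Independence of the enrolled vectors: the coordinate m is pinned to a, and each of the other |κ|
− 1 coordinates avoids the bad set with probability 1 − P(bad). -/
lemma sum_pi_split {κ α : Type*} [Fintype κ] [DecidableEq κ] [Fintype α] (m : κ) {g : α → ℝ}
    (hg : ∑ a, g a = 1) (bad : α → Prop) (a : α) :
    ∑ x : κ → α, ind (x m = a) * ((∏ j, g (x j)) * ind (∀ j, j ≠ m → ¬ bad (x j))) =
      g a * (1 - ∑ b, g b * ind (bad b)) ^ (Fintype.card κ - 1) := by
  have h1 : ∀ x : κ → α, ind (x m = a) * ((∏ j, g (x j)) * ind (∀ j, j ≠ m → ¬ bad (x j))) =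
      ∏ j, (if j = m then g (x j) * ind (x j = a) else g (x j) * ind (¬ bad (x j))) := by
    intro x
    rw [← Finset.mul_prod_erase Finset.univ _ (Finset.mem_univ m),
      ← Finset.mul_prod_erase Finset.univ (fun j => if j = m then _ else _) (Finset.mem_univ m),
      if_pos rfl]
    have h2 : ∏ j ∈ Finset.univ.erase m,
        (if j = m then g (x j) * ind (x j = a) else g (x j) * ind (¬ bad (x j))) =
        (∏ j ∈ Finset.univ.erase m, g (x j)) * ind (∀ j, j ≠ m → ¬ bad (x j)) := by
      have h3 : ind (∀ j, j ≠ m → ¬ bad (x j)) =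
          ∏ j ∈ Finset.univ.erase m, ind (¬ bad (x j)) := by
        by_cases h : ∀ j, j ≠ m → ¬ bad (x j)
        · rw [ind_true h, Finset.prod_eq_one]
          intro j hj
          exact ind_true (h j (Finset.ne_of_mem_erase hj))
        · rw [ind_false h]
          push Not at h
          obtain ⟨j, hj, hb⟩ := h
          rw [Finset.prod_eq_zero (Finset.mem_erase.2 ⟨hj, Finset.mem_univ j⟩)
            (ind_false (not_not.2 hb))]
      rw [h3, ← Finset.prod_mul_distrib]
      refine Finset.prod_congr rfl fun j hj => ?_
      rw [if_neg (Finset.ne_of_mem_erase hj)]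
    rw [h2]
    ring
  simp only [h1]
  have h4 := Finset.prod_univ_sum (fun _ : κ => (Finset.univ : Finset α))
    (fun j b => if j = m then g b * ind (b = a) else g b * ind (¬ bad b))
  rw [Fintype.piFinset_univ] at h4
  rw [← h4, ← Finset.mul_prod_erase Finset.univ _ (Finset.mem_univ m)]
  congr 1
  · simp only [if_true]
    rw [Finset.sum_eq_single a]
    · rw [ind_true rfl, mul_one]
    · intro b _ hb; rw [ind_false hb, mul_zero]
    · simp
  · rw [Finset.prod_congr rfl (g := fun _ => 1 - ∑ b, g b * ind (bad b)),
      Finset.prod_const, Finset.card_erase_of_mem (Finset.mem_univ m), Finset.card_univ]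
    intro j hj
    simp only [if_neg (Finset.ne_of_mem_erase hj)]
    rw [← hg, ← Finset.sum_sub_distrib]
    refine Finset.sum_congr rfl fun b _ => ?_
    by_cases hb : bad b
    · rw [ind_true hb, ind_false (not_not.2 hb)]; ring
    · rw [ind_false hb, ind_true hb]; ring

/-- The probability that a competitor has a metric not larger than that of `y`. -/
def confusion (G : X → ℝ) (ι : X ↪ Y) (ω : Ensemble n Δ c) (y : Fin n → Y) (z : Fin n → Z) : ℝ :=
  ∑ x : Fin n → X, (∏ i, G (x i)) *
    ind (∃ y', encode ι ω x = some y' ∧ metric G ι ω y' z ≤ metric G ι ω y z)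

/-- The probability of error when `x` is drawn and `z` is observed. -/
def condError (G : X → ℝ) (R : ℝ) (ι : X ↪ Y) (ω : Ensemble n Δ c) (x : Fin n → X)
    (z : Fin n → Z) : ℝ :=
  match encode ι ω x with
  | none => 1
  | some y => 1 - (1 - confusion G ι ω y z) ^ (numEnrolled n R - 1)

lemma numEnrolled_pos (n : ℕ) (R : ℝ) : 0 < numEnrolled n R := Nat.ceil_pos.2 (Real.exp_pos _)

/-- Every index m contributes the same amount, so the average over m disappears. Given x_m and z,
identification succeeds precisely when y_m exists and none of the M − 1 independent competitors has
a metric that is as small. -/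
lemma errorProbGiven_eq (hG : G ∈ stdSimplex ℝ X) (ω : Ensemble n Δ c) :
    errorProbGiven G W R ι ω =
      ∑ x : Fin n → X, (∏ i, G (x i)) * ∑ z : Fin n → Z, (∏ i, W (x i) (z i)) *
        condError G R ι ω x z := by
  set M := numEnrolled n R with hM
  have hM0 : (M : ℝ) ≠ 0 := by exact_mod_cast (numEnrolled_pos n R).ne'
  have key : ∀ m : Fin M, ∑ x : Fin M → Fin n → X, (∏ j, ∏ i, G (x j i)) *
      ∑ z : Fin n → Z, (∏ i, W (x m i) (z i)) * (if Identifies G ι ω x m z then 0 else 1) =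
      ∑ x : Fin n → X, (∏ i, G (x i)) * ∑ z : Fin n → Z, (∏ i, W (x i) (z i)) *
        condError G R ι ω x z := by
    intro m
    have h1 : ∀ x : Fin M → Fin n → X, (∏ j, ∏ i, G (x j i)) *
        ∑ z : Fin n → Z, (∏ i, W (x m i) (z i)) * (if Identifies G ι ω x m z then 0 else 1) =
        ∑ a : Fin n → X, ∑ z : Fin n → Z, (∏ i, W (a i) (z i)) *
          (ind (x m = a) * ((∏ j, ∏ i, G (x j i)) *
            (if Identifies G ι ω x m z then 0 else 1))) := by
      intro x
      rw [Finset.sum_eq_single (x m)]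
      · rw [ind_true rfl, Finset.mul_sum]
        refine Finset.sum_congr rfl fun z _ => ?_
        ring
      · intro a _ ha
        refine Finset.sum_eq_zero fun z _ => ?_
        rw [ind_false (Ne.symm ha)]; ring
      · simp
    simp only [h1]
    rw [Finset.sum_comm]
    refine Finset.sum_congr rfl fun a _ => ?_
    rw [Finset.sum_comm, Finset.mul_sum]
    refine Finset.sum_congr rfl fun z _ => ?_
    rw [← Finset.mul_sum, mul_left_comm]
    congr 1
    have hg := sum_prod_eq_one (n := n) hG
    -- With an empty bad set this is the total probability of x_m = a, needed when the encoder fails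
    -- and for taking complements.
    have h0 := sum_pi_split m hg (fun _ => False) a
    simp only [not_false_eq_true, implies_true, ind_true, mul_one, ind_false, mul_zero,
      Finset.sum_const_zero, sub_zero, one_pow] at h0
    rw [condError]
    rcases he : encode ι ω a with _ | y
    · simp only [mul_one]
      rw [← h0]
      refine Finset.sum_congr rfl fun x _ => ?_
      by_cases hx : x m = a
      · have : ¬ Identifies G ι ω x m z := by
          rintro ⟨y, hy, -⟩
          rw [hx, he] at hy
          cases hy
        rw [if_neg this, mul_one]
      · rw [ind_false hx, zero_mul, zero_mul]
    · have h2 := sum_pi_split m hg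
        (fun x' => ∃ y', encode ι ω x' = some y' ∧ metric G ι ω y' z ≤ metric G ι ω y z) a
      rw [Fintype.card_fin] at h2
      simp only
      rw [mul_sub, mul_one, confusion, ← h2]
      rw [← h0, ← Finset.sum_sub_distrib]
      refine Finset.sum_congr rfl fun x _ => ?_
      by_cases hx : x m = a
      · rw [ind_true hx]
        have hiff : Identifies G ι ω x m z ↔ ∀ j, j ≠ m →
            ¬ ∃ y', encode ι ω (x j) = some y' ∧ metric G ι ω y' z ≤ metric G ι ω y z := by
          constructor
          · rintro ⟨y₁, hy₁, hmin⟩ j hj ⟨y', hy', hle⟩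
            rw [hx, he, Option.some_inj] at hy₁
            subst hy₁
            exact absurd (hmin j hj y' hy') (not_lt.2 hle)
          · intro h
            refine ⟨y, by rw [hx, he], fun j hj y' hy' => ?_⟩
            by_contra hlt
            exact h j hj ⟨y', hy', not_lt.1 hlt⟩
        by_cases hI : Identifies G ι ω x m z
        · rw [if_pos hI, ind_true (hiff.1 hI)]; ring
        · rw [if_neg hI, ind_false (fun h => hI (hiff.2 h))]; ring
      · rw [ind_false hx]; ring
  rw [errorProbGiven]
  simp only [← mul_div_assoc, ← Finset.sum_div]
  rw [div_eq_iff hM0]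
  have h5 : ∀ x : Fin M → Fin n → X, (∏ m, ∏ i, G (x m i)) * ∑ m : Fin M, ∑ z : Fin n → Z,
      (∏ i, W (x m i) (z i)) * (if Identifies G ι ω x m z then 0 else 1) =
      ∑ m : Fin M, (∏ j, ∏ i, G (x j i)) * ∑ z : Fin n → Z,
        (∏ i, W (x m i) (z i)) * (if Identifies G ι ω x m z then 0 else 1) := fun x => by
    rw [Finset.mul_sum]
  rw [Finset.sum_congr rfl fun x _ => h5 x, Finset.sum_comm, Finset.sum_congr rfl fun m _ => key m]
  simp [mul_comm]

lemma errorProb_eq_avg (hG : G ∈ stdSimplex ℝ X) :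
    errorProb G W R ι n Δ c = avg fun ω : Ensemble n Δ c =>
      ∑ x : Fin n → X, (∏ i, G (x i)) * ∑ z : Fin n → Z, (∏ i, W (x i) (z i)) *
        condError G R ι ω x z := by
  rw [errorProb, avg_eq]
  simp only [errorProbGiven_eq hG]

lemma prob_nonneg (hG : G ∈ stdSimplex ℝ X) (x : Fin n → X) : 0 ≤ ∏ i, G (x i) :=
  Finset.prod_nonneg fun _ _ => hG.1 _

lemma chan_nonneg (hW : IsChannel W) (x : Fin n → X) (z : Fin n → Z) :
    0 ≤ ∏ i, W (x i) (z i) :=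
  Finset.prod_nonneg fun _ _ => (hW _).1 _

lemma sum_chan_eq_one (hW : IsChannel W) (x : Fin n → X) :
    ∑ z : Fin n → Z, ∏ i, W (x i) (z i) = 1 := by
  have h := Finset.prod_univ_sum (fun _ : Fin n => (Finset.univ : Finset Z))
    (fun i b => W (x i) b)
  rw [Fintype.piFinset_univ] at h
  rw [← h]
  exact Finset.prod_eq_one fun i _ => (hW _).2

lemma confusion_nonneg (hG : G ∈ stdSimplex ℝ X) (ω : Ensemble n Δ c) (y : Fin n → Y)
    (z : Fin n → Z) : 0 ≤ confusion G ι ω y z :=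
  Finset.sum_nonneg fun x _ => mul_nonneg (prob_nonneg hG x) (ind_nonneg _)

lemma confusion_le_one (hG : G ∈ stdSimplex ℝ X) (ω : Ensemble n Δ c) (y : Fin n → Y)
    (z : Fin n → Z) : confusion G ι ω y z ≤ 1 := by
  rw [← sum_prod_eq_one (n := n) hG]
  exact Finset.sum_le_sum fun x _ => mul_le_of_le_one_right (prob_nonneg hG x) (ind_le_one _)

lemma one_sub_pow_le {b : ℝ} (hb1 : b ≤ 1) (k : ℕ) :
    1 - (1 - b) ^ k ≤ min 1 (k * b) := by
  refine le_min ?_ ?_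
  · have : 0 ≤ (1 - b) ^ k := pow_nonneg (by linarith) k
    linarith
  · have := one_add_mul_le_pow (a := -b) (by linarith) k
    rw [← sub_eq_add_neg] at this
    linarith

/-- With t = kb, (1 − b)^k ≤ e^{-t} ≤ 1/(1+t), and t/(1+t) ≥ min(1, t)/2. Together with
`one_sub_pow_le`, the truncated union bound is thus tight up to a factor 2. -/
lemma le_one_sub_pow {b : ℝ} (hb : 0 ≤ b) (hb1 : b ≤ 1) (k : ℕ) :
    min 1 (k * b) / 2 ≤ 1 - (1 - b) ^ k := by
  have h1 : (1 - b) ^ k ≤ Real.exp (-(k * b)) := by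
    have := Real.add_one_le_exp (-b)
    calc (1 - b) ^ k ≤ Real.exp (-b) ^ k := pow_le_pow_left₀ (by linarith) (by linarith) k
      _ = _ := by rw [← Real.exp_nat_mul]; congr 1; ring
  set t := (k : ℝ) * b
  have ht : 0 ≤ t := by positivity
  have h2 : Real.exp (-t) ≤ 1 / (1 + t) := by
    rw [Real.exp_neg, ← one_div]
    exact one_div_le_one_div_of_le (by linarith) (by linarith [Real.add_one_le_exp t])
  have h3 : min 1 t / 2 ≤ 1 - 1 / (1 + t) := by
    rw [one_sub_div (by positivity), add_sub_cancel_left, div_le_div_iff₀ (by norm_num) (by positivity)]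
    rcases le_total t 1 with h | h
    · rw [min_eq_right h]; nlinarith
    · rw [min_eq_left h]; nlinarith
  linarith

lemma condError_mem (hG : G ∈ stdSimplex ℝ X) (ω : Ensemble n Δ c) (x : Fin n → X)
    (z : Fin n → Z) : 0 ≤ condError G R ι ω x z ∧ condError G R ι ω x z ≤ 1 := by
  rw [condError]
  split
  · simp
  · rename_i y _
    have h1 := confusion_nonneg (ι := ι) hG ω y z
    have h2 := confusion_le_one (ι := ι) hG ω y z
    have h3 := pow_le_one₀ (n := numEnrolled n R - 1) (by linarith : 0 ≤ 1 - confusion G ι ω y z)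
      (by linarith)
    have h4 := pow_nonneg (by linarith : 0 ≤ 1 - confusion G ι ω y z) (numEnrolled n R - 1)
    constructor <;> linarith

lemma condError_some {ω : Ensemble n Δ c} {x : Fin n → X} {y : Fin n → Y}
    (h : encode ι ω x = some y) (z : Fin n → Z) :
    condError G R ι ω x z = 1 - (1 - confusion G ι ω y z) ^ (numEnrolled n R - 1) := by
  rw [condError, h]

lemma numTypical_eq_cnt (ω : Ensemble n Δ c) (y : Fin n → Y) (z : Fin n → Z) :
    numTypical ι ω y z = cnt fun y' => y' ∈ codebook ι ω ∧ empPair y' z = empPair y z := by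
  rw [numTypical, Set.ncard_eq_toFinset_card', cnt]
  congr 1
  ext y'
  simp

lemma metric_congr (ω : Ensemble n Δ c) {y y' : Fin n → Y} {z : Fin n → Z}
    (h : empPair y' z = empPair y z) : metric G ι ω y' z = metric G ι ω y z := by
  have : emp y' = emp y := by rw [← margFst_empPair y' z, ← margFst_empPair y z, h]
  rw [metric, metric, numTypical, numTypical, h, this]

/-- This is where the one-to-one assumption enters: the type of a reproduction determines the type
of the source sequence. -/
lemma Admissible.emp_eq_of_emp_eq (h : Admissible ι Δ ε n c) {x x' : Fin n → X} {y y' : Fin n → Y}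
    (hy : y ∈ condTypeClass c x) (hy' : y' ∈ condTypeClass c x') (e : emp y' = emp y) :
    emp x' = emp x := by
  refine h.oneToOne (mem_types x') (mem_types x) ?_
  simp only
  rw [← emp_of_mem_condTypeClass hy, ← emp_of_mem_condTypeClass hy', e]

lemma Admissible.alpha_eq (h : Admissible ι Δ ε n c) {x : Fin n → X} {y : Fin n → Y}
    (hy : y ∈ condTypeClass c x) :
    alpha n G c (emp y) = mutualInfo (c (emp x)) + (relEntropy (emp x) G).toReal := by
  have e : Function.invFunOn (fun QX => margSnd (c QX)) (types n X : Set (X → ℝ)) (emp y) =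
      emp x := by
    rw [emp_of_mem_condTypeClass hy]
    exact h.oneToOne.leftInvOn_invFunOn (mem_types x)
  rw [alpha]
  simp only [e]

/-- Bounds on the sizes of type classes that hold at all large block lengths. -/
structure SizeBounds (X Y Z : Type*) [Fintype X] [Fintype Y] [Fintype Z] (n : ℕ) (δ : ℝ) :
    Prop where
  pos : 0 < n
  xy : ∀ (x : Fin n → X) (y : Fin n → Y),
    Real.exp (n * (entropy (empPair x y) - entropy (emp x) - δ)) ≤ condCard x y ∧
    (condCard x y : ℝ) ≤ Real.exp (n * (entropy (empPair x y) - entropy (emp x) + δ))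
  yx : ∀ (y : Fin n → Y) (x : Fin n → X),
    Real.exp (n * (entropy (empPair y x) - entropy (emp y) - δ)) ≤ condCard y x ∧
    (condCard y x : ℝ) ≤ Real.exp (n * (entropy (empPair y x) - entropy (emp y) + δ))
  zy : ∀ (z : Fin n → Z) (y : Fin n → Y),
    Real.exp (n * (entropy (empPair z y) - entropy (emp z) - δ)) ≤ condCard z y ∧
    (condCard z y : ℝ) ≤ Real.exp (n * (entropy (empPair z y) - entropy (emp z) + δ))
  y : ∀ y : Fin n → Y, Real.exp (n * (entropy (emp y) - δ)) ≤ (typeClass n (emp y)).card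
  xyz : ∀ p : Fin n → (X × Y) × Z,
    Real.exp (n * (entropy (emp p) - δ)) ≤ (typeClass n (emp p)).card
  card_yz : ((types n (Y × Z)).card : ℝ) ≤ Real.exp (n * δ)
  card_xyz : ((types n ((X × Y) × Z)).card : ℝ) ≤ Real.exp (n * δ)
  const : 8 ≤ Real.exp (n * δ)

lemma eventually_le_exp (C : ℝ) {δ : ℝ} (hδ : 0 < δ) :
    ∀ᶠ n : ℕ in Filter.atTop, C ≤ Real.exp (n * δ) :=
  (Real.tendsto_exp_atTop.comp
    (tendsto_natCast_atTop_atTop.atTop_mul_const hδ)).eventually_ge_atTop C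

lemma eventually_sizeBounds (X Y Z : Type*) [Fintype X] [Fintype Y] [Fintype Z] {δ : ℝ}
    (hδ : 0 < δ) : ∀ᶠ n : ℕ in Filter.atTop, SizeBounds X Y Z n δ := by
  filter_upwards [Filter.eventually_gt_atTop 0, eventually_condCard X Y hδ,
    eventually_condCard Y X hδ, eventually_condCard Z Y hδ, eventually_card_typeClass Y hδ,
    eventually_card_typeClass ((X × Y) × Z) hδ, eventually_card_types (Y × Z) hδ,
    eventually_card_types ((X × Y) × Z) hδ, eventually_le_exp 8 hδ]
    with n h1 h2 h3 h4 h5 h6 h7 h8 h9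
  exact ⟨h1, h2, h3, h4, h5, h6, h7, h8, h9⟩

lemma mutualInfo_empPair (x : Fin n → X) (y : Fin n → Y) :
    mutualInfo (empPair x y) = entropy (emp x) + entropy (emp y) - entropy (empPair x y) := by
  rw [mutualInfo, condEntropy, margFst_empPair, margSnd_empPair]; ring

lemma cnt_empPair_left (x : Fin n → X) (y : Fin n → Y) :
    (cnt fun x' : Fin n → X => empPair x' y = empPair x y) = condCard y x := by
  rw [cnt, condCard]
  congr 1
  ext x'
  simp only [Finset.mem_filter, Finset.mem_univ, true_and]
  exact (empPair_swap_eq_iff x' x y y).symm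

/-- The source probability of the sequences with a given reproduction. -/
def fiberProb (G : X → ℝ) (ι : X ↪ Y) (ω : Ensemble n Δ c) (y : Fin n → Y) : ℝ :=
  ∑ x : Fin n → X, (∏ i, G (x i)) * ind (encode ι ω x = some y)

lemma Admissible.alpha_eq_klReal (h : Admissible ι Δ ε n c) (hn : 0 < n) (hG : G ∈ stdSimplex ℝ X)
    {x : Fin n → X} {y : Fin n → Y} (hy : y ∈ condTypeClass c x)
    (hac : ∀ a, G a = 0 → emp x a = 0) :
    alpha n G c (emp y) = mutualInfo (empPair x y) + klReal G (emp x) := by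
  rw [h.alpha_eq hy, relEntropy_eq_ofReal hac,
    ENNReal.toReal_ofReal (klReal_nonneg hG (emp_mem hn x) hac), mem_condTypeClass.1 hy]

/-- All sequences of positive probability reproduced by y share one joint type with y. There are at
most about e^{nH(X|Y)} of them, each of probability e^{-n(H(X) + D(Q_X‖G))}, and the difference of
the exponents is α. -/
lemma Admissible.fiberProb_le (h : Admissible ι Δ ε n c) (hG : G ∈ stdSimplex ℝ X) {δ : ℝ}
    (hs : SizeBounds X Y Z n δ) (ω : Ensemble n Δ c) (y : Fin n → Y) :
    fiberProb G ι ω y ≤ Real.exp (-(n * (alpha n G c (emp y) - δ))) := by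
  by_cases h0 : ∃ x, encode ι ω x = some y ∧ ∏ i, G (x i) ≠ 0
  · obtain ⟨x₀, hx₀, hne⟩ := h0
    have hac := emp_ac_of_prod_ne_zero hne
    have hy := h.mem_of_encode hx₀
    have h1 : fiberProb G ι ω y ≤ ∑ x : Fin n → X,
        Real.exp (-(n * (entropy (emp x₀) + klReal G (emp x₀)))) *
          ind (empPair x y = empPair x₀ y) := by
      refine Finset.sum_le_sum fun x _ => ?_
      by_cases hx : encode ι ω x = some y
      · have hy' := h.mem_of_encode hx
        have e := h.emp_eq_of_emp_eq hy hy' rfl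
        rw [ind_true hx, ind_true (by
          rw [mem_condTypeClass.1 hy', mem_condTypeClass.1 hy, e]),
          prod_eq_exp_klReal hG.1 (by rwa [e]), e]
      · rw [ind_false hx, mul_zero]
        exact mul_nonneg (Real.exp_pos _).le (ind_nonneg _)
    refine h1.trans ?_
    have h2 : ∑ x : Fin n → X, ind (empPair x y = empPair x₀ y) = condCard y x₀ := by
      rw [← cnt_empPair_left, cnt_cast]
    rw [← Finset.mul_sum, h2, h.alpha_eq_klReal hs.pos hG hy hac]
    refine (mul_le_mul_of_nonneg_left (hs.yx y x₀).2 (Real.exp_pos _).le).trans ?_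
    rw [← Real.exp_add, mutualInfo_empPair, entropy_empPair_swap]
    refine Real.exp_le_exp.2 (le_of_eq ?_)
    ring
  · push Not at h0
    rw [fiberProb, Finset.sum_eq_zero]
    · exact (Real.exp_pos _).le
    · intro x _
      by_cases hx : encode ι ω x = some y
      · rw [h0 x hx, zero_mul]
      · rw [ind_false hx, mul_zero]

lemma numTypical_pos {ω : Ensemble n Δ c} {y : Fin n → Y} (hy : y ∈ codebook ι ω)
    (z : Fin n → Z) : 0 < numTypical ι ω y z := by
  rw [numTypical_eq_cnt]
  exact cnt_pos ⟨hy, rfl⟩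

/-- Group the codewords by their joint type with z: a nonempty group of N codewords contributes N ·
(1/N) = 1. -/
lemma sum_inv_numTypical_le (ω : Ensemble n Δ c) (z : Fin n → Z) :
    ∑ y : Fin n → Y, ind (y ∈ codebook ι ω) * (1 / (numTypical ι ω y z : ℝ)) ≤
      (types n (Y × Z)).card := by
  rw [← Finset.sum_fiberwise_of_maps_to (g := fun y : Fin n → Y => empPair y z)
    (t := types n (Y × Z)) (fun y _ => mem_types _)]
  calc _ ≤ ∑ _τ ∈ types n (Y × Z), (1 : ℝ) := by
        refine Finset.sum_le_sum fun τ _ => ?_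
        by_cases hex : ∃ y₀ : Fin n → Y, empPair y₀ z = τ
        · obtain ⟨y₀, rfl⟩ := hex
          have h1 : ∀ y ∈ Finset.univ.filter (fun y : Fin n → Y => empPair y z = empPair y₀ z),
              ind (y ∈ codebook ι ω) * (1 / (numTypical ι ω y z : ℝ)) =
              ind (y ∈ codebook ι ω) * (1 / (numTypical ι ω y₀ z : ℝ)) := by
            intro y hy
            rw [numTypical, numTypical, (Finset.mem_filter.1 hy).2]
          rw [Finset.sum_congr rfl h1, ← Finset.sum_mul]
          have h2 : ∑ y ∈ Finset.univ.filter (fun y : Fin n → Y => empPair y z = empPair y₀ z),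
              ind (y ∈ codebook ι ω) = numTypical ι ω y₀ z := by
            rw [numTypical_eq_cnt, cnt_cast, Finset.sum_filter]
            refine Finset.sum_congr rfl fun y _ => ?_
            by_cases ha : y ∈ codebook ι ω <;> by_cases hb : empPair y z = empPair y₀ z <;>
              simp [ha, hb, ind]
          rw [h2]
          rw [mul_one_div]
          exact div_self_le_one _
        · rw [Finset.filter_eq_empty_iff.2 fun y _ he => hex ⟨y, he⟩]
          simp
    _ = _ := by simp

lemma exp_metric {ω : Ensemble n Δ c} {y : Fin n → Y} (hy : y ∈ codebook ι ω) (z : Fin n → Z) :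
    Real.exp (metric G ι ω y z) =
      numTypical ι ω y z * Real.exp (-(n * alpha n G c (emp y))) := by
  have : (0 : ℝ) < numTypical ι ω y z := by exact_mod_cast numTypical_pos hy z
  rw [metric, sub_eq_add_neg, Real.exp_add, Real.exp_log this]

/-- The metric of y' is the logarithm of N(y'|z) times the estimate e^{-nα} of its fibre
probability. A y' with metric at most that of y thus has fibre probability at most e^{nδ}
e^{metric(y)}/N(y'|z), and the reciprocals add up to a subexponential factor. -/
lemma Admissible.confusion_le (h : Admissible ι Δ ε n c) (hG : G ∈ stdSimplex ℝ X) {δ : ℝ}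
    (hs : SizeBounds X Y Z n δ) (ω : Ensemble n Δ c) {y : Fin n → Y} (hy : y ∈ codebook ι ω)
    (z : Fin n → Z) :
    confusion G ι ω y z ≤
      Real.exp (n * (2 * δ)) * (numTypical ι ω y z * Real.exp (-(n * alpha n G c (emp y)))) := by
  rw [← exp_metric hy]
  have h1 : confusion G ι ω y z ≤ ∑ y' : Fin n → Y,
      ind (y' ∈ codebook ι ω ∧ metric G ι ω y' z ≤ metric G ι ω y z) * fiberProb G ι ω y' := by
    simp only [fiberProb, Finset.mul_sum]
    rw [Finset.sum_comm]
    refine Finset.sum_le_sum fun x _ => ?_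
    have hnn : ∀ y' ∈ (Finset.univ : Finset (Fin n → Y)),
        0 ≤ ind (y' ∈ codebook ι ω ∧ metric G ι ω y' z ≤ metric G ι ω y z) *
        ((∏ i, G (x i)) * ind (encode ι ω x = some y')) := fun y' _ =>
      mul_nonneg (ind_nonneg _) (mul_nonneg (prob_nonneg hG x) (ind_nonneg _))
    by_cases hx : ∃ y', encode ι ω x = some y' ∧ metric G ι ω y' z ≤ metric G ι ω y z
    · obtain ⟨y', hy', hle⟩ := hx
      refine le_trans (le_of_eq ?_) (Finset.single_le_sum hnn (Finset.mem_univ y'))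
      rw [ind_true ⟨y', hy', hle⟩, ind_true hy', ind_true ⟨mem_codebook_of_encode hy', hle⟩,
        one_mul]
    · rw [ind_false hx, mul_zero]
      exact Finset.sum_nonneg hnn
  refine h1.trans ?_
  have h2 : ∀ y' : Fin n → Y, ind (y' ∈ codebook ι ω ∧ metric G ι ω y' z ≤ metric G ι ω y z) *
      fiberProb G ι ω y' ≤ Real.exp (n * δ) * Real.exp (metric G ι ω y z) *
        (ind (y' ∈ codebook ι ω) * (1 / (numTypical ι ω y' z : ℝ))) := by
    intro y'
    by_cases hc : y' ∈ codebook ι ω ∧ metric G ι ω y' z ≤ metric G ι ω y z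
    · rw [ind_true hc, ind_true hc.1, one_mul, one_mul]
      have hN : (0 : ℝ) < numTypical ι ω y' z := by exact_mod_cast numTypical_pos hc.1 z
      have h3 := h.fiberProb_le hG hs ω y'
      have h4 : Real.exp (-(n * (alpha n G c (emp y') - δ))) =
          Real.exp (n * δ) * (Real.exp (metric G ι ω y' z) * (1 / (numTypical ι ω y' z : ℝ))) := by
        rw [exp_metric hc.1]
        have : Real.exp (-(n * (alpha n G c (emp y') - δ))) =
            Real.exp (n * δ) * Real.exp (-(n * alpha n G c (emp y'))) := by
          rw [← Real.exp_add]; congr 1; ring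
        rw [this]; field_simp
      rw [h4] at h3
      refine h3.trans ?_
      rw [mul_assoc]
      refine mul_le_mul_of_nonneg_left ?_ (Real.exp_pos _).le
      exact mul_le_mul_of_nonneg_right (Real.exp_le_exp.2 hc.2) (by positivity)
    · rw [ind_false hc, zero_mul]
      exact mul_nonneg (by positivity) (mul_nonneg (ind_nonneg _) (by positivity))
  refine (Finset.sum_le_sum fun y' _ => h2 y').trans ?_
  rw [← Finset.mul_sum]
  have h5 := (sum_inv_numTypical_le (ι := ι) ω z).trans hs.card_yz
  calc _ ≤ Real.exp (n * δ) * Real.exp (metric G ι ω y z) * Real.exp (n * δ) :=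
        mul_le_mul_of_nonneg_left h5 (by positivity)
    _ = _ := by
        have : Real.exp (n * (2 * δ)) = Real.exp (n * δ) * Real.exp (n * δ) := by
          rw [← Real.exp_add]; congr 1; ring
        rw [this]; ring

/-- The metric depends on a codeword only through its joint type with z, so every codeword counted
by N(y|z) ties with y, and ties are errors. -/
lemma le_confusion (hG : G ∈ stdSimplex ℝ X) (ω : Ensemble n Δ c) {y : Fin n → Y}
    (z : Fin n → Z) {q : ℝ}
    (hq : ∀ y' ∈ codebook ι ω, empPair y' z = empPair y z → q ≤ fiberProb G ι ω y') :
    numTypical ι ω y z * q ≤ confusion G ι ω y z := by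
  have h1 : ∑ y' : Fin n → Y, ind (y' ∈ codebook ι ω ∧ empPair y' z = empPair y z) *
      fiberProb G ι ω y' ≤ confusion G ι ω y z := by
    simp only [fiberProb, Finset.mul_sum]
    rw [Finset.sum_comm]
    refine Finset.sum_le_sum fun x _ => ?_
    rcases he : encode ι ω x with _ | y₁
    · rw [Finset.sum_eq_zero]
      · exact mul_nonneg (prob_nonneg hG x) (ind_nonneg _)
      · intro y' _
        rw [ind_false (p := none = some y') (by simp)]; ring
    · rw [Finset.sum_eq_single y₁]
      · rw [ind_true rfl, mul_one, mul_comm]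
        refine mul_le_mul_of_nonneg_left (ind_mono fun hc => ?_) (prob_nonneg hG x)
        exact ⟨y₁, rfl, (metric_congr ω hc.2).le⟩
      · intro y' _ hne
        rw [ind_false (fun e => hne (Option.some_inj.1 e).symm)]; ring
      · simp
  refine le_trans ?_ h1
  have h2 : (numTypical ι ω y z : ℝ) =
      ∑ y' : Fin n → Y, ind (y' ∈ codebook ι ω ∧ empPair y' z = empPair y z) := by
    rw [numTypical_eq_cnt, cnt_cast]
  rw [h2, Finset.sum_mul]
  refine Finset.sum_le_sum fun y' _ => ?_
  by_cases hc : y' ∈ codebook ι ω ∧ empPair y' z = empPair y z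
  · rw [ind_true hc]
    exact mul_le_mul_of_nonneg_left (hq y' hc.1 hc.2) zero_le_one
  · rw [ind_false hc, zero_mul, zero_mul]

end GivenEncoder

/-! ### Typical behaviour of the ensemble -/

section GoodEvent

open Classical

variable {X Y Z : Type*} [Fintype X] [Fintype Y] [Fintype Z]
variable {n : ℕ} {Δ ε δ : ℝ} {c : (X → ℝ) → (X × Y → ℝ)} {ι : X ↪ Y}
variable {G : X → ℝ} {W : X → Z → ℝ} {R : ℝ}

/-- The sequences that have the same joint type with `z` as `y`. -/
def jointClass (y : Fin n → Y) (z : Fin n → Z) : Finset (Fin n → Y) :=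
  Finset.univ.filter fun y' => empPair y' z = empPair y z

lemma mem_jointClass {y y' : Fin n → Y} {z : Fin n → Z} :
    y' ∈ jointClass y z ↔ empPair y' z = empPair y z := by
  simp [jointClass]

lemma card_jointClass (y : Fin n → Y) (z : Fin n → Z) :
    (jointClass y z).card = condCard z y := by
  rw [← cnt_empPair_left, jointClass, cnt_eq]

lemma card_condTypeClass {x : Fin n → X} {y : Fin n → Y} (hy : y ∈ condTypeClass c x) :
    (condTypeClass c x).card = condCard x y := by
  rw [condTypeClass, condCard, mem_condTypeClass.1 hy]

lemma emp_eq_of_mem_jointClass {y y' : Fin n → Y} {z : Fin n → Z} (h : y' ∈ jointClass y z) :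
    emp y' = emp y := by
  rw [← margFst_empPair y' z, ← margFst_empPair y z, mem_jointClass.1 h]

/-- The properties of the code that hold with overwhelming probability. -/
structure GoodCode (Z : Type*) [Fintype Z] (δ : ℝ) (C : Codebooks n Δ c) : Prop where
  cover_pos : ∀ x hx, 0 < hits C (highType x hx) (condTypeClass c x)
  cover_le : ∀ x hx, (hits C (highType x hx) (condTypeClass c x) : ℝ) ≤
    Real.exp (n * (Δ + 4 * δ))
  typical_ge : ∀ x hx, ∀ y ∈ condTypeClass c x, ∀ z : Fin n → Z,
    mutualInfo (empPair y z) ≤ mutualInfo (empPair x y) →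
    Real.exp (n * (mutualInfo (empPair x y) + Δ - mutualInfo (empPair y z) - 2 * δ)) ≤
      hits C (highType x hx) (jointClass y z)
  typical_le : ∀ x hx, ∀ y ∈ condTypeClass c x, ∀ z : Fin n → Z,
    (hits C (highType x hx) (jointClass y z) : ℝ) ≤
    Real.exp (n * (max 0 (mutualInfo (empPair x y) + Δ - mutualInfo (empPair y z)) + 4 * δ))

/-- The properties of the encoder that hold with overwhelming probability. -/
structure GoodEncoder (Z : Type*) [Fintype Z] (ι : X ↪ Y) (δ : ℝ) (ω : Ensemble n Δ c) :
    Prop where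
  code : GoodCode Z δ ω.1
  fiber : ∀ x hx, ∀ y ∈ condTypeClass c x, (∃ l, (ω.1 (highType x hx) l : Fin n → Y) = y) →
    Real.exp (n * (entropy (empPair x y) - entropy (emp y) - Δ - 6 * δ)) ≤
      cnt fun x' => encode ι ω x' = some y

lemma SizeBounds.mul_exp_le (hs : SizeBounds X Y Z n δ) {a b : ℝ} (h : a + δ ≤ b) :
    8 * Real.exp (n * a) ≤ Real.exp (n * b) := by
  calc _ ≤ Real.exp (n * δ) * Real.exp (n * a) :=
        mul_le_mul_of_nonneg_right hs.const (Real.exp_pos _).le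
    _ = Real.exp (n * (a + δ)) := by rw [← Real.exp_add]; congr 1; ring
    _ ≤ _ := Real.exp_le_exp.2 (mul_le_mul_of_nonneg_left h (by positivity))

lemma exp_mul_le_exp_mul {n : ℕ} {a b : ℝ} (h : a ≤ b) :
    Real.exp (n * a) ≤ Real.exp (n * b) :=
  Real.exp_le_exp.2 (mul_le_mul_of_nonneg_left h (by positivity))

lemma le_subcodeSize (n : ℕ) (Δ : ℝ) (Q : X × Y → ℝ) :
    Real.exp (n * (mutualInfo Q + Δ)) ≤ subcodeSize n Δ Q := Nat.le_ceil _

lemma subcodeSize_le (hΔ : 0 ≤ Δ) {Q : X × Y → ℝ} (hQ : Q ∈ stdSimplex ℝ (X × Y)) :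
    (subcodeSize n Δ Q : ℝ) ≤ 2 * Real.exp (n * (mutualInfo Q + Δ)) := by
  have h1 := mutualInfo_nonneg hQ
  have h2 : (1 : ℝ) ≤ Real.exp (n * (mutualInfo Q + Δ)) := Real.one_le_exp (by positivity)
  have h3 := Nat.ceil_lt_add_one (Real.exp_pos (n * (mutualInfo Q + Δ))).le
  rw [subcodeSize]
  linarith

/-- The mean number of codewords in a subset of the type class. -/
lemma mean_bounds (hs : SizeBounds X Y Z n δ) (hΔ : 0 ≤ Δ) {x : Fin n → X} {y : Fin n → Y}
    {N : ℕ} {J : ℝ} (h1 : Real.exp (n * (entropy (emp y) - J - δ)) ≤ N)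
    (h2 : N ≤ Real.exp (n * (entropy (emp y) - J + δ))) :
    Real.exp (n * (mutualInfo (empPair x y) + Δ - J - δ)) ≤
      subcodeSize n Δ (empPair x y) * (N / (typeClass n (emp y)).card) ∧
    subcodeSize n Δ (empPair x y) * (N / (typeClass n (emp y)).card) ≤
      2 * Real.exp (n * (mutualInfo (empPair x y) + Δ - J + 2 * δ)) := by
  -- The parameter J is I(X;Y) for the vectors that can cover x, where the mean is about e^{nΔ}, and
  -- I(Y;Z) for the vectors jointly typed with z.
  have hT := typeClass_card_pos y
  have hT1 := card_typeClass_upper y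
  have hT2 := hs.y y
  have hm1 := le_subcodeSize n Δ (empPair x y)
  have hm2 := subcodeSize_le (n := n) hΔ (emp_mem hs.pos (fun i => (x i, y i)))
  change (subcodeSize n Δ (empPair x y) : ℝ) ≤ 2 * Real.exp (n * (mutualInfo (empPair x y) + Δ))
    at hm2
  rw [← mul_div_assoc]
  constructor
  · rw [le_div_iff₀ hT]
    calc _ ≤ Real.exp (n * (mutualInfo (empPair x y) + Δ - J - δ)) *
          Real.exp (n * entropy (emp y)) := mul_le_mul_of_nonneg_left hT1 (Real.exp_pos _).le
      _ = Real.exp (n * (mutualInfo (empPair x y) + Δ)) *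
          Real.exp (n * (entropy (emp y) - J - δ)) := by
          rw [← Real.exp_add, ← Real.exp_add]; congr 1; ring
      _ ≤ _ := mul_le_mul hm1 h1 (Real.exp_pos _).le (Nat.cast_nonneg _)
  · rw [div_le_iff₀ hT]
    calc _ ≤ (2 * Real.exp (n * (mutualInfo (empPair x y) + Δ))) *
          Real.exp (n * (entropy (emp y) - J + δ)) :=
          mul_le_mul hm2 h2 (Nat.cast_nonneg _) (by positivity)
      _ = 2 * Real.exp (n * (mutualInfo (empPair x y) + Δ - J + 2 * δ)) *
          Real.exp (n * (entropy (emp y) - δ)) := by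
          rw [mul_assoc, mul_assoc, ← Real.exp_add, ← Real.exp_add]; congr 2; ring
      _ ≤ _ := mul_le_mul_of_nonneg_left hT2 (by positivity)

/-- Deviations of the number of codewords in a subset of the type class are very unlikely. -/
lemma Admissible.avg_hits_upper (h : Admissible ι Δ ε n c) (hs : SizeBounds X Y Z n δ)
    (hΔ : 0 ≤ Δ) (hδ : 0 < δ) {x : Fin n → X} (hx : √Δ ≤ entropy (emp x)) {y : Fin n → Y}
    (hy : y ∈ condTypeClass c x) {S : Finset (Fin n → Y)} (hS : S ⊆ typeClass n (emp y)) {J a : ℝ}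
    (h1 : Real.exp (n * (entropy (emp y) - J - δ)) ≤ S.card)
    (h2 : S.card ≤ Real.exp (n * (entropy (emp y) - J + δ)))
    (ha : 0 ≤ a) (ha' : mutualInfo (empPair x y) + Δ - J ≤ a) :
    avg (fun C : Codebooks n Δ c => ind (Real.exp (n * (a + 4 * δ)) ≤ hits C (highType x hx) S)) ≤
      Real.exp (-Real.exp (n * δ)) := by
  have hm := (mean_bounds (x := x) hs hΔ h1 h2).2
  have e := emp_of_mem_condTypeClass hy
  have e2 := mem_condTypeClass.1 hy
  refine (h.avg_hits_ge (highType x hx) (S := S) (by rw [e] at hS; exact hS) _).trans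
    (Real.exp_le_exp.2 ?_)
  change 2 * ((subcodeSize n Δ (c (emp x)) : ℝ) *
    (S.card / (typeClass n (margSnd (c (emp x)))).card)) - _ ≤ _
  rw [← e, ← e2]
  -- Twice the mean is at most 4e^{n(a+2δ)}, while the threshold is at least 8e^{n(a+2δ)}; a ≥ 0
  -- makes the surplus at least e^{nδ}. Truncating a at zero covers sets whose mean number of hits
  -- is small.
  have h3 := exp_mul_le_exp_mul (n := n)
    (by linarith : mutualInfo (empPair x y) + Δ - J + 2 * δ ≤ a + 2 * δ)
  have h4 := hs.mul_exp_le (by linarith : a + 2 * δ + δ ≤ a + 4 * δ)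
  have h5 := exp_mul_le_exp_mul (n := n) (by linarith : δ ≤ a + 2 * δ)
  have h6 := Real.exp_pos (n * (a + 2 * δ))
  linarith

lemma Admissible.avg_hits_lower (h : Admissible ι Δ ε n c) (hs : SizeBounds X Y Z n δ)
    (hΔ : 0 ≤ Δ) {x : Fin n → X} (hx : √Δ ≤ entropy (emp x)) {y : Fin n → Y}
    (hy : y ∈ condTypeClass c x) {S : Finset (Fin n → Y)} (hS : S ⊆ typeClass n (emp y)) {J t : ℝ}
    (h1 : Real.exp (n * (entropy (emp y) - J - δ)) ≤ S.card)
    (h2 : S.card ≤ Real.exp (n * (entropy (emp y) - J + δ)))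
    (ha' : 3 * δ ≤ mutualInfo (empPair x y) + Δ - J)
    (ht : t ≤ Real.exp (n * (mutualInfo (empPair x y) + Δ - J - 2 * δ))) :
    avg (fun C : Codebooks n Δ c => ind ((hits C (highType x hx) S : ℝ) ≤ t)) ≤
      Real.exp (-Real.exp (n * δ)) := by
  have hm := (mean_bounds (x := x) hs hΔ h1 h2).1
  have e := emp_of_mem_condTypeClass hy
  have e2 := mem_condTypeClass.1 hy
  refine (h.avg_hits_le (highType x hx) (S := S) (by rw [e] at hS; exact hS) _).trans
    (Real.exp_le_exp.2 ?_)
  change t - ((subcodeSize n Δ (c (emp x)) : ℝ) *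
    (S.card / (typeClass n (margSnd (c (emp x)))).card)) / 2 ≤ _
  rw [← e, ← e2]
  have h4 := hs.mul_exp_le (by linarith : mutualInfo (empPair x y) + Δ - J - 2 * δ + δ ≤
    mutualInfo (empPair x y) + Δ - J - δ)
  have h5 := hs.mul_exp_le (by linarith : δ + δ ≤ mutualInfo (empPair x y) + Δ - J - δ)
  have h6 := Real.exp_pos (n * δ)
  linarith

lemma avg_ind_exists_le {Ω κ : Type*} [Fintype Ω] [Fintype κ] {B : κ → Ω → Prop} {b : ℝ}
    (hB : ∀ i, avg (fun ω => ind (B i ω)) ≤ b) :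
    avg (fun ω => ind (∃ i, B i ω)) ≤ Fintype.card κ * b := by
  calc _ ≤ avg (fun ω => ∑ i, ind (B i ω)) := by
        refine avg_mono fun ω => ?_
        by_cases h : ∃ i, B i ω
        · obtain ⟨i, hi⟩ := h
          rw [ind_true ⟨i, hi⟩, ← ind_true hi]
          exact Finset.single_le_sum (f := fun i => ind (B i ω)) (fun _ _ => ind_nonneg _)
            (Finset.mem_univ i)
        · rw [ind_false h]
          exact Finset.sum_nonneg fun _ _ => ind_nonneg _
    _ = ∑ i, avg (fun ω => ind (B i ω)) := avg_sum _ _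
    _ ≤ ∑ _i : κ, b := Finset.sum_le_sum fun i _ => hB i
    _ = _ := by simp

/-- Deterministic side conditions p of a random event may be assumed: without them the event is
empty. -/
lemma avg_ind_le_of_imp {Ω : Type*} [Fintype Ω] {p : Prop} {B : Ω → Prop} {b : ℝ} (hb : 0 ≤ b)
    (hp : ∀ ω, B ω → p) (h : p → avg (fun ω => ind (B ω)) ≤ b) : avg (fun ω => ind (B ω)) ≤ b := by
  by_cases hp' : p
  · exact h hp'
  · have : (fun ω => ind (B ω)) = fun _ => (0 : ℝ) * 0 := by
      funext ω; rw [ind_false fun hB => hp' (hp ω hB), zero_mul]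
    rw [this, avg_const_mul, zero_mul]; exact hb

lemma jointClass_subset (y : Fin n → Y) (z : Fin n → Z) :
    jointClass y z ⊆ typeClass n (emp y) := fun _ hy' =>
  mem_typeClass.2 (emp_eq_of_mem_jointClass hy')

lemma condTypeClass_subset {x : Fin n → X} {y : Fin n → Y} (hy : y ∈ condTypeClass c x) :
    condTypeClass c x ⊆ typeClass n (emp y) := fun _ hy' =>
  mem_typeClass.2 (by rw [emp_of_mem_condTypeClass hy', emp_of_mem_condTypeClass hy])

lemma SizeBounds.condTypeClass (hs : SizeBounds X Y Z n δ) {x : Fin n → X} {y : Fin n → Y}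
    (hy : y ∈ condTypeClass c x) :
    Real.exp (n * (entropy (emp y) - mutualInfo (empPair x y) - δ)) ≤ (condTypeClass c x).card ∧
    ((condTypeClass c x).card : ℝ) ≤
      Real.exp (n * (entropy (emp y) - mutualInfo (empPair x y) + δ)) := by
  rw [card_condTypeClass hy, mutualInfo_empPair]
  have := hs.xy x y
  constructor
  · refine le_trans (exp_mul_le_exp_mul ?_) this.1; linarith
  · refine le_trans this.2 (exp_mul_le_exp_mul ?_); linarith

lemma SizeBounds.jointClass (hs : SizeBounds X Y Z n δ) (y : Fin n → Y) (z : Fin n → Z) :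
    Real.exp (n * (entropy (emp y) - mutualInfo (empPair y z) - δ)) ≤ (jointClass y z).card ∧
    ((jointClass y z).card : ℝ) ≤
      Real.exp (n * (entropy (emp y) - mutualInfo (empPair y z) + δ)) := by
  rw [card_jointClass, mutualInfo_empPair]
  have := hs.zy z y
  rw [entropy_empPair_swap] at this
  constructor
  · refine le_trans (exp_mul_le_exp_mul ?_) this.1; linarith
  · refine le_trans this.2 (exp_mul_le_exp_mul ?_); linarith

/-- The number of tuples of sequences of the three alphabets. -/
def tupleCard (X Y Z : Type*) [Fintype X] [Fintype Y] [Fintype Z] (n : ℕ) : ℕ :=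
  ((Fintype.card X + 1) * (Fintype.card Y + 1) * (Fintype.card Z + 1)) ^ n

lemma card_seq_le (X Y Z : Type*) [Fintype X] [Fintype Y] [Fintype Z] (n : ℕ) :
    Fintype.card (Fin n → X) ≤ tupleCard X Y Z n := by
  rw [tupleCard, Fintype.card_pi, Finset.prod_const, Finset.card_univ, Fintype.card_fin]
  refine Nat.pow_le_pow_left ?_ n
  nlinarith [Nat.zero_le (Fintype.card X), Nat.zero_le (Fintype.card Y),
    Nat.zero_le (Fintype.card Z), Nat.zero_le (Fintype.card X * Fintype.card Y),
    Nat.zero_le (Fintype.card X * Fintype.card Y * Fintype.card Z),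
    Nat.zero_le (Fintype.card X * Fintype.card Z), Nat.zero_le (Fintype.card Y * Fintype.card Z)]

lemma card_pairSeq_le (X Y Z : Type*) [Fintype X] [Fintype Y] [Fintype Z] (n : ℕ) :
    Fintype.card ((Fin n → X) × (Fin n → Y)) ≤ tupleCard X Y Z n := by
  rw [Fintype.card_prod, Fintype.card_pi, Fintype.card_pi]
  simp only [Finset.prod_const, Finset.card_univ, Fintype.card_fin]
  rw [tupleCard, ← mul_pow]
  refine Nat.pow_le_pow_left ?_ n
  nlinarith [Nat.zero_le (Fintype.card X), Nat.zero_le (Fintype.card Y),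
    Nat.zero_le (Fintype.card Z), Nat.zero_le (Fintype.card X * Fintype.card Y),
    Nat.zero_le (Fintype.card X * Fintype.card Y * Fintype.card Z),
    Nat.zero_le (Fintype.card X * Fintype.card Z), Nat.zero_le (Fintype.card Y * Fintype.card Z)]

lemma card_tripleSeq_le (X Y Z : Type*) [Fintype X] [Fintype Y] [Fintype Z] (n : ℕ) :
    Fintype.card ((Fin n → X) × (Fin n → Y) × (Fin n → Z)) ≤ tupleCard X Y Z n := by
  rw [Fintype.card_prod, Fintype.card_prod, Fintype.card_pi, Fintype.card_pi, Fintype.card_pi]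
  simp only [Finset.prod_const, Finset.card_univ, Fintype.card_fin]
  rw [tupleCard, ← mul_pow, ← mul_pow]
  refine Nat.pow_le_pow_left ?_ n
  nlinarith [Nat.zero_le (Fintype.card X), Nat.zero_le (Fintype.card Y),
    Nat.zero_le (Fintype.card Z), Nat.zero_le (Fintype.card X * Fintype.card Y),
    Nat.zero_le (Fintype.card X * Fintype.card Y * Fintype.card Z),
    Nat.zero_le (Fintype.card X * Fintype.card Z), Nat.zero_le (Fintype.card Y * Fintype.card Z)]

/-- Union bound over four families of deviations: an uncovered sequence, a sequence covered by too
many draws, and too few or too many draws with a given joint type. The condition 3δ ≤ Δ makes the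
means in the two lower-tail events exponentially large. -/
lemma Admissible.avg_not_goodCode (h : Admissible ι Δ ε n c) (hs : SizeBounds X Y Z n δ)
    (hδ : 0 < δ) (hδΔ : 3 * δ ≤ Δ) :
    avg (fun C : Codebooks n Δ c => ind (¬ GoodCode Z δ C)) ≤
      4 * (tupleCard X Y Z n * Real.exp (-Real.exp (n * δ))) := by
  have hΔ : 0 ≤ Δ := by linarith
  have hb := (Real.exp_pos (-Real.exp (n * δ))).le
  let B₁ : (Fin n → X) → Codebooks n Δ c → Prop := fun x C =>
    ∃ hx, (hits C (highType x hx) (condTypeClass c x) : ℝ) ≤ 0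
  let B₂ : (Fin n → X) → Codebooks n Δ c → Prop := fun x C =>
    ∃ hx, Real.exp (n * (Δ + 4 * δ)) ≤ hits C (highType x hx) (condTypeClass c x)
  let B₃ : (Fin n → X) × (Fin n → Y) × (Fin n → Z) → Codebooks n Δ c → Prop := fun p C =>
    ∃ hx, p.2.1 ∈ condTypeClass c p.1 ∧
      mutualInfo (empPair p.2.1 p.2.2) ≤ mutualInfo (empPair p.1 p.2.1) ∧
      (hits C (highType p.1 hx) (jointClass p.2.1 p.2.2) : ℝ) ≤
      Real.exp (n * (mutualInfo (empPair p.1 p.2.1) + Δ - mutualInfo (empPair p.2.1 p.2.2) - 2 * δ))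
  let B₄ : (Fin n → X) × (Fin n → Y) × (Fin n → Z) → Codebooks n Δ c → Prop := fun p C =>
    ∃ hx, p.2.1 ∈ condTypeClass c p.1 ∧
      Real.exp (n * (max 0 (mutualInfo (empPair p.1 p.2.1) + Δ - mutualInfo (empPair p.2.1 p.2.2))
        + 4 * δ)) ≤ hits C (highType p.1 hx) (jointClass p.2.1 p.2.2)
  have key : ∀ C : Codebooks n Δ c, ind (¬ GoodCode Z δ C) ≤
      ind (∃ x, B₁ x C) + ind (∃ x, B₂ x C) + ind (∃ p, B₃ p C) + ind (∃ p, B₄ p C) := by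
    intro C
    by_cases h1 : ∃ x, B₁ x C
    · rw [ind_true h1]
      linarith [ind_le_one (¬ GoodCode Z δ C), ind_nonneg (∃ x, B₂ x C), ind_nonneg (∃ p, B₃ p C),
        ind_nonneg (∃ p, B₄ p C)]
    by_cases h2 : ∃ x, B₂ x C
    · rw [ind_true h2]
      linarith [ind_le_one (¬ GoodCode Z δ C), ind_nonneg (∃ x, B₁ x C), ind_nonneg (∃ p, B₃ p C),
        ind_nonneg (∃ p, B₄ p C)]
    by_cases h3 : ∃ p, B₃ p C
    · rw [ind_true h3]
      linarith [ind_le_one (¬ GoodCode Z δ C), ind_nonneg (∃ x, B₁ x C), ind_nonneg (∃ p, B₂ p C),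
        ind_nonneg (∃ p, B₄ p C)]
    by_cases h4 : ∃ p, B₄ p C
    · rw [ind_true h4]
      linarith [ind_le_one (¬ GoodCode Z δ C), ind_nonneg (∃ x, B₁ x C), ind_nonneg (∃ p, B₂ p C),
        ind_nonneg (∃ p, B₃ p C)]
    rw [ind_false (p := ¬ GoodCode Z δ C)]
    · linarith [ind_nonneg (∃ x, B₁ x C), ind_nonneg (∃ p, B₂ p C), ind_nonneg (∃ p, B₃ p C),
        ind_nonneg (∃ p, B₄ p C)]
    · rw [not_not]
      refine ⟨fun x hx => ?_, fun x hx => ?_, fun x hx y hy z hI => ?_, fun x hx y hy z => ?_⟩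
      · by_contra hc
        exact h1 ⟨x, hx, by exact_mod_cast not_lt.1 hc⟩
      · by_contra hc
        exact h2 ⟨x, hx, (not_le.1 hc).le⟩
      · by_contra hc
        exact h3 ⟨(x, y, z), hx, hy, hI, (not_le.1 hc).le⟩
      · by_contra hc
        exact h4 ⟨(x, y, z), hx, hy, (not_le.1 hc).le⟩
  refine (avg_mono key).trans ?_
  rw [avg_add, avg_add, avg_add]
  have hx1 : (Fintype.card (Fin n → X) : ℝ) ≤ tupleCard X Y Z n := by
    exact_mod_cast card_seq_le X Y Z n
  have hx2 : (Fintype.card ((Fin n → X) × (Fin n → Y) × (Fin n → Z)) : ℝ) ≤ tupleCard X Y Z n := by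
    exact_mod_cast card_tripleSeq_le X Y Z n
  have e1 : avg (fun C => ind (∃ x, B₁ x C)) ≤
      tupleCard X Y Z n * Real.exp (-Real.exp (n * δ)) := by
    refine (avg_ind_exists_le fun x => ?_).trans (mul_le_mul_of_nonneg_right hx1 hb)
    refine avg_ind_le_of_imp hb (p := √Δ ≤ entropy (emp x)) (fun C hC => hC.1) fun hx => ?_
    obtain ⟨y, hy⟩ := h.exists_mem_condTypeClass x
    refine le_trans (avg_mono fun C => ind_mono fun hC => ?_) (h.avg_hits_lower hs hΔ hx hy
      (condTypeClass_subset hy) (hs.condTypeClass hy).1 (hs.condTypeClass hy).2 (t := 0)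
      (by linarith) (Real.exp_pos _).le)
    exact hC.2
  have e2 : avg (fun C => ind (∃ x, B₂ x C)) ≤
      tupleCard X Y Z n * Real.exp (-Real.exp (n * δ)) := by
    refine (avg_ind_exists_le fun x => ?_).trans (mul_le_mul_of_nonneg_right hx1 hb)
    refine avg_ind_le_of_imp hb (p := √Δ ≤ entropy (emp x)) (fun C hC => hC.1) fun hx => ?_
    obtain ⟨y, hy⟩ := h.exists_mem_condTypeClass x
    refine le_trans (avg_mono fun C => ind_mono fun hC => ?_) (h.avg_hits_upper hs hΔ hδ hx hy
      (condTypeClass_subset hy) (hs.condTypeClass hy).1 (hs.condTypeClass hy).2 hΔ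
      (by linarith))
    exact hC.2
  have e3 : avg (fun C => ind (∃ p, B₃ p C)) ≤
      tupleCard X Y Z n * Real.exp (-Real.exp (n * δ)) := by
    refine (avg_ind_exists_le fun p => ?_).trans (mul_le_mul_of_nonneg_right hx2 hb)
    refine avg_ind_le_of_imp hb (p := √Δ ≤ entropy (emp p.1) ∧ p.2.1 ∈ condTypeClass c p.1 ∧
      mutualInfo (empPair p.2.1 p.2.2) ≤ mutualInfo (empPair p.1 p.2.1))
      (fun C hC => ⟨hC.1, hC.2.1, hC.2.2.1⟩) fun ⟨hx, hy, hI⟩ => ?_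
    refine le_trans (avg_mono fun C => ind_mono fun hC => ?_) (h.avg_hits_lower hs hΔ hx hy
      (jointClass_subset p.2.1 p.2.2) (hs.jointClass p.2.1 p.2.2).1 (hs.jointClass p.2.1 p.2.2).2
      (by linarith) le_rfl)
    exact hC.2.2.2
  have e4 : avg (fun C => ind (∃ p, B₄ p C)) ≤
      tupleCard X Y Z n * Real.exp (-Real.exp (n * δ)) := by
    refine (avg_ind_exists_le fun p => ?_).trans (mul_le_mul_of_nonneg_right hx2 hb)
    refine avg_ind_le_of_imp hb (p := √Δ ≤ entropy (emp p.1) ∧ p.2.1 ∈ condTypeClass c p.1)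
      (fun C hC => ⟨hC.1, hC.2.1⟩) fun ⟨hx, hy⟩ => ?_
    refine le_trans (avg_mono fun C => ind_mono fun hC => ?_) (h.avg_hits_upper hs hΔ hδ hx hy
      (jointClass_subset p.2.1 p.2.2) (hs.jointClass p.2.1 p.2.2).1 (hs.jointClass p.2.1 p.2.2).2
      (le_max_left _ _) (le_max_right _ _))
    exact hC.2.2
  linarith

/-- Conditionally on a good code each x jointly typed with a codeword y chooses it with probability
at least e^{-n(Δ+4δ)}, independently of the others, so the fibre of y concentrates; the rankings
supply the randomness. -/
lemma Admissible.avg_not_goodEncoder (h : Admissible ι Δ ε n c) (hs : SizeBounds X Y Z n δ)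
    (hδ : 0 < δ) (hδΔ : 3 * δ ≤ Δ) (hδε : 7 * δ ≤ 3 * ε) :
    avg (fun ω : Ensemble n Δ c => ind (¬ GoodEncoder Z ι δ ω)) ≤
      5 * (tupleCard X Y Z n * Real.exp (-Real.exp (n * δ))) := by
  have hb := (Real.exp_pos (-Real.exp (n * δ))).le
  let B : (Fin n → X) × (Fin n → Y) → Ensemble n Δ c → Prop := fun p ω =>
    GoodCode Z δ ω.1 ∧ ∃ hx, p.2 ∈ condTypeClass c p.1 ∧
      (∃ l, (ω.1 (highType p.1 hx) l : Fin n → Y) = p.2) ∧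
      (cnt fun x' => encode ι ω x' = some p.2 : ℝ) ≤
        Real.exp (n * (entropy (empPair p.1 p.2) - entropy (emp p.2) - Δ - 6 * δ))
  have key : ∀ ω : Ensemble n Δ c, ind (¬ GoodEncoder Z ι δ ω) ≤
      ind (¬ GoodCode Z δ ω.1) + ind (∃ p, B p ω) := by
    intro ω
    by_cases h1 : GoodCode Z δ ω.1
    · by_cases h2 : ∃ p, B p ω
      · rw [ind_true h2]
        linarith [ind_le_one (¬ GoodEncoder Z ι δ ω), ind_nonneg (¬ GoodCode Z δ ω.1)]
      · rw [ind_false (p := ¬ GoodEncoder Z ι δ ω)]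
        · exact add_nonneg (ind_nonneg _) (ind_nonneg _)
        · rw [not_not]
          refine ⟨h1, fun x hx y hy hl => ?_⟩
          by_contra hc
          exact h2 ⟨(x, y), h1, hx, hy, hl, (not_le.1 hc).le⟩
    · rw [ind_true (p := ¬ GoodCode Z δ ω.1) h1]
      linarith [ind_le_one (¬ GoodEncoder Z ι δ ω), ind_nonneg (∃ p, B p ω)]
  refine (avg_mono key).trans ?_
  rw [avg_add, avg_fst (fun C : Codebooks n Δ c => ind (¬ GoodCode Z δ C))]
  have e1 := h.avg_not_goodCode hs hδ hδΔ
  have hx1 : (Fintype.card ((Fin n → X) × (Fin n → Y)) : ℝ) ≤ tupleCard X Y Z n := by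
    exact_mod_cast card_pairSeq_le X Y Z n
  have e2 : avg (fun ω => ind (∃ p, B p ω)) ≤
      tupleCard X Y Z n * Real.exp (-Real.exp (n * δ)) := by
    refine (avg_ind_exists_le fun p => ?_).trans (mul_le_mul_of_nonneg_right hx1 hb)
    refine avg_ind_le_of_imp hb (p := √Δ ≤ entropy (emp p.1) ∧ p.2 ∈ condTypeClass c p.1)
      (fun C hC => ⟨hC.2.1, hC.2.2.1⟩) fun ⟨hx, hy⟩ => ?_
    rw [avg_ensemble]
    have := h.nonempty_codebooks
    rw [← avg_const (Ω := Codebooks n Δ c) (Real.exp (-Real.exp (n * δ)))]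
    refine avg_mono fun C => ?_
    refine avg_ind_le_of_imp hb (p := GoodCode Z δ C ∧
      ∃ l, (C (highType p.1 hx) l : Fin n → Y) = p.2)
      (fun r hr => ⟨hr.1, hr.2.2.2.1⟩) fun ⟨hC, hl⟩ => ?_
    refine le_trans (avg_mono fun r => ind_mono fun hr => hr.2.2.2.2)
      ((h.avg_fiber_le C (highType p.1 hx) (m := Real.exp (n * (Δ + 4 * δ)))
        (fun x hx' _ => le_trans (by exact_mod_cast card_cover_le_hits C x hx') (hC.cover_le x hx'))
        hl _).trans (Real.exp_le_exp.2 ?_))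
    have e3 : c (highType p.1 hx).1 = empPair p.1 p.2 := (mem_condTypeClass.1 hy).symm
    rw [e3, cnt_empPair_left]
    have hy1 := (hs.yx p.2 p.1).1
    rw [entropy_empPair_swap] at hy1
    -- The mean size of the fibre is at least e^{n(H(X|Y) − Δ − 5δ)}. Equivocation and 7δ ≤ 3ε make
    -- this exponent at least 2δ, enough for a doubly exponential tail.
    have heq := h.equivocation _ (mem_types p.1) hx
    rw [← mem_condTypeClass.1 hy, condEntropy, margSnd_empPair] at heq
    set H := entropy (empPair p.1 p.2) - entropy (emp p.2) with hH
    have h6 : Real.exp (n * (H - Δ - 5 * δ)) ≤ condCard p.2 p.1 / Real.exp (n * (Δ + 4 * δ)) := by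
      rw [le_div_iff₀ (Real.exp_pos _), ← Real.exp_add]
      refine le_trans (Real.exp_le_exp.2 (le_of_eq ?_)) hy1
      ring
    have h4 := hs.mul_exp_le (by linarith : H - Δ - 6 * δ + δ ≤ H - Δ - 5 * δ)
    have h5 := hs.mul_exp_le (by linarith : δ + δ ≤ H - Δ - 5 * δ)
    have h7 := Real.exp_pos (n * δ)
    linarith
  linarith

end GoodEvent

/-! ### The conditional error probability of a typical encoder -/

section TypicalError

open Classical

variable {X Y Z : Type*} [Fintype X] [Fintype Y] [Fintype Z]
variable {n : ℕ} {Δ ε δ : ℝ} {c : (X → ℝ) → (X × Y → ℝ)} {ι : X ↪ Y}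
variable {G : X → ℝ} {W : X → Z → ℝ} {R : ℝ}

/-- The exponent of the probability of confusion, given the three sequences. -/
def confExponent (G : X → ℝ) (R : ℝ) (x : Fin n → X) (y : Fin n → Y) (z : Fin n → Z) : ℝ :=
  max 0 (klReal G (emp x) + min (mutualInfo (empPair x y)) (mutualInfo (empPair y z)) - R)

lemma min_one_exp_le {n : ℕ} {a b k : ℝ} (hk : 0 ≤ k) (h : a ≤ k - b) :
    min 1 (Real.exp (n * a)) ≤ Real.exp (n * (k - max 0 b)) := by
  rcases le_total b 0 with hb | hb
  · rw [max_eq_left hb, sub_zero]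
    exact (min_le_left _ _).trans (Real.one_le_exp (by positivity))
  · rw [max_eq_right hb]
    exact (min_le_right _ _).trans (exp_mul_le_exp_mul h)

lemma exp_le_min_one_exp {n : ℕ} {a b k : ℝ} (hk : 0 ≤ k) (h : -k - b ≤ a) :
    Real.exp (n * (-k - max 0 b)) ≤ min 1 (Real.exp (n * a)) := by
  refine le_min ?_ ?_
  · rw [← Real.exp_zero]
    refine Real.exp_le_exp.2 (mul_nonpos_of_nonneg_of_nonpos (by positivity) ?_)
    linarith [le_max_left 0 b]
  · exact exp_mul_le_exp_mul (by linarith [le_max_right 0 b])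

/-- As Q_X ↦ Q_Y is one-to-one, codewords of one type belong to a single subcode; in particular
losslessly kept sequences of low entropy do not mix with it. -/
lemma Admissible.exists_draw_of_mem_codebook (h : Admissible ι Δ ε n c) {ω : Ensemble n Δ c}
    {x : Fin n → X} (hx : √Δ ≤ entropy (emp x)) {y y' : Fin n → Y} (hy : y ∈ condTypeClass c x)
    (hy' : y' ∈ codebook ι ω) (e : emp y' = emp y) :
    ∃ l, (ω.1 (highType x hx) l : Fin n → Y) = y' := by
  rcases hy' with ⟨Q, l, rfl⟩ | ⟨x', hx', rfl⟩
  · have h1 : emp (ω.1 Q l : Fin n → Y) = margSnd (c Q.1) := mem_typeClass.1 (ω.1 Q l).2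
    have h2 : Q.1 = emp x := by
      refine h.oneToOne Q.2.1 (mem_types x) ?_
      simp only
      rw [← h1, e, emp_of_mem_condTypeClass hy]
    have h3 : Q = highType x hx := Subtype.ext h2
    subst h3
    exact ⟨l, rfl⟩
  · have h1 : (fun i => ι (x' i)) ∈ condTypeClass c x' := by
      rw [h.condTypeClass_low hx']; exact Finset.mem_singleton_self _
    have h2 := h.emp_eq_of_emp_eq hy h1 e
    rw [h2] at hx'
    exact absurd hx' (not_lt.2 hx)

lemma Admissible.numTypical_le_hits (h : Admissible ι Δ ε n c) (ω : Ensemble n Δ c)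
    {x : Fin n → X} (hx : √Δ ≤ entropy (emp x)) {y : Fin n → Y} (hy : y ∈ condTypeClass c x)
    (z : Fin n → Z) :
    numTypical ι ω y z ≤ hits ω.1 (highType x hx) (jointClass y z) := by
  rw [numTypical_eq_cnt, hits, cnt_eq, cnt_eq]
  refine le_trans (Finset.card_le_card fun y' hy' => ?_)
    (Finset.card_image_le (f := fun l => (ω.1 (highType x hx) l : Fin n → Y)))
  rw [Finset.mem_filter] at hy'
  have h1 : y' ∈ jointClass y z := mem_jointClass.2 hy'.2.2
  obtain ⟨l, hl⟩ := h.exists_draw_of_mem_codebook hx hy hy'.2.1 (emp_eq_of_mem_jointClass h1)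
  refine Finset.mem_image.2 ⟨l, ?_, hl⟩
  rw [Finset.mem_filter]
  exact ⟨Finset.mem_univ _, by rw [hl]; exact h1⟩

/-- The permutation that takes y to y' is applied to x as well. -/
lemma exists_partner {x : Fin n → X} {y y' : Fin n → Y} (hy : y ∈ condTypeClass c x)
    (e : emp y' = emp y) :
    ∃ x', emp x' = emp x ∧ y' ∈ condTypeClass c x' ∧ empPair x' y' = empPair x y := by
  obtain ⟨σ, rfl⟩ := exists_perm_of_emp_eq e.symm
  have h1 : empPair (x ∘ σ) (y ∘ σ) = empPair x y := emp_comp_perm (fun i => (x i, y i)) σ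
  refine ⟨x ∘ σ, emp_comp_perm x σ, ?_, h1⟩
  rw [mem_condTypeClass, h1, emp_comp_perm, mem_condTypeClass.1 hy]

/-- N(y|z) counts distinct vectors, `hits` counts draws. Repetitions of a vector y' all cover one
and the same source sequence, so the bound on the cover also bounds the multiplicity. -/
lemma GoodCode.hits_le {ω : Ensemble n Δ c} (hω : GoodCode Z δ ω.1) {x : Fin n → X}
    (hx : √Δ ≤ entropy (emp x)) {y : Fin n → Y} (hy : y ∈ condTypeClass c x) (z : Fin n → Z) :
    (hits ω.1 (highType x hx) (jointClass y z) : ℝ) ≤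
      Real.exp (n * (Δ + 4 * δ)) * numTypical ι ω y z := by
  have h1 : hits ω.1 (highType x hx) (jointClass y z) ≤
      ⌊Real.exp (n * (Δ + 4 * δ))⌋₊ * numTypical ι ω y z := by
    rw [hits, cnt_eq]
    refine (Finset.card_le_mul_card_image (f := fun l => (ω.1 (highType x hx) l : Fin n → Y)) _
      ⌊Real.exp (n * (Δ + 4 * δ))⌋₊ ?_).trans (Nat.mul_le_mul_left _ ?_)
    · intro y' hy'
      obtain ⟨l, hl, rfl⟩ := Finset.mem_image.1 hy'
      rw [Finset.mem_filter] at hl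
      obtain ⟨x', hx', hc', -⟩ := exists_partner hy (emp_eq_of_mem_jointClass hl.2)
      have hx'' : √Δ ≤ entropy (emp x') := hx' ▸ hx
      have e : highType x' hx'' = highType x hx := Subtype.ext hx'
      refine Nat.le_floor (le_trans ?_ (hω.cover_le x' hx''))
      rw [e, hits, cnt_eq]
      refine Nat.cast_le.2 (Finset.card_le_card fun l' hl' => ?_)
      rw [Finset.mem_filter] at hl' ⊢
      exact ⟨Finset.mem_univ _, by rw [hl'.2]; exact hc'⟩
    · rw [numTypical_eq_cnt, cnt_eq]
      refine Finset.card_le_card fun y' hy' => ?_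
      obtain ⟨l, hl, rfl⟩ := Finset.mem_image.1 hy'
      rw [Finset.mem_filter] at hl ⊢
      exact ⟨Finset.mem_univ _, Or.inl ⟨_, l, rfl⟩, mem_jointClass.1 hl.2⟩
  calc (hits ω.1 (highType x hx) (jointClass y z) : ℝ)
      ≤ (⌊Real.exp (n * (Δ + 4 * δ))⌋₊ : ℝ) * numTypical ι ω y z := by exact_mod_cast h1
    _ ≤ _ := mul_le_mul_of_nonneg_right (Nat.floor_le (Real.exp_pos _).le) (Nat.cast_nonneg _)

lemma entropy_emp_map (x : Fin n → X) : entropy (emp fun i => ι (x i)) = entropy (emp x) := by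
  have h1 : ∀ a, emp (fun i => ι (x i)) (ι a) = emp x a := fun a => by
    rw [emp_eq_sum, emp_eq_sum]; simp
  rw [entropy, ← Finset.sum_subset (Finset.subset_univ (Finset.univ.map ι)), Finset.sum_map]
  · simp only [h1]; rfl
  · intro b _ hb
    have : emp (fun i => ι (x i)) b = 0 := by
      rw [emp_eq_sum, Finset.sum_eq_zero, zero_div]
      intro i _
      rw [if_neg]
      intro e
      exact hb (Finset.mem_map.2 ⟨x i, Finset.mem_univ _, e⟩)
    rw [this, Real.negMulLog_zero]

lemma numTypical_le_typeClass (ω : Ensemble n Δ c) (y : Fin n → Y) (z : Fin n → Z) :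
    numTypical ι ω y z ≤ (typeClass n (emp y)).card := by
  rw [numTypical_eq_cnt, cnt_eq]
  refine Finset.card_le_card fun y' hy' => ?_
  rw [Finset.mem_filter] at hy'
  exact jointClass_subset y z (mem_jointClass.2 hy'.2.2)

lemma numEnrolled_sub_one_le (n : ℕ) (R : ℝ) :
    ((numEnrolled n R - 1 : ℕ) : ℝ) ≤ Real.exp (n * R) := by
  rw [Nat.cast_sub (numEnrolled_pos n R), numEnrolled]
  have := Nat.ceil_lt_add_one (Real.exp_pos (n * R)).le
  push_cast
  linarith

lemma le_numEnrolled_sub_one (hn : 0 < n) (hR : 0 < R) :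
    Real.exp (n * R) / 2 ≤ ((numEnrolled n R - 1 : ℕ) : ℝ) := by
  have h1 : Real.exp (n * R) ≤ numEnrolled n R := Nat.le_ceil _
  have h2 : (1 : ℝ) < Real.exp (n * R) := Real.one_lt_exp_iff.2 (by positivity)
  have h3 : 1 < numEnrolled n R := by exact_mod_cast h2.trans_le h1
  have h4 : (2 : ℝ) ≤ numEnrolled n R := by exact_mod_cast h3
  rw [Nat.cast_sub (numEnrolled_pos n R)]
  push_cast
  linarith

/-- On a good encoder N(y|z)e^{-nα} is at most about e^{-n(D + min(I, J))}: for high entropy because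
[I + Δ − J]_+ ≤ I + Δ − min(I, J), for low entropy because N(y|z) ≤ e^{n√Δ}. The bound Δ ≤ 1 gives Δ
≤ √Δ. -/
lemma Admissible.condError_le (h : Admissible ι Δ ε n c) (hG : G ∈ stdSimplex ℝ X)
    (hs : SizeBounds X Y Z n δ) (hδ : 0 < δ) (hΔ : 0 < Δ) (hΔ1 : Δ ≤ 1) {ω : Ensemble n Δ c}
    (hω : GoodEncoder Z ι δ ω) {x : Fin n → X} {y : Fin n → Y} (hxy : encode ι ω x = some y)
    (hg : ∏ i, G (x i) ≠ 0) (z : Fin n → Z) :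
    condError G R ι ω x z ≤ Real.exp (n * (2 * √Δ + 6 * δ - confExponent G R x y z)) := by
  have hy := h.mem_of_encode hxy
  have hac := emp_ac_of_prod_ne_zero hg
  have hsq : Δ ≤ √Δ := by
    rw [Real.le_sqrt hΔ.le hΔ.le]; nlinarith
  have hsq0 : 0 < √Δ := Real.sqrt_pos.2 hΔ
  have hn := hs.pos
  set I := mutualInfo (empPair x y) with hI
  set J := mutualInfo (empPair y z) with hJ
  set D := klReal G (emp x) with hD
  have hI0 : 0 ≤ I := mutualInfo_nonneg (emp_mem hn (fun i => (x i, y i)))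
  -- the number of codewords in the conditional type class
  have hN : (numTypical ι ω y z : ℝ) * Real.exp (-(n * alpha n G c (emp y))) ≤
      Real.exp (n * (2 * √Δ + 4 * δ - min I J - D)) := by
    rw [h.alpha_eq_klReal hn hG hy hac, ← hI, ← hD]
    rcases lt_or_ge (entropy (emp x)) √Δ with hx | hx
    · have e : y = fun i => ι (x i) := by
        rw [encode_low hx, Option.some_inj] at hxy; exact hxy.symm
      have h1 : (numTypical ι ω y z : ℝ) ≤ Real.exp (n * √Δ) := by
        refine le_trans (by exact_mod_cast numTypical_le_typeClass ω y z)
          ((card_typeClass_upper y).trans (exp_mul_le_exp_mul ?_))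
        rw [e, entropy_emp_map]; exact hx.le
      have h2 : I ≤ √Δ := by
        have := mutualInfo_le_entropy (emp_mem hn (fun i => (x i, y i)))
        have e2 := margFst_empPair x y
        rw [empPair] at e2
        rw [e2] at this
        exact this.trans hx.le
      have h3 := min_le_left I J
      calc _ ≤ Real.exp (n * √Δ) * Real.exp (-(n * (I + D))) :=
            mul_le_mul_of_nonneg_right h1 (Real.exp_pos _).le
        _ = Real.exp (n * (√Δ - I - D)) := by rw [← Real.exp_add]; congr 1; ring
        _ ≤ _ := exp_mul_le_exp_mul (by linarith)
    · have h1 : (numTypical ι ω y z : ℝ) ≤ Real.exp (n * (max 0 (I + Δ - J) + 4 * δ)) :=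
        le_trans (by exact_mod_cast h.numTypical_le_hits ω hx hy z)
          (hω.code.typical_le x hx y hy z)
      have h2 : max 0 (I + Δ - J) ≤ I + Δ - min I J :=
        max_le (by linarith [min_le_left I J]) (by linarith [min_le_right I J])
      calc _ ≤ Real.exp (n * (max 0 (I + Δ - J) + 4 * δ)) * Real.exp (-(n * (I + D))) :=
            mul_le_mul_of_nonneg_right h1 (Real.exp_pos _).le
        _ = Real.exp (n * (max 0 (I + Δ - J) + 4 * δ - I - D)) := by
            rw [← Real.exp_add]; congr 1; ring
        _ ≤ _ := exp_mul_le_exp_mul (by linarith)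
  rw [condError_some hxy]
  have hc0 := confusion_nonneg (ι := ι) hG ω y z
  refine (one_sub_pow_le (confusion_le_one hG ω y z) _).trans ?_
  refine le_trans ?_ (min_one_exp_le (a := R + 2 * √Δ + 6 * δ - min I J - D)
    (by positivity) (by linarith))
  refine min_le_min le_rfl ?_
  calc _ ≤ Real.exp (n * R) * (Real.exp (n * (2 * δ)) *
        Real.exp (n * (2 * √Δ + 4 * δ - min I J - D))) := by
        refine mul_le_mul (numEnrolled_sub_one_le n R) ?_ hc0 (Real.exp_pos _).le
        exact (h.confusion_le hG hs ω (mem_codebook_of_encode hxy) z).trans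
          (mul_le_mul_of_nonneg_left hN (Real.exp_pos _).le)
    _ = _ := by rw [← Real.exp_add, ← Real.exp_add]; congr 1; ring

/-- Every codeword of the type of y has a source sequence with the joint type of (x, y), hence a
large fibre; all sequences in it have the type of x and so the same probability. -/
lemma Admissible.le_fiberProb (h : Admissible ι Δ ε n c) (hG : G ∈ stdSimplex ℝ X)
    {ω : Ensemble n Δ c} (hω : GoodEncoder Z ι δ ω) {x : Fin n → X}
    (hx : √Δ ≤ entropy (emp x)) {y y' : Fin n → Y} (hy : y ∈ condTypeClass c x)
    (hg : ∏ i, G (x i) ≠ 0) (hy' : y' ∈ codebook ι ω) (e : emp y' = emp y) :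
    Real.exp (n * (-(mutualInfo (empPair x y) + klReal G (emp x)) - Δ - 6 * δ)) ≤
      fiberProb G ι ω y' := by
  have hac := emp_ac_of_prod_ne_zero hg
  obtain ⟨x', hx', hc', hp'⟩ := exists_partner hy e
  have hx'' : √Δ ≤ entropy (emp x') := hx' ▸ hx
  obtain ⟨l, hl⟩ := h.exists_draw_of_mem_codebook hx'' hc' hy' rfl
  have h1 := hω.fiber x' hx'' y' hc' ⟨l, hl⟩
  have h2 : fiberProb G ι ω y' = (cnt fun x' => encode ι ω x' = some y' : ℝ) *
      Real.exp (-(n * (entropy (emp x) + klReal G (emp x)))) := by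
    rw [fiberProb, cnt_cast, Finset.sum_mul]
    refine Finset.sum_congr rfl fun x₁ _ => ?_
    by_cases hx₁ : encode ι ω x₁ = some y'
    · have e1 := (h.emp_eq_of_emp_eq hc' (h.mem_of_encode hx₁) rfl).trans hx'
      rw [ind_true hx₁, mul_one, one_mul, prod_eq_exp_klReal hG.1 (by rwa [e1]), e1]
    · rw [ind_false hx₁, mul_zero, zero_mul]
  rw [h2]
  refine le_trans ?_ (mul_le_mul_of_nonneg_right h1 (Real.exp_pos _).le)
  rw [← Real.exp_add, hp', mutualInfo_empPair, e]
  refine Real.exp_le_exp.2 (le_of_eq ?_)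
  ring

lemma Admissible.le_condError (h : Admissible ι Δ ε n c) (hG : G ∈ stdSimplex ℝ X) (hR : 0 < R)
    (hs : SizeBounds X Y Z n δ) (hδ : 0 < δ) (hΔ : 0 < Δ) (hΔ1 : Δ ≤ 1) {ω : Ensemble n Δ c}
    (hω : GoodEncoder Z ι δ ω) {x : Fin n → X} {y : Fin n → Y} (hxy : encode ι ω x = some y)
    (hg : ∏ i, G (x i) ≠ 0) (z : Fin n → Z) :
    Real.exp (n * (-(√Δ + 13 * δ) - confExponent G R x y z)) ≤ condError G R ι ω x z := by
  have hy := h.mem_of_encode hxy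
  have hac := emp_ac_of_prod_ne_zero hg
  have hsq : Δ ≤ √Δ := by
    rw [Real.le_sqrt hΔ.le hΔ.le]; nlinarith
  have hsq0 : 0 < √Δ := Real.sqrt_pos.2 hΔ
  have hn := hs.pos
  set I := mutualInfo (empPair x y) with hI
  set J := mutualInfo (empPair y z) with hJ
  set D := klReal G (emp x) with hD
  have hI0 : 0 ≤ I := mutualInfo_nonneg (emp_mem hn (fun i => (x i, y i)))
  have hJ0 : 0 ≤ J := mutualInfo_nonneg (emp_mem hn (fun i => (y i, z i)))
  have hc0 := confusion_nonneg (ι := ι) hG ω y z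
  have hcb := mem_codebook_of_encode hxy
  have hconf : Real.exp (n * (-(min I J) - D - √Δ - 12 * δ)) ≤ confusion G ι ω y z := by
    rcases lt_or_ge (entropy (emp x)) √Δ with hx | hx
    -- At low entropy it suffices that the competitor coincides with x, an event of probability
    -- e^{-n(H(X) + D)} with H(X) < √Δ.
    · have h1 : ∏ i, G (x i) ≤ confusion G ι ω y z := by
        refine le_trans (le_of_eq ?_) (Finset.single_le_sum (f := fun x : Fin n → X =>
          (∏ i, G (x i)) * ind (∃ y', encode ι ω x = some y' ∧
            metric G ι ω y' z ≤ metric G ι ω y z))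
          (fun x _ => mul_nonneg (prob_nonneg hG x) (ind_nonneg _)) (Finset.mem_univ x))
        rw [ind_true ⟨y, hxy, le_rfl⟩, mul_one]
      refine le_trans ?_ h1
      rw [prod_eq_exp_klReal hG.1 hac, ← hD, ← mul_neg]
      exact exp_mul_le_exp_mul (by linarith [le_min hI0 hJ0])
    · have h1 := le_confusion hG ω (y := y) z (q := Real.exp (n * (-(I + D) - Δ - 6 * δ)))
        fun y' hy' hp => h.le_fiberProb hG hω hx hy hg hy'
          (emp_eq_of_mem_jointClass (mem_jointClass.2 hp))
      -- For J ≤ I, dividing the number of draws by the maximal multiplicity cancels Δ; for I ≤ J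
      -- the codeword y itself suffices.
      have hN : Real.exp (n * (I - min I J - 6 * δ)) ≤ numTypical ι ω y z := by
        rcases le_total J I with hJI | hJI
        · have h2 := (hω.code.typical_ge x hx y hy z hJI).trans (hω.code.hits_le (ι := ι) hx hy z)
          rw [← div_le_iff₀' (Real.exp_pos _), ← Real.exp_sub] at h2
          refine le_trans (Real.exp_le_exp.2 (le_of_eq ?_)) h2
          rw [min_eq_right hJI]; ring
        · have h2 : (1 : ℝ) ≤ numTypical ι ω y z := by exact_mod_cast numTypical_pos hcb z
          refine le_trans ?_ h2
          rw [← Real.exp_zero]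
          refine Real.exp_le_exp.2 (mul_nonpos_of_nonneg_of_nonpos (by positivity) ?_)
          rw [min_eq_left hJI]; linarith
      refine le_trans ?_ h1
      refine le_trans ?_ (mul_le_mul_of_nonneg_right hN (Real.exp_pos _).le)
      rw [← Real.exp_add, ← mul_add]
      exact exp_mul_le_exp_mul (by linarith)
  rw [condError_some hxy]
  refine le_trans ?_ (le_one_sub_pow hc0 (confusion_le_one hG ω y z) _)
  have h3 : Real.exp (n * (R - min I J - D - √Δ - 12 * δ)) / 2 ≤
      ((numEnrolled n R - 1 : ℕ) : ℝ) * confusion G ι ω y z := by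
    refine le_trans (le_of_eq ?_) (mul_le_mul (le_numEnrolled_sub_one hn hR) hconf
      (Real.exp_pos _).le (Nat.cast_nonneg _))
    rw [div_mul_eq_mul_div, ← Real.exp_add, ← mul_add]
    congr 3; ring
  have h4 := exp_le_min_one_exp (n := n) (a := R - min I J - D - √Δ - 12 * δ)
    (b := D + min I J - R) (k := √Δ + 12 * δ) (by positivity) (by linarith)
  have h5 : min 1 (Real.exp (n * (R - min I J - D - √Δ - 12 * δ))) / 2 ≤
      min 1 (((numEnrolled n R - 1 : ℕ) : ℝ) * confusion G ι ω y z) := by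
    refine le_min ?_ ?_
    · linarith [min_le_left 1 (Real.exp (n * (R - min I J - D - √Δ - 12 * δ)))]
    · linarith [min_le_right 1 (Real.exp (n * (R - min I J - D - √Δ - 12 * δ)))]
  have h6 := hs.mul_exp_le (a := -(√Δ + 13 * δ) - confExponent G R x y z)
    (b := -(√Δ + 12 * δ) - max 0 (D + min I J - R)) (by rw [confExponent]; linarith)
  have h7 := Real.exp_pos (n * (-(√Δ + 13 * δ) - confExponent G R x y z))
  linarith

end TypicalError

/-! ### The averaged error probability as a sum over types -/

section TypeSum

open Classical

variable {X Y Z : Type*} [Fintype X] [Fintype Y] [Fintype Z]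
variable {n : ℕ} {Δ ε δ : ℝ} {c : (X → ℝ) → (X × Y → ℝ)} {ι : X ↪ Y}
variable {G : X → ℝ} {W : X → Z → ℝ} {R : ℝ}

/-- The averaged error probability, up to subexponential factors: a reproduction is uniform in
the conditional type class and confusion has probability `exp (-n * confExponent)`. -/
def typeSum (G : X → ℝ) (W : X → Z → ℝ) (R : ℝ) (n : ℕ) (c : (X → ℝ) → (X × Y → ℝ)) : ℝ :=
  ∑ x : Fin n → X, ∑ y : Fin n → Y, ∑ z : Fin n → Z,
    ind (y ∈ condTypeClass c x) * ((∏ i, G (x i)) * (∏ i, W (x i) (z i)) *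
      (1 / ((condTypeClass c x).card : ℝ) * Real.exp (-(n * confExponent G R x y z))))

/-- The analogue of `typeSum` for a given encoder. -/
def encoderSum (G : X → ℝ) (W : X → Z → ℝ) (R : ℝ) (ι : X ↪ Y) (ω : Ensemble n Δ c) : ℝ :=
  ∑ x : Fin n → X, ∑ y : Fin n → Y, ∑ z : Fin n → Z,
    ind (encode ι ω x = some y) * ((∏ i, G (x i)) * (∏ i, W (x i) (z i)) *
      Real.exp (-(n * confExponent G R x y z)))

lemma GoodEncoder.encode_ne_none {ω : Ensemble n Δ c} (hω : GoodEncoder Z ι δ ω)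
    (x : Fin n → X) : encode ι ω x ≠ none := by
  rcases lt_or_ge (entropy (emp x)) √Δ with hx | hx
  · rw [encode_low hx]; simp
  · rw [Ne, encode_high_eq_none_iff hx, ← Ne, ← Finset.nonempty_iff_ne_empty]
    exact cover_nonempty_of_hits (hω.code.cover_pos x hx)

lemma sum_ind_encode {ω : Ensemble n Δ c} {x : Fin n → X} {y : Fin n → Y}
    (hxy : encode ι ω x = some y) (f : (Fin n → Y) → ℝ) :
    ∑ y', ind (encode ι ω x = some y') * f y' = f y := by
  rw [Finset.sum_eq_single y]
  · rw [ind_true hxy, one_mul]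
  · intro y' _ hne
    rw [ind_false (fun e => hne (Option.some_inj.1 (e.symm.trans hxy))), zero_mul]
  · simp

lemma Admissible.errorTerm_le (h : Admissible ι Δ ε n c) (hG : G ∈ stdSimplex ℝ X)
    (hW : IsChannel W) (hs : SizeBounds X Y Z n δ) (hδ : 0 < δ) (hΔ : 0 < Δ) (hΔ1 : Δ ≤ 1)
    (ω : Ensemble n Δ c) :
    ∑ x : Fin n → X, (∏ i, G (x i)) * ∑ z : Fin n → Z, (∏ i, W (x i) (z i)) *
        condError G R ι ω x z ≤
      ind (¬ GoodEncoder Z ι δ ω) +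
        Real.exp (n * (2 * √Δ + 6 * δ)) * encoderSum G W R ι ω := by
  have hnn : 0 ≤ encoderSum G W R ι ω :=
    Finset.sum_nonneg fun x _ => Finset.sum_nonneg fun y _ => Finset.sum_nonneg fun z _ =>
      mul_nonneg (ind_nonneg _) (mul_nonneg (mul_nonneg (prob_nonneg hG x) (chan_nonneg hW x z))
        (Real.exp_pos _).le)
  by_cases hω : GoodEncoder Z ι δ ω
  · rw [ind_false (not_not.2 hω), zero_add, encoderSum, Finset.mul_sum]
    refine Finset.sum_le_sum fun x _ => ?_
    obtain ⟨y, hxy⟩ := Option.ne_none_iff_exists'.1 (hω.encode_ne_none x)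
    simp only [← Finset.mul_sum]
    rw [sum_ind_encode hxy]
    rw [Finset.mul_sum, Finset.mul_sum]
    refine Finset.sum_le_sum fun z _ => ?_
    by_cases hg : ∏ i, G (x i) = 0
    · simp [hg]
    · have h1 := h.condError_le (R := R) hG hs hδ hΔ hΔ1 hω hxy hg z
      rw [mul_sub, sub_eq_add_neg, Real.exp_add] at h1
      rw [← mul_assoc]
      refine (mul_le_mul_of_nonneg_left h1
        (mul_nonneg (prob_nonneg hG x) (chan_nonneg hW x z))).trans (le_of_eq ?_)
      ring
  · rw [ind_true hω]
    have h1 : ∑ x : Fin n → X, (∏ i, G (x i)) * ∑ z : Fin n → Z, (∏ i, W (x i) (z i)) *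
        condError G R ι ω x z ≤ 1 := by
      rw [← sum_prod_eq_one (n := n) hG]
      refine Finset.sum_le_sum fun x _ => mul_le_of_le_one_right (prob_nonneg hG x) ?_
      rw [← sum_chan_eq_one hW x]
      exact Finset.sum_le_sum fun z _ => mul_le_of_le_one_right (chan_nonneg hW x z)
        (condError_mem hG ω x z).2
    have := mul_nonneg (Real.exp_pos (n * (2 * √Δ + 6 * δ))).le hnn
    linarith

lemma encoderSum_le_one (hG : G ∈ stdSimplex ℝ X) (hW : IsChannel W) (ω : Ensemble n Δ c) :
    encoderSum G W R ι ω ≤ 1 := by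
  rw [← sum_prod_eq_one (n := n) hG]
  refine Finset.sum_le_sum fun x _ => ?_
  simp only [← Finset.mul_sum]
  rcases he : encode ι ω x with _ | y
  · rw [Finset.sum_eq_zero]
    · exact prob_nonneg hG x
    · intro y _; rw [ind_false (by simp), zero_mul]
  · have e : ∏ i, G (x i) = ∑ z : Fin n → Z, (∏ i, G (x i)) * ∏ i, W (x i) (z i) := by
      rw [← Finset.mul_sum, sum_chan_eq_one hW x, mul_one]
    rw [← he, sum_ind_encode he]
    refine le_trans (Finset.sum_le_sum fun z _ => ?_) e.symm.le
    refine mul_le_of_le_one_right (mul_nonneg (prob_nonneg hG x) (chan_nonneg hW x z)) ?_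
    rw [Real.exp_le_one_iff, neg_nonpos]
    exact mul_nonneg (by positivity) (le_max_left _ _)

lemma Admissible.le_errorTerm (h : Admissible ι Δ ε n c) (hG : G ∈ stdSimplex ℝ X)
    (hW : IsChannel W) (hR : 0 < R) (hs : SizeBounds X Y Z n δ) (hδ : 0 < δ) (hΔ : 0 < Δ)
    (hΔ1 : Δ ≤ 1) (ω : Ensemble n Δ c) :
    Real.exp (n * (-(√Δ + 13 * δ))) * encoderSum G W R ι ω - ind (¬ GoodEncoder Z ι δ ω) ≤
    ∑ x : Fin n → X, (∏ i, G (x i)) * ∑ z : Fin n → Z, (∏ i, W (x i) (z i)) *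
        condError G R ι ω x z := by
  by_cases hω : GoodEncoder Z ι δ ω
  · rw [ind_false (not_not.2 hω), sub_zero, encoderSum, Finset.mul_sum]
    refine Finset.sum_le_sum fun x _ => ?_
    obtain ⟨y, hxy⟩ := Option.ne_none_iff_exists'.1 (hω.encode_ne_none x)
    simp only [← Finset.mul_sum]
    rw [sum_ind_encode hxy]
    rw [Finset.mul_sum, Finset.mul_sum]
    refine Finset.sum_le_sum fun z _ => ?_
    by_cases hg : ∏ i, G (x i) = 0
    · simp [hg]
    · have h1 := h.le_condError hG hR hs hδ hΔ hΔ1 hω hxy hg z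
      rw [mul_sub, sub_eq_add_neg, Real.exp_add] at h1
      rw [← mul_assoc (∏ i, G (x i))]
      refine le_trans (le_of_eq ?_) (mul_le_mul_of_nonneg_left h1
        (mul_nonneg (prob_nonneg hG x) (chan_nonneg hW x z)))
      ring
  · rw [ind_true hω]
    have h1 : 0 ≤ ∑ x : Fin n → X, (∏ i, G (x i)) * ∑ z : Fin n → Z, (∏ i, W (x i) (z i)) *
        condError G R ι ω x z :=
      Finset.sum_nonneg fun x _ => mul_nonneg (prob_nonneg hG x) (Finset.sum_nonneg fun z _ =>
        mul_nonneg (chan_nonneg hW x z) (condError_mem hG ω x z).1)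
    have h2 := encoderSum_le_one (ι := ι) (R := R) hG hW ω
    have h3 : Real.exp (n * (-(√Δ + 13 * δ))) ≤ 1 := by
      rw [Real.exp_le_one_iff]
      exact mul_nonpos_of_nonneg_of_nonpos (by positivity)
        (by linarith [Real.sqrt_nonneg Δ])
    nlinarith [Real.exp_pos (n * (-(√Δ + 13 * δ)))]

lemma avg_encoderSum :
    avg (fun ω : Ensemble n Δ c => encoderSum G W R ι ω) =
      ∑ x : Fin n → X, ∑ y : Fin n → Y, ∑ z : Fin n → Z,
        avg (fun ω : Ensemble n Δ c => ind (encode ι ω x = some y)) *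
          ((∏ i, G (x i)) * (∏ i, W (x i) (z i)) * Real.exp (-(n * confExponent G R x y z))) := by
  simp only [encoderSum, avg_sum]
  refine Finset.sum_congr rfl fun x _ => Finset.sum_congr rfl fun y _ =>
    Finset.sum_congr rfl fun z _ => ?_
  rw [mul_comm (avg _), ← avg_const_mul]
  congr 1
  funext ω
  ring

/-- A good encoder never fails, so the success probability at each x is between 1/2 and 1;
uniformity on the conditional type class gives the rest. -/
lemma Admissible.avg_encode_bounds (h : Admissible ι Δ ε n c)
    (hb : avg (fun ω : Ensemble n Δ c => ind (¬ GoodEncoder Z ι δ ω)) ≤ 1 / 2)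
    (x : Fin n → X) (y : Fin n → Y) :
    1 / 2 * (ind (y ∈ condTypeClass c x) * (1 / ((condTypeClass c x).card : ℝ))) ≤
      avg (fun ω : Ensemble n Δ c => ind (encode ι ω x = some y)) ∧
    avg (fun ω : Ensemble n Δ c => ind (encode ι ω x = some y)) ≤
      ind (y ∈ condTypeClass c x) * (1 / ((condTypeClass c x).card : ℝ)) := by
  by_cases hy : y ∈ condTypeClass c x
  · have hT : (0 : ℝ) < (condTypeClass c x).card := by
      exact_mod_cast Finset.card_pos.2 ⟨y, hy⟩
    have h1 := h.avg_encode_eq hy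
    have h2 : avg (fun ω : Ensemble n Δ c => ind (encode ι ω x = none)) ≤ 1 / 2 :=
      le_trans (avg_mono fun ω => ind_mono fun he hω => hω.encode_ne_none x he) hb
    have h3 : 0 ≤ avg (fun ω : Ensemble n Δ c => ind (encode ι ω x = none)) :=
      avg_nonneg fun _ => ind_nonneg _
    rw [ind_true hy, one_mul, ← mul_div_assoc, mul_one, div_le_iff₀ hT, le_div_iff₀ hT]
    constructor <;> linarith
  · have : (fun ω : Ensemble n Δ c => ind (encode ι ω x = some y)) = fun _ => (0 : ℝ) * 0 := by
      funext ω
      rw [ind_false fun he => hy (h.mem_of_encode he), zero_mul]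
    rw [ind_false hy, this, avg_const_mul]
    simp

lemma Admissible.avg_encoderSum_bounds (h : Admissible ι Δ ε n c) (hG : G ∈ stdSimplex ℝ X)
    (hW : IsChannel W)
    (hb : avg (fun ω : Ensemble n Δ c => ind (¬ GoodEncoder Z ι δ ω)) ≤ 1 / 2) :
    1 / 2 * typeSum G W R n c ≤ avg (fun ω : Ensemble n Δ c => encoderSum G W R ι ω) ∧
    avg (fun ω : Ensemble n Δ c => encoderSum G W R ι ω) ≤ typeSum G W R n c := by
  rw [avg_encoderSum, typeSum, Finset.mul_sum]
  simp only [Finset.mul_sum]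
  have hnn : ∀ (x : Fin n → X) (y : Fin n → Y) (z : Fin n → Z), 0 ≤ (∏ i, G (x i)) *
      (∏ i, W (x i) (z i)) * Real.exp (-(n * confExponent G R x y z)) := fun x y z =>
    mul_nonneg (mul_nonneg (prob_nonneg hG x) (chan_nonneg hW x z)) (Real.exp_pos _).le
  constructor
  · refine Finset.sum_le_sum fun x _ => Finset.sum_le_sum fun y _ => Finset.sum_le_sum fun z _ => ?_
    refine le_trans (le_of_eq ?_)
      (mul_le_mul_of_nonneg_right (h.avg_encode_bounds hb x y).1 (hnn x y z))
    ring
  · refine Finset.sum_le_sum fun x _ => Finset.sum_le_sum fun y _ => Finset.sum_le_sum fun z _ => ?_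
    refine le_trans (mul_le_mul_of_nonneg_right (h.avg_encode_bounds hb x y).2 (hnn x y z))
      (le_of_eq ?_)
    ring

/-- The summand of `typeSum` as a function of a sequence of triples. -/
def typeTerm (G : X → ℝ) (W : X → Z → ℝ) (R : ℝ) (c : (X → ℝ) → (X × Y → ℝ))
    (p : Fin n → (X × Y) × Z) : ℝ :=
  ind ((fun i => (p i).1.2) ∈ condTypeClass c (fun i => (p i).1.1)) *
    ((∏ i, G (p i).1.1) * (∏ i, W (p i).1.1 (p i).2) *
      (1 / ((condTypeClass c (fun i => (p i).1.1)).card : ℝ) *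
        Real.exp (-(n * confExponent G R (fun i => (p i).1.1) (fun i => (p i).1.2)
          (fun i => (p i).2)))))

lemma sum_seq_prod {A B : Type*} [Fintype A] [Fintype B] (F : (Fin n → A × B) → ℝ) :
    ∑ p, F p = ∑ a : Fin n → A, ∑ b : Fin n → B, F fun i => (a i, b i) := by
  rw [← Fintype.sum_prod_type', ← Equiv.sum_comp (Equiv.arrowProdEquivProdArrow (Fin n) (fun _ => A) (fun _ => B)).symm]
  rfl

lemma typeSum_eq : typeSum G W R n c = ∑ p : Fin n → (X × Y) × Z, typeTerm G W R c p := by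
  rw [sum_seq_prod, sum_seq_prod]
  rfl

lemma typeTerm_nonneg (hG : G ∈ stdSimplex ℝ X) (hW : IsChannel W) (p : Fin n → (X × Y) × Z) :
    0 ≤ typeTerm G W R c p :=
  mul_nonneg (ind_nonneg _) (mul_nonneg (mul_nonneg (prob_nonneg hG fun i => (p i).1.1)
    (chan_nonneg hW (fun i => (p i).1.1) fun i => (p i).2)) (by positivity))

section Marginals

variable (p : Fin n → (X × Y) × Z)

lemma margFst_emp : margFst (emp p) = empPair (fun i => (p i).1.1) (fun i => (p i).1.2) :=
  margFst_empPair (fun i => (p i).1) (fun i => (p i).2)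

lemma margFst_margFst_emp : margFst (margFst (emp p)) = emp fun i => (p i).1.1 := by
  rw [margFst_emp, margFst_empPair]

lemma margYZ_emp_triple : margYZ (emp p) = empPair (fun i => (p i).1.2) (fun i => (p i).2) :=
  margYZ_emp (fun i => (p i).1.1) (fun i => (p i).1.2) (fun i => (p i).2)

end Marginals

lemma feasible_of_typeTerm_ne_zero (hn : 0 < n) {p : Fin n → (X × Y) × Z}
    (hp : typeTerm G W R c p ≠ 0) : Feasible G W c (types n X) (emp p) := by
  rw [typeTerm] at hp
  have h1 := left_ne_zero_of_mul hp
  have h2 := left_ne_zero_of_mul (right_ne_zero_of_mul hp)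
  have hy : (fun i => (p i).1.2) ∈ condTypeClass c (fun i => (p i).1.1) := by
    by_contra hc; exact h1 (ind_false hc)
  refine ⟨emp_mem hn p, ?_, ?_, ?_, ?_⟩
  · rw [margFst_margFst_emp]; exact mem_types _
  · rw [margFst_margFst_emp, margFst_emp, mem_condTypeClass.1 hy]
  · rw [margFst_margFst_emp]; exact emp_ac_of_prod_ne_zero (left_ne_zero_of_mul h2)
  · intro x y z hw
    exact emp_ac_of_prod_ne_zero (G := fun q : (X × Y) × Z => W q.1.1 q.2)
      (right_ne_zero_of_mul h2) ((x, y), z) hw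

/-- The exponents of the source, of the uniform reproduction and of the channel are H(X) + D, about
H(Y|X), and −∑ P log W. They add up to D, the channel cost and the entropy of the triple; the last
is compensated by the size of the type class. -/
lemma typeTerm_bounds (hG : G ∈ stdSimplex ℝ X) (hW : IsChannel W) (hs : SizeBounds X Y Z n δ)
    {p : Fin n → (X × Y) × Z} (hF : Feasible G W c (types n X) (emp p)) :
    Real.exp (n * (-(tripleExponent G W R (emp p)) - entropy (emp p) - δ)) ≤ typeTerm G W R c p ∧
    typeTerm G W R c p ≤
      Real.exp (n * (-(tripleExponent G W R (emp p)) - entropy (emp p) + δ)) := by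
  have hco := hF.coupling
  have hacG := hF.acG
  have hacW := hF.acW
  rw [margFst_margFst_emp, margFst_emp] at hco
  rw [margFst_margFst_emp] at hacG
  have hy : (fun i => (p i).1.2) ∈ condTypeClass c (fun i => (p i).1.1) :=
    mem_condTypeClass.2 hco.symm
  have hT : (0 : ℝ) < (condTypeClass c fun i => (p i).1.1).card := by
    exact_mod_cast Finset.card_pos.2 ⟨_, hy⟩
  have hsz := hs.xy (fun i => (p i).1.1) (fun i => (p i).1.2)
  rw [← card_condTypeClass hy] at hsz
  have e1 := prod_eq_exp_klReal hG.1 hacG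
  have e2 := prod_eq_exp (G := fun q : (X × Y) × Z => W q.1.1 q.2) (fun q => (hW _).1 _)
    (x := p) (by rintro ⟨⟨x, y⟩, z⟩ hw; exact hacW x y z hw)
  have e3 : typeTerm G W R c p = Real.exp (n * (-(tripleExponent G W R (emp p)) - entropy (emp p)
      + (entropy (empPair (fun i => (p i).1.1) (fun i => (p i).1.2))
        - entropy (emp fun i => (p i).1.1)))) *
      (1 / ((condTypeClass c (fun i => (p i).1.1)).card : ℝ)) := by
    rw [typeTerm, ind_true hy, one_mul, e1, e2, tripleExponent, chanCost, margFst_margFst_emp,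
      margFst_emp, margYZ_emp_triple, confExponent]
    rw [mul_comm (1 / _), ← mul_assoc, ← Real.exp_add, ← Real.exp_add]
    congr 2
    ring
  rw [e3, ← mul_div_assoc, mul_one, le_div_iff₀ hT, div_le_iff₀ hT]
  constructor
  · refine (mul_le_mul_of_nonneg_left hsz.2 (Real.exp_pos _).le).trans ?_
    rw [← Real.exp_add, ← mul_add]
    exact exp_mul_le_exp_mul (by linarith)
  · refine le_trans ?_ (mul_le_mul_of_nonneg_left hsz.1 (Real.exp_pos _).le)
    rw [← Real.exp_add, ← mul_add]
    exact exp_mul_le_exp_mul (by linarith)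

lemma sum_exp_neg_entropy_le {A : Type*} [Fintype A] :
    ∑ p : Fin n → A, Real.exp (-(n * entropy (emp p))) ≤ (types n A).card := by
  rw [← Finset.sum_fiberwise_of_maps_to (g := fun p : Fin n → A => emp p)
    (t := types n A) (fun p _ => mem_types p)]
  calc _ ≤ ∑ _τ ∈ types n A, (1 : ℝ) := by
        refine Finset.sum_le_sum fun τ hτ => ?_
        obtain ⟨q, rfl⟩ := exists_emp_of_mem_types hτ
        rw [Finset.sum_congr rfl (g := fun _ => Real.exp (-(n * entropy (emp q)))) (fun p hp => by
          rw [(Finset.mem_filter.1 hp).2]), Finset.sum_const, nsmul_eq_mul, Real.exp_neg,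
          ← div_eq_mul_inv, div_le_one (Real.exp_pos _)]
        refine le_trans (Nat.cast_le.2 (Finset.card_le_card fun p hp => ?_))
          (card_typeClass_upper q)
        exact mem_typeClass.2 (Finset.mem_filter.1 hp).2
    _ = _ := by simp

lemma typeSum_le (hG : G ∈ stdSimplex ℝ X) (hW : IsChannel W) (hs : SizeBounds X Y Z n δ) {a : ℝ}
    (ha : ∀ P : (X × Y) × Z → ℝ, Feasible G W c (types n X) P → a ≤ tripleExponent G W R P) :
    typeSum G W R n c ≤ Real.exp (n * (2 * δ - a)) := by
  rw [typeSum_eq]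
  have h1 : ∀ p : Fin n → (X × Y) × Z, typeTerm G W R c p ≤
      Real.exp (n * (δ - a)) * Real.exp (-(n * entropy (emp p))) := by
    intro p
    by_cases hp : typeTerm G W R c p = 0
    · rw [hp]; positivity
    · have hF := feasible_of_typeTerm_ne_zero hs.pos hp
      refine (typeTerm_bounds hG hW hs hF).2.trans ?_
      rw [← Real.exp_add, ← mul_neg, ← mul_add]
      exact exp_mul_le_exp_mul (by linarith [ha _ hF])
  refine (Finset.sum_le_sum fun p _ => h1 p).trans ?_
  rw [← Finset.mul_sum]
  refine (mul_le_mul_of_nonneg_left (sum_exp_neg_entropy_le.trans hs.card_xyz)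
    (Real.exp_pos _).le).trans (le_of_eq ?_)
  rw [← Real.exp_add, ← mul_add]
  congr 2; ring

lemma le_typeSum (hG : G ∈ stdSimplex ℝ X) (hW : IsChannel W) (hs : SizeBounds X Y Z n δ)
    {p : Fin n → (X × Y) × Z} (hF : Feasible G W c (types n X) (emp p)) :
    Real.exp (n * (-(2 * δ) - tripleExponent G W R (emp p))) ≤ typeSum G W R n c := by
  rw [typeSum_eq]
  refine le_trans ?_ (Finset.sum_le_sum_of_subset_of_nonneg
    (Finset.subset_univ (typeClass n (emp p))) fun q _ _ => typeTerm_nonneg hG hW q)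
  have h1 : ∀ q ∈ typeClass n (emp p),
      Real.exp (n * (-(tripleExponent G W R (emp p)) - entropy (emp p) - δ)) ≤
        typeTerm G W R c q := by
    intro q hq
    have e := mem_typeClass.1 hq
    have := (typeTerm_bounds (R := R) hG hW hs (p := q) (by rwa [e])).1
    rwa [e] at this
  refine le_trans ?_ (Finset.sum_le_sum h1)
  rw [Finset.sum_const, nsmul_eq_mul]
  refine le_trans (le_of_eq ?_) (mul_le_mul_of_nonneg_right (hs.xyz p) (Real.exp_pos _).le)
  rw [← Real.exp_add, ← mul_add]
  congr 2; ring

lemma Admissible.errorProb_le (h : Admissible ι Δ ε n c) (hG : G ∈ stdSimplex ℝ X)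
    (hW : IsChannel W) (hs : SizeBounds X Y Z n δ) (hδ : 0 < δ) (hΔ : 0 < Δ) (hΔ1 : Δ ≤ 1)
    (hb : avg (fun ω : Ensemble n Δ c => ind (¬ GoodEncoder Z ι δ ω)) ≤ 1 / 2) {a : ℝ}
    (ha : ∀ P : (X × Y) × Z → ℝ, Feasible G W c (types n X) P → a ≤ tripleExponent G W R P) :
    errorProb G W R ι n Δ c ≤
      avg (fun ω : Ensemble n Δ c => ind (¬ GoodEncoder Z ι δ ω)) +
        Real.exp (n * (2 * √Δ + 8 * δ - a)) := by
  rw [errorProb_eq_avg hG]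
  refine (avg_mono fun ω => h.errorTerm_le hG hW hs hδ hΔ hΔ1 ω).trans ?_
  rw [avg_add, avg_const_mul]
  refine add_le_add le_rfl ?_
  refine (mul_le_mul_of_nonneg_left ((h.avg_encoderSum_bounds hG hW hb).2.trans
    (typeSum_le hG hW hs ha)) (Real.exp_pos _).le).trans (le_of_eq ?_)
  rw [← Real.exp_add, ← mul_add]
  congr 2; ring

lemma Admissible.le_errorProb (h : Admissible ι Δ ε n c) (hG : G ∈ stdSimplex ℝ X)
    (hW : IsChannel W) (hR : 0 < R) (hs : SizeBounds X Y Z n δ) (hδ : 0 < δ) (hΔ : 0 < Δ)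
    (hΔ1 : Δ ≤ 1) (hb : avg (fun ω : Ensemble n Δ c => ind (¬ GoodEncoder Z ι δ ω)) ≤ 1 / 2)
    {p : Fin n → (X × Y) × Z} (hF : Feasible G W c (types n X) (emp p)) :
    1 / 2 * Real.exp (n * (-(√Δ + 15 * δ) - tripleExponent G W R (emp p))) -
      avg (fun ω : Ensemble n Δ c => ind (¬ GoodEncoder Z ι δ ω)) ≤ errorProb G W R ι n Δ c := by
  rw [errorProb_eq_avg hG]
  refine le_trans ?_ (avg_mono fun ω => h.le_errorTerm hG hW hR hs hδ hΔ hΔ1 ω)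
  rw [avg_sub, avg_const_mul]
  refine sub_le_sub_right ?_ _
  refine le_trans (le_of_eq ?_) (mul_le_mul_of_nonneg_left ((mul_le_mul_of_nonneg_left
    (le_typeSum hG hW hs hF) (by norm_num)).trans (h.avg_encoderSum_bounds hG hW hb).1)
    (Real.exp_pos _).le)
  rw [mul_left_comm, ← Real.exp_add, ← mul_add]
  congr 3; ring

end TypeSum

/-! ### The exponent for an arbitrary admissible choice -/

section Exponent

open Classical

variable {X Y Z : Type*} [Fintype X] [Fintype Y] [Fintype Z]
variable {n : ℕ} {Δ ε δ : ℝ} {c : (X → ℝ) → (X × Y → ℝ)} {ι : X ↪ Y}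
variable {G : X → ℝ} {W : X → Z → ℝ} {R : ℝ}

/-- Since e^{nδ} ≥ (nδ)²/2 outgrows every linear function of n, the doubly exponential factor
absorbs the number of tuples and any prescribed exponential rate K. -/
lemma eventually_tupleCard_mul_le (X Y Z : Type*) [Fintype X] [Fintype Y] [Fintype Z] (K : ℝ)
    {δ : ℝ} (hδ : 0 < δ) :
    ∀ᶠ n : ℕ in Filter.atTop,
      5 * (tupleCard X Y Z n * Real.exp (-Real.exp (n * δ))) ≤ Real.exp (-(n * K)) := by
  set L : ℝ := (((Fintype.card X + 1) * (Fintype.card Y + 1) * (Fintype.card Z + 1) : ℕ) : ℝ) with hL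
  have hL0 : 0 < L := by rw [hL]; positivity
  set C : ℝ := Real.log 5 + |Real.log L + K| with hC
  have h1 : Filter.Tendsto (fun n : ℕ => (n : ℝ) * (δ ^ 2 / 2)) Filter.atTop Filter.atTop :=
    tendsto_natCast_atTop_atTop.atTop_mul_const (by positivity)
  filter_upwards [h1.eventually_ge_atTop C, Filter.eventually_ge_atTop 1] with n hn hn1
  have hn1' : (1 : ℝ) ≤ n := by exact_mod_cast hn1
  have e1 : (tupleCard X Y Z n : ℝ) = Real.exp (n * Real.log L) := by
    rw [tupleCard, Nat.cast_pow, ← hL, mul_comm, Real.exp_mul, Real.exp_log hL0, Real.rpow_natCast]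
  have e2 : (5 : ℝ) = Real.exp (Real.log 5) := (Real.exp_log (by norm_num)).symm
  rw [e1, e2, ← Real.exp_add, ← Real.exp_add, Real.exp_le_exp]
  have h2 := Real.quadratic_le_exp_of_nonneg (x := n * δ) (by positivity)
  have h3 : (0 : ℝ) ≤ n * δ := by positivity
  have h4 : n * C ≤ n * (n * (δ ^ 2 / 2)) := mul_le_mul_of_nonneg_left hn (by positivity)
  have h5 : n * (Real.log L + K) ≤ n * |Real.log L + K| :=
    mul_le_mul_of_nonneg_left (le_abs_self _) (by positivity)
  have h6 : 0 ≤ Real.log 5 := Real.log_nonneg (by norm_num)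
  rw [hC] at h4
  nlinarith [mul_le_mul_of_nonneg_right hn1' h6]

lemma Admissible.mem_simplex (h : Admissible ι Δ ε n c) (hn : 0 < n) {q : X → ℝ}
    (hq : q ∈ types n X) : c q ∈ stdSimplex ℝ (X × Y) := by
  obtain ⟨w, hw⟩ := exists_emp_of_mem_types (h.isType q hq)
  rw [← hw]; exact emp_mem hn w

lemma Admissible.exists_feasible (h : Admissible ι Δ ε n c) (hn : 0 < n)
    (hG : G ∈ stdSimplex ℝ X) (hW : IsChannel W) :
    ∃ P : (X × Y) × Z → ℝ, Feasible G W c (types n X) P := by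
  obtain ⟨v, hv, -⟩ := exists_type hn hG
  exact ⟨_, feasible_chanTriple hW (mem_types v)
    ⟨h.mem_simplex hn (mem_types v), h.marginal _ (mem_types v)⟩ hv⟩

lemma Admissible.exponent_isGLB (h : Admissible ι Δ ε n c) (hn : 0 < n)
    (hG : G ∈ stdSimplex ℝ X) (hW : IsChannel W) (hR : 0 ≤ R) :
    exponent G W R c (types n X) ≠ ⊤ ∧
      IsGLB (tripleExponent G W R '' {P | Feasible G W c (types n X) P})
        (exponent G W R c (types n X)).toReal :=
  VQIdent.exponent_isGLB hG hW hR (fun q hq => ⟨h.mem_simplex hn hq, h.marginal q hq⟩)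
    (h.exists_feasible hn hG hW)

/-- The (X,Y)-marginal is already a type by admissibility, so only the conditional law of Z is
rounded; the coupling constraint is kept exactly and the support does not grow. -/
lemma Admissible.exists_feasible_emp (h : Admissible ι Δ ε n c) (hn : 0 < n)
    {P : (X × Y) × Z → ℝ} (hP : Feasible G W c (types n X) P) :
    ∃ p : Fin n → (X × Y) × Z, Feasible G W c (types n X) (emp p) ∧
      ∀ q, |emp p q - P q| ≤ Fintype.card Z / n := by
  obtain ⟨u, hu⟩ := exists_emp_of_mem_types (h.isType _ hP.mem_set)
  rw [hP.coupling] at hu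
  obtain ⟨v, hv1, hv2⟩ := exists_joint_type hn hP.mem_simplex hu.symm
  have e : margFst (emp fun i => (u i, v i)) = margFst P := (margFst_empPair u v).trans hu
  refine ⟨fun i => (u i, v i), ⟨emp_mem hn _, ?_, ?_, ?_, ?_⟩, hv2⟩
  · rw [e]; exact hP.mem_set
  · rw [e]; exact hP.coupling
  · rw [e]; exact hP.acG
  · intro x y z hw
    exact hv1 _ (hP.acW x y z hw)

lemma exists_tripleExponent_le (G : X → ℝ) (W : X → Z → ℝ) (R : ℝ) :
    ∃ K : ℝ, 0 ≤ K ∧ ∀ P ∈ stdSimplex ℝ ((X × Y) × Z), tripleExponent G W R P ≤ K := by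
  obtain ⟨K, hK⟩ := (isCompact_stdSimplex ℝ ((X × Y) × Z)).bddAbove_image
    (continuous_tripleExponent G W R).continuousOn
  exact ⟨max K 0, le_max_right _ _, fun P hP =>
    (hK (Set.mem_image_of_mem _ hP)).trans (le_max_left _ _)⟩

lemma exists_tripleExponent_close (G : X → ℝ) (W : X → Z → ℝ) (R : ℝ) {δ : ℝ} (hδ : 0 < δ) :
    ∃ r : ℝ, 0 < r ∧ ∀ P ∈ stdSimplex ℝ ((X × Y) × Z), ∀ P' ∈ stdSimplex ℝ ((X × Y) × Z),
      (∀ p, |P p - P' p| ≤ r) → tripleExponent G W R P ≤ tripleExponent G W R P' + δ := by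
  have h := (isCompact_stdSimplex ℝ ((X × Y) × Z)).uniformContinuousOn_of_continuous
    (continuous_tripleExponent G W R).continuousOn
  obtain ⟨r, hr, H⟩ := Metric.uniformContinuousOn_iff.1 h δ hδ
  refine ⟨r / 2, by positivity, fun P hP P' hP' hd => ?_⟩
  have h1 := H P hP P' hP' (lt_of_le_of_lt ((dist_pi_le_iff (half_pos hr).le).2 fun p => by
    rw [Real.dist_eq]; exact hd p) (half_lt_self hr))
  rw [Real.dist_eq] at h1
  linarith [(abs_lt.1 h1).2]

lemma eventually_card_div_le (k : ℕ) {r : ℝ} (hr : 0 < r) :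
    ∀ᶠ n : ℕ in Filter.atTop, (k : ℝ) / n ≤ r :=
  (tendsto_const_div_atTop_nhds_zero_nat (k : ℝ)).eventually_le_const hr

/-- The upper bound uses that T is at least the exponent at every feasible triple, the lower bound a
nearly optimal triple rounded to a type. All thresholds on n depend on δ, Δ and the uniform bound K
only, hence the uniformity over admissible choices. -/
theorem errorProb_exponent (ι : X ↪ Y) (hG : G ∈ stdSimplex ℝ X) (hW : IsChannel W)
    (hR : 0 < R) (hΔ : 0 < Δ) (hΔ1 : Δ ≤ 1) (hε : 0 < ε) {η : ℝ} (hη : 0 < η) :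
    ∀ᶠ n : ℕ in Filter.atTop, ∀ c : (X → ℝ) → (X × Y → ℝ), Admissible ι Δ ε n c →
      exponent G W R c (types n X) ≠ ⊤ ∧ 0 < errorProb G W R ι n Δ c ∧
      |-Real.log (errorProb G W R ι n Δ c) / n - (exponent G W R c (types n X)).toReal| ≤
        2 * √Δ + η := by
  obtain ⟨K, hK0, hK⟩ := exists_tripleExponent_le (Y := Y) G W R
  -- The first two bounds are for concentration of the code and of the fibres; 19δ is the total loss
  -- in the lower bound, including constant factors.
  obtain ⟨δ, hδ, hδΔ, hδε, hδη⟩ : ∃ δ : ℝ, 0 < δ ∧ 3 * δ ≤ Δ ∧ 7 * δ ≤ 3 * ε ∧ 19 * δ ≤ η := by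
    refine ⟨min (Δ / 3) (min (3 * ε / 7) (η / 19)), by positivity, ?_, ?_, ?_⟩
    · linarith [min_le_left (Δ / 3) (min (3 * ε / 7) (η / 19))]
    · linarith [(min_le_right (Δ / 3) (min (3 * ε / 7) (η / 19))).trans (min_le_left _ _)]
    · linarith [(min_le_right (Δ / 3) (min (3 * ε / 7) (η / 19))).trans (min_le_right _ _)]
  obtain ⟨r, hr, hclose⟩ := exists_tripleExponent_close (Y := Y) G W R hδ
  filter_upwards [eventually_sizeBounds X Y Z hδ,
    eventually_tupleCard_mul_le X Y Z (K + √Δ + 19 * δ) hδ, eventually_le_exp 2 hδ,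
    eventually_card_div_le (Fintype.card Z) hr] with n hs hB h2 hz c h
  have hn := hs.pos
  have hn' : (0 : ℝ) < n := by exact_mod_cast hn
  obtain ⟨htop, hglb⟩ := h.exponent_isGLB (Z := Z) hn hG hW hR.le
  set E := (exponent G W R c (types n X)).toReal
  have hbad := (h.avg_not_goodEncoder hs hδ hδΔ hδε).trans hB
  set b := avg (fun ω : Ensemble n Δ c => ind (¬ GoodEncoder Z ι δ ω))
  have hs0 := Real.sqrt_nonneg Δ
  have hE : ∀ P : (X × Y) × Z → ℝ, Feasible G W c (types n X) P → E ≤ tripleExponent G W R P :=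
    fun P hP => hglb.1 ⟨P, hP, rfl⟩
  obtain ⟨_, ⟨P, hP, rfl⟩, -, hPE⟩ := hglb.exists_between (b := E + δ) (by linarith)
  have hEK : E ≤ K := (hE P hP).trans (hK P hP.mem_simplex)
  -- The exponent E is at most K uniformly in the choice c, so bad encoders are negligible even
  -- against the error probability itself.
  have hb1 : b ≤ Real.exp (n * (-√Δ - 19 * δ - E)) := by
    refine hbad.trans ?_
    rw [← mul_neg]; exact exp_mul_le_exp_mul (by linarith)
  have hb2 : b ≤ 1 / 2 := by
    refine hbad.trans ?_
    rw [← mul_neg]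
    refine (exp_mul_le_exp_mul (b := -δ) (by linarith)).trans ?_
    rw [mul_neg, Real.exp_neg, inv_le_comm₀ (Real.exp_pos _) (by norm_num)]
    linarith
  obtain ⟨p, hpF, hpc⟩ := h.exists_feasible_emp hn hP
  have hpE : tripleExponent G W R (emp p) ≤ E + 2 * δ := by
    have := hclose _ hpF.mem_simplex _ hP.mem_simplex fun q => (hpc q).trans hz
    linarith
  have hlow : Real.exp (n * (-√Δ - 19 * δ - E)) ≤ errorProb G W R ι n Δ c := by
    have h1 := h.le_errorProb hG hW hR hs hδ hΔ hΔ1 hb2 hpF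
    have h3 : Real.exp (n * (-√Δ - 17 * δ - E)) ≤
        Real.exp (n * (-(√Δ + 15 * δ) - tripleExponent G W R (emp p))) :=
      exp_mul_le_exp_mul (by linarith)
    have h4 : Real.exp (n * (-√Δ - 17 * δ - E)) =
        Real.exp (n * δ) * Real.exp (n * δ) * Real.exp (n * (-√Δ - 19 * δ - E)) := by
      rw [← Real.exp_add, ← Real.exp_add]; congr 1; ring
    have h5 := Real.exp_pos (n * (-√Δ - 19 * δ - E))
    have h6 : 4 * Real.exp (n * (-√Δ - 19 * δ - E)) ≤ Real.exp (n * (-√Δ - 17 * δ - E)) := by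
      rw [h4]; exact mul_le_mul_of_nonneg_right (by nlinarith) h5.le
    linarith
  have hup : errorProb G W R ι n Δ c ≤ Real.exp (n * (2 * √Δ + 9 * δ - E)) := by
    have h1 := h.errorProb_le hG hW hs hδ hΔ hΔ1 hb2 hE
    have h3 : b ≤ Real.exp (n * (2 * √Δ + 8 * δ - E)) :=
      hb1.trans (exp_mul_le_exp_mul (by linarith))
    have h4 : Real.exp (n * (2 * √Δ + 9 * δ - E)) =
        Real.exp (n * δ) * Real.exp (n * (2 * √Δ + 8 * δ - E)) := by
      rw [← Real.exp_add]; congr 1; ring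
    rw [h4]
    nlinarith [Real.exp_pos (n * (2 * √Δ + 8 * δ - E))]
  have hpos : 0 < errorProb G W R ι n Δ c := (Real.exp_pos _).trans_le hlow
  refine ⟨htop, hpos, ?_⟩
  have hl1 := (Real.le_log_iff_exp_le hpos).2 hlow
  have hl2 := (Real.log_le_iff_le_exp hpos).2 hup
  rw [abs_le]
  constructor
  · rw [le_sub_iff_add_le, le_div_iff₀ hn']
    nlinarith
  · rw [sub_le_iff_le_add, div_le_iff₀ hn']
    nlinarith

end Exponent

/-! ### Comparison of exponents for nearby choices of conditional types -/

section Comparison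

open Classical

variable {X Y Z : Type*} [Fintype X] [Fintype Y] [Fintype Z]
variable {n : ℕ} {Δ ε δ : ℝ} {c : (X → ℝ) → (X × Y → ℝ)} {ι : X ↪ Y}
variable {G : X → ℝ} {W : X → Z → ℝ} {R : ℝ} {U U' : (X → ℝ) → (X × Y → ℝ)} {S S' : Set (X → ℝ)}

/-- The joint distribution with `(X, Y)`-marginal `Q` and the conditional law `P_{Z|XY}`
(continued by `W` where it is undefined). -/
def rebase (P : (X × Y) × Z → ℝ) (W : X → Z → ℝ) (Q : X × Y → ℝ) : (X × Y) × Z → ℝ :=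
  fun p => Q p.1 * (if margFst P p.1 = 0 then W p.1.1 p.2 else P p / margFst P p.1)

lemma rebase_kernel_mem (hW : IsChannel W) {P : (X × Y) × Z → ℝ}
    (hP : P ∈ stdSimplex ℝ ((X × Y) × Z)) (q : X × Y) :
    (fun z => if margFst P q = 0 then W q.1 z else P (q, z) / margFst P q) ∈ stdSimplex ℝ Z := by
  by_cases h : margFst P q = 0
  · simp only [h, if_true]; exact hW q.1
  · simp only [h, if_false]
    exact ⟨fun z => div_nonneg (hP.1 _) ((margFst_mem hP).1 q), by
      rw [← Finset.sum_div]; exact div_self h⟩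

lemma margFst_rebase (hW : IsChannel W) {P : (X × Y) × Z → ℝ}
    (hP : P ∈ stdSimplex ℝ ((X × Y) × Z)) (Q : X × Y → ℝ) : margFst (rebase P W Q) = Q := by
  funext q
  rw [← mul_one (Q q), ← (rebase_kernel_mem hW hP q).2, Finset.mul_sum]
  rfl

lemma rebase_mem (hW : IsChannel W) {P : (X × Y) × Z → ℝ}
    (hP : P ∈ stdSimplex ℝ ((X × Y) × Z)) {Q : X × Y → ℝ} (hQ : Q ∈ stdSimplex ℝ (X × Y)) :
    rebase P W Q ∈ stdSimplex ℝ ((X × Y) × Z) :=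
  ⟨fun p => mul_nonneg (hQ.1 _) ((rebase_kernel_mem hW hP p.1).1 p.2), by
    rw [Fintype.sum_prod_type, ← hQ.2]
    exact Finset.sum_congr rfl fun q _ => congrFun (margFst_rebase hW hP Q) q⟩

/-- Only the (X,Y)-marginal changes, and it is multiplied by kernel entries in [0, 1]; where the
marginal of P vanishes, P does too. -/
lemma abs_rebase_sub_le (hW : IsChannel W) {P : (X × Y) × Z → ℝ}
    (hP : P ∈ stdSimplex ℝ ((X × Y) × Z)) (Q : X × Y → ℝ) (p : (X × Y) × Z) :
    |rebase P W Q p - P p| ≤ |Q p.1 - margFst P p.1| := by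
  have hk := rebase_kernel_mem hW hP p.1
  set k : ℝ := if margFst P p.1 = 0 then W p.1.1 p.2 else P p / margFst P p.1 with hkdef
  have hk0 : 0 ≤ k := hk.1 p.2
  have hk1 : k ≤ 1 := by
    rw [← hk.2]
    exact Finset.single_le_sum (f := fun z => if margFst P p.1 = 0 then W p.1.1 z
      else P (p.1, z) / margFst P p.1) (fun z _ => hk.1 z) (Finset.mem_univ p.2)
  have e : P p = margFst P p.1 * k := by
    by_cases h : margFst P p.1 = 0
    · rw [h, zero_mul]
      exact (Finset.sum_eq_zero_iff_of_nonneg fun z _ => hP.1 (p.1, z)).1 h p.2 (Finset.mem_univ _)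
    · rw [hkdef, if_neg h, mul_div_cancel₀ _ h]
  have e2 : rebase P W Q p - P p = (Q p.1 - margFst P p.1) * k := by
    rw [sub_mul, ← e]; rfl
  rw [e2, abs_mul, abs_of_nonneg hk0]
  exact mul_le_of_le_one_right (abs_nonneg _) hk1

lemma Feasible.rebase (hW : IsChannel W) {P : (X × Y) × Z → ℝ} (h : Feasible G W U S P)
    {q : X → ℝ} (hq : q ∈ S') (hU : U' q ∈ stdSimplex ℝ (X × Y) ∧ margFst (U' q) = q)
    (hac : ∀ a, G a = 0 → q a = 0) :
    Feasible G W U' S' (VQIdent.rebase P W (U' q)) := by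
  have e := margFst_rebase hW h.mem_simplex (U' q)
  refine ⟨rebase_mem hW h.mem_simplex hU.1, by rwa [e, hU.2], by rw [e, hU.2], by rwa [e, hU.2],
    fun x y z h0 => ?_⟩
  simp only [VQIdent.rebase]
  split_ifs
  · rw [h0, mul_zero]
  · rw [h.acW x y z h0, zero_div, mul_zero]

/-- If the entropy of the `X`-marginal is small, the coupling hardly matters. -/
lemma Feasible.tripleExponent_chanTriple_le (hW : IsChannel W)
    {P : (X × Y) × Z → ℝ} (h : Feasible G W U S P) {Q : X × Y → ℝ}
    (hQ : Q ∈ stdSimplex ℝ (X × Y)) (hQX : margFst Q = margFst (margFst P)) :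
    tripleExponent G W R (chanTriple Q W) ≤
      tripleExponent G W R P + entropy (margFst (margFst P)) := by
  have hH : 0 ≤ entropy (margFst (margFst P)) :=
    entropy_nonneg (margFst_mem (margFst_mem h.mem_simplex))
  have h1 := chanCost_nonneg hW h.mem_simplex h.acW
  have h2 := mutualInfo_nonneg (margFst_mem h.mem_simplex)
  have h3 : 0 ≤ mutualInfo (margYZ P) := mutualInfo_nonneg (margYZ_mem h.mem_simplex)
  have h4 := mutualInfo_le_entropy hQ
  rw [hQX] at h4
  rw [tripleExponent, tripleExponent, chanCost_chanTriple Q hW, margFst_chanTriple Q hW, hQX]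
  set D := klReal G (margFst (margFst P))
  have h5 := min_le_left (mutualInfo Q) (mutualInfo (margYZ (chanTriple Q W)))
  have h6 := le_min h2 h3
  have h7 := le_max_left 0
    (D + min (mutualInfo (margFst P)) (mutualInfo (margYZ P)) - R)
  have h8 := le_max_right 0
    (D + min (mutualInfo (margFst P)) (mutualInfo (margYZ P)) - R)
  -- Both minima lie above zero and the new one is at most I(X;Y) ≤ H(X), so the bracket grows by at
  -- most H(X).
  have h9 : max 0 (D + min (mutualInfo Q) (mutualInfo (margYZ (chanTriple Q W))) - R) ≤
      max 0 (D + min (mutualInfo (margFst P)) (mutualInfo (margYZ P)) - R)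
        + entropy (margFst (margFst P)) := max_le (by linarith) (by linarith)
  linarith

lemma Feasible.exists_feasible_of_close (hW : IsChannel W) {r : ℝ}
    (hclose : ∀ P ∈ stdSimplex ℝ ((X × Y) × Z), ∀ P' ∈ stdSimplex ℝ ((X × Y) × Z),
      (∀ p, |P p - P' p| ≤ r) → tripleExponent G W R P ≤ tripleExponent G W R P' + δ)
    {P : (X × Y) × Z → ℝ} (h : Feasible G W U S P)
    {q : X → ℝ} (hq : q ∈ S') (hU : U' q ∈ stdSimplex ℝ (X × Y) ∧ margFst (U' q) = q)
    (hac : ∀ a, G a = 0 → q a = 0) (hr : ∀ p, |U' q p - margFst P p| ≤ r) :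
    ∃ P', Feasible G W U' S' P' ∧ margFst (margFst P') = q ∧
      tripleExponent G W R P' ≤ tripleExponent G W R P + δ :=
  ⟨_, h.rebase hW hq hU hac, by rw [margFst_rebase hW h.mem_simplex, hU.2],
    hclose _ (rebase_mem hW h.mem_simplex hU.1) _ h.mem_simplex fun p =>
      (abs_rebase_sub_le hW h.mem_simplex _ p).trans (hr _)⟩

/-- Passing between couplings that agree approximately at `X`-marginals of large entropy. -/
lemma Feasible.exists_feasible_of_high (hW : IsChannel W) {r s : ℝ} (hδ : 0 ≤ δ) (hs : 0 ≤ s)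
    (hclose : ∀ P ∈ stdSimplex ℝ ((X × Y) × Z), ∀ P' ∈ stdSimplex ℝ ((X × Y) × Z),
      (∀ p, |P p - P' p| ≤ r) → tripleExponent G W R P ≤ tripleExponent G W R P' + δ)
    {P : (X × Y) × Z → ℝ} (h : Feasible G W U S P) (hS : margFst (margFst P) ∈ S')
    (hU : U' (margFst (margFst P)) ∈ stdSimplex ℝ (X × Y) ∧
      margFst (U' (margFst (margFst P))) = margFst (margFst P))
    (hr : s ≤ entropy (margFst (margFst P)) →
      ∀ p, |U' (margFst (margFst P)) p - U (margFst (margFst P)) p| ≤ r) :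
    ∃ P', Feasible G W U' S' P' ∧ tripleExponent G W R P' ≤ tripleExponent G W R P + (δ + s) := by
  rcases le_or_gt s (entropy (margFst (margFst P))) with hH | hH
  · obtain ⟨P', h1, -, h2⟩ := h.exists_feasible_of_close hW hclose hS hU h.acG (by
      have := hr hH
      rwa [h.coupling] at this)
    exact ⟨P', h1, by linarith⟩
  · refine ⟨_, feasible_chanTriple hW hS hU h.acG, ?_⟩
    have := h.tripleExponent_chanTriple_le (R := R) hW hU.1 hU.2
    linarith

theorem exponent_isGLB_simplex (hG : G ∈ stdSimplex ℝ X) (hW : IsChannel W) (hR : 0 ≤ R)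
    (hU : ∀ q ∈ stdSimplex ℝ X, U q ∈ stdSimplex ℝ (X × Y) ∧ margFst (U q) = q) :
    exponent G W R U (stdSimplex ℝ X) ≠ ⊤ ∧
      IsGLB (tripleExponent G W R '' {P | Feasible G W U (stdSimplex ℝ X) P})
        (exponent G W R U (stdSimplex ℝ X)).toReal :=
  exponent_isGLB hG hW hR hU ⟨_, feasible_chanTriple hW hG (hU G hG) fun _ h => h⟩

lemma isGLB_le_add_of_forall_exists {α : Type*} {f : α → ℝ} {s t : Set α} {a b θ : ℝ}
    (ha : IsGLB (f '' s) a) (hb : IsGLB (f '' t) b)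
    (h : ∀ y ∈ t, ∃ x ∈ s, f x ≤ f y + θ) : a ≤ b + θ := by
  have : a - θ ≤ b := hb.2 (by
    rintro _ ⟨y, hy, rfl⟩
    obtain ⟨x, hx, hxy⟩ := h y hy
    linarith [ha.1 (Set.mem_image_of_mem f hx)])
  linarith

/-- Feasible triples are carried between the two problems at a loss of at most √Δ + η in T.
Convergence of c_n to U is known only at entropies of at least √Δ; below, the triple is replaced by
one driven by W. -/
theorem exponent_types_close (hG : G ∈ stdSimplex ℝ X) (hW : IsChannel W) (hR : 0 ≤ R)
    (hU : ∀ q ∈ stdSimplex ℝ X, U q ∈ stdSimplex ℝ (X × Y) ∧ margFst (U q) = q)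
    (hUc : ContinuousOn U (stdSimplex ℝ X)) {c : ℕ → (X → ℝ) → (X × Y → ℝ)}
    (hc : ∀ᶠ n : ℕ in Filter.atTop, Admissible ι Δ ε n (c n))
    (hcU : ∀ δ : ℝ, 0 < δ → ∀ᶠ n : ℕ in Filter.atTop, ∀ q ∈ types n X,
      √Δ ≤ entropy q → ∀ p, |c n q p - U q p| ≤ δ) {η : ℝ} (hη : 0 < η) :
    ∀ᶠ n : ℕ in Filter.atTop,
      |(exponent G W R (c n) (types n X)).toReal - (exponent G W R U (stdSimplex ℝ X)).toReal| ≤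
        √Δ + η := by
  obtain ⟨r, hr, hclose⟩ := exists_tripleExponent_close (Y := Y) G W R (half_pos hη)
  obtain ⟨ρ, hρ, hUρ⟩ := Metric.uniformContinuousOn_iff.1
    ((isCompact_stdSimplex ℝ X).uniformContinuousOn_of_continuous hUc) r hr
  have hglb := (exponent_isGLB_simplex hG hW hR hU).2
  filter_upwards [hc, hcU r hr, Filter.eventually_gt_atTop 0,
    eventually_card_div_le (Fintype.card X) (half_pos hρ)] with n h hd hn hx
  have hglb' := (h.exponent_isGLB (Z := Z) hn hG hW hR).2
  have hT : ∀ q ∈ types n X, q ∈ stdSimplex ℝ X := fun q hq => by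
    obtain ⟨v, rfl⟩ := exists_emp_of_mem_types hq
    exact emp_mem hn v
  have h1 := isGLB_le_add_of_forall_exists (θ := η / 2 + √Δ) hglb hglb' fun P hP =>
    Feasible.exists_feasible_of_high hW (half_pos hη).le (Real.sqrt_nonneg Δ) hclose hP
      (hT _ hP.mem_set) (hU _ (hT _ hP.mem_set)) fun hH p => by
        rw [abs_sub_comm]; exact hd _ hP.mem_set hH p
  -- Two moves of cost η/2 and η/2 + √Δ: first the X-marginal is rounded to a type within its
  -- support, with U still as the coupling, then U is exchanged for c_n.
  have h2 := isGLB_le_add_of_forall_exists (θ := η + √Δ) hglb' hglb fun P hP => by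
    obtain ⟨v, hv1, hv2⟩ := exists_type hn hP.mem_set
    have hvs := emp_mem hn v
    obtain ⟨P₁, hP₁, e, hA₁⟩ := Feasible.exists_feasible_of_close hW hclose hP hvs (hU _ hvs)
      (fun a ha => hv1 a (hP.acG a ha)) fun p => by
        have h3 : dist (emp v) (margFst (margFst P)) < ρ :=
          lt_of_le_of_lt ((dist_pi_le_iff (half_pos hρ).le).2 fun a => by
            rw [Real.dist_eq]; exact (hv2 a).trans hx) (half_lt_self hρ)
        have h4 := (dist_le_pi_dist _ _ p).trans (hUρ _ hvs _ hP.mem_set h3).le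
        rwa [Real.dist_eq, hP.coupling] at h4
    have hq : margFst (margFst P₁) ∈ types n X := by rw [e]; exact mem_types v
    obtain ⟨P₂, hP₂, hA₂⟩ := Feasible.exists_feasible_of_high (S' := (types n X : Set (X → ℝ)))
      hW (half_pos hη).le (Real.sqrt_nonneg Δ) hclose hP₁ hq
      ⟨h.mem_simplex hn hq, h.marginal _ hq⟩ fun hH p => hd _ hq hH p
    exact ⟨P₂, hP₂, by linarith⟩
  rw [abs_le]
  constructor <;> linarith

end Comparison

end

end VQIdent

/-! ### The two claims of the theorem -/

theorem theorem1 {X Y Z : Type*} [Fintype X] [Fintype Y] [Fintype Z]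
    (ι : X ↪ Y)
    (G : X → ℝ) (hG : G ∈ stdSimplex ℝ X)
    (W : X → Z → ℝ) (hW : VQIdent.IsChannel W)
    (R : ℝ) (hR : 0 < R) :
    -- an arbitrary choice of conditional types, at every block length
    (∀ η : ℝ, 0 < η → ∃ Δ₀ : ℝ, 0 < Δ₀ ∧ ∀ Δ : ℝ, 0 < Δ → Δ < Δ₀ → ∀ ε : ℝ, 0 < ε →
      ∀ᶠ n : ℕ in Filter.atTop, ∀ c : (X → ℝ) → (X × Y → ℝ), VQIdent.Admissible ι Δ ε n c →
        VQIdent.exponent G W R c (VQIdent.types n X) ≠ ⊤ ∧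
        0 < VQIdent.errorProb G W R ι n Δ c ∧
        |-Real.log (VQIdent.errorProb G W R ι n Δ c) / n
          - (VQIdent.exponent G W R c (VQIdent.types n X)).toReal| ≤ η) ∧
    -- a choice that follows a continuous functional `U : Q_X ↦ Q_{XY}`
    (∀ U : (X → ℝ) → (X × Y → ℝ),
      (∀ QX ∈ stdSimplex ℝ X, U QX ∈ stdSimplex ℝ (X × Y) ∧ VQIdent.margFst (U QX) = QX) →
      ContinuousOn U (stdSimplex ℝ X) →
      VQIdent.exponent G W R U (stdSimplex ℝ X) ≠ ⊤ ∧
      ∀ η : ℝ, 0 < η → ∃ Δ₀ : ℝ, 0 < Δ₀ ∧ ∀ Δ : ℝ, 0 < Δ → Δ < Δ₀ → ∀ ε : ℝ, 0 < ε →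
        ∀ c : ℕ → (X → ℝ) → (X × Y → ℝ),
          (∀ᶠ n : ℕ in Filter.atTop, VQIdent.Admissible ι Δ ε n (c n)) →
          (∀ δ : ℝ, 0 < δ → ∀ᶠ n : ℕ in Filter.atTop, ∀ QX ∈ VQIdent.types n X,
            √Δ ≤ VQIdent.entropy QX → ∀ p, |c n QX p - U QX p| ≤ δ) →
          ∀ᶠ n : ℕ in Filter.atTop,
            0 < VQIdent.errorProb G W R ι n Δ (c n) ∧
            |-Real.log (VQIdent.errorProb G W R ι n Δ (c n)) / n
              - (VQIdent.exponent G W R U (stdSimplex ℝ X)).toReal| ≤ η) := by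
  -- The error budgets are 2√Δ + η/2 in the first claim and (2√Δ + η/4) + (√Δ + η/4) in the second,
  -- whence √Δ ≤ η/4 and √Δ ≤ η/6.
  refine ⟨fun η hη => ⟨min 1 ((η / 4) ^ 2), by positivity, fun Δ hΔ hΔ0 ε hε => ?_⟩,
    fun U hU hUc => ⟨(VQIdent.exponent_isGLB_simplex hG hW hR.le hU).1, fun η hη =>
      ⟨min 1 ((η / 6) ^ 2), by positivity, fun Δ hΔ hΔ0 ε hε c hc hcU => ?_⟩⟩⟩
  · have hs : √Δ ≤ η / 4 :=
      (Real.sqrt_le_left (by positivity)).2 (hΔ0.le.trans (min_le_right _ _))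
    filter_upwards [VQIdent.errorProb_exponent (Z := Z) ι hG hW hR hΔ
      (hΔ0.le.trans (min_le_left _ _)) hε (half_pos hη)] with n h c hc
    obtain ⟨h1, h2, h3⟩ := h c hc
    exact ⟨h1, h2, h3.trans (by linarith)⟩
  · have hs : √Δ ≤ η / 6 :=
      (Real.sqrt_le_left (by positivity)).2 (hΔ0.le.trans (min_le_right _ _))
    have hη4 : 0 < η / 4 := by positivity
    filter_upwards [VQIdent.errorProb_exponent (Z := Z) ι hG hW hR hΔ
      (hΔ0.le.trans (min_le_left _ _)) hε hη4, hc,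
      VQIdent.exponent_types_close hG hW hR.le hU hUc hc hcU hη4] with n h hcn hd
    obtain ⟨-, h2, h3⟩ := h (c n) hcn
    exact ⟨h2, (abs_sub_le _ _ _).trans ((add_le_add h3 hd).trans (by linarith))⟩
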